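/- Machine model. Algorithms are deterministic programs for a random access machine whose memory consists of named registers and arrays of natural numbers and named arrays of real numbers. Operations on natural numbers ($+$, truncated $-$, $\times$, integer division, remainder, comparison, array access) are charged by the bit length of the numbers involved; exact operations $+,-,\times,/$ and comparisons on real numbers have unit cost. Real numbers cannot be rounded to natural numbers. Programs contain only natural constants. Graphs and cuts. Let $G=(V,E)$ be a finite undirected graph (parallel edges and loops are allowed) with $n$ nodes, $m$ edges, edge capacities $c:E\to\mathbb{R}_{\ge 0}$ and $h$ connected components. For a partition $\mathcal P$ of $V$ let $E(\mathcal P)$ be the set of edges with end points in two different parts. A $k$-cut is a set $E(\mathcal P)$ with $|\mathcal P|\ge k$; it is a minimum $k$-cut if its capacity is minimum among all $k$-cuts. The LP. Let $\mathcal T(G)$ be the set of maximal forests of $G$ (its spanning trees, if $G$ is connected). The dual of the $k$-cut LP $\min\{\sum_e c_e x_e : \sum_{e\in T}x_e\ge k-h\ (T\in\mathcal T(G)),\ 0\le x\le 1\}$ is $$\max\ (k-h)\sum_{T\in\mathcal T(G)}y_T-\sum_{e\in E}z_e\quad\text{s.t.}\quad \sum_{T\ni e}y_T\le c_e+z_e\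 (e\in E),\quad y,z\ge 0 .$$ A program solves the $k$-cut LP on $G$ in time $t$ if within time $t$ it writes down an optimum solution $(y,z)$ of this dual whose support has at most $m$ forests (every optimum basic feasible solution has this property), by listing at most $m$ different edge sets that include the support of $y$, their $y$-values, and all values $z_e$. Enumeration. A program enumerates the minimum $k$-cuts of $G$ in time $t$, with reporting time $r$, if within time $t$ it computes a number $N$ and a representation in memory of a list $K_0,\dots,K_{N-1}$ (repetitions allowed) that contains exactly the minimum $k$-cuts of $G$, such that a second program, given $i<N$ and only the natural numbers in the memory (not the capacities or any other real number), writes the characteristic vector of $K_i$ in time $r$. Theorem. For every fixed integer $k>2$ there are constants $C,d$, which depend only on $k$, such that the following holds. For every program $S$ there are an enumerating program and a reporting program such that, for every function $\beta$ and every graph $G$ with $n$ nodes and $m$ edges in which every $k$-cut has positive capacity: if $S$ solves the $k$-cut LP on $G$ in time $\beta(m,n)$, then all minimum $k$-cuts of $G$ are enumerated in time $$C\,\lfloor\log_2(n+m+2)\rfloor^{d}\,\bigl(m\,n^{2k-3}+\beta(m,n)\bigr)=\tilde O\bigl(mn^{2k-3}+\beta(m,n)\bigr),$$ with reporting time $C\,\lfloor\log_2(n+m+2)\rfloor^{d}\,(n+m)=\tilde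 O(n+m)$ per cut. -/

import Mathlib

namespace KCut

/-! ### Capacitated graphs, `k`-cuts, and the dual of the `k`-cut LP -/

/-- A finite undirected graph on the nodes `0, …, n - 1` with edges `0, …, m - 1` (parallel edges
and loops are allowed) and non-negative real edge capacities. The order of the two ends of an edge
carries no meaning. -/
structure CapGraph (n m : ℕ) where
  fst : Fin m → Fin n
  snd : Fin m → Fin n
  cap : Fin m → ℝ
  cap_nonneg : ∀ e, 0 ≤ cap e

namespace CapGraph

variable {n m : ℕ} (G : CapGraph n m)

/-- The capacity `c(A)` of a set of edges. -/
noncomputable def capOf (A : Finset (Fin m)) : ℝ := ∑ e ∈ A, G.cap e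

/-- `E(P)`: the edges whose ends lie in two different parts of the partition `P` of the nodes. -/
def crossing (P : Finpartition (Finset.univ : Finset (Fin n))) : Finset (Fin m) :=
  Finset.univ.filter fun e => P.part (G.fst e) ≠ P.part (G.snd e)

/-- A `k`-cut is a set of edges `E(P)`, for a partition `P` of the nodes with at least `k` parts. -/
def IsKCut (k : ℕ) (A : Finset (Fin m)) : Prop :=
  ∃ P : Finpartition (Finset.univ : Finset (Fin n)), k ≤ P.parts.card ∧ A = G.crossing P

/-- A `k`-cut of minimum capacity. -/
def IsMinKCut (k : ℕ) (A : Finset (Fin m)) : Prop :=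
  G.IsKCut k A ∧ ∀ B, G.IsKCut k B → G.capOf A ≤ G.capOf B

/-- The simple graph on the nodes in which two nodes are adjacent if an edge of `F` joins them. It
serves only to express connectivity in the spanning subgraph with edge set `F`. -/
def span (F : Finset (Fin m)) : SimpleGraph (Fin n) :=
  SimpleGraph.fromRel fun u v => ∃ e ∈ F, G.fst e = u ∧ G.snd e = v

/-- `h`: the number of connected components of the graph. -/
noncomputable def numComponents : ℕ := Nat.card (G.span Finset.univ).ConnectedComponent

/-- `F` contains no cycle: no edge of `F` joins two nodes that the other edges of `F` connect.
(A loop, or two parallel edges, count as a cycle.) -/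
def IsForest (F : Finset (Fin m)) : Prop :=
  ∀ e ∈ F, ¬ (G.span (F.erase e)).Reachable (G.fst e) (G.snd e)

/-- The inclusion-wise maximal forests; these are the spanning trees if the graph is connected. -/
def IsMaximalForest (F : Finset (Fin m)) : Prop := Maximal G.IsForest F

/-- The feasible solutions `(y, z)` of the dual of the `k`-cut LP. There is a variable `y F` for each
maximal forest `F` (`y` is set to `0` on all other sets of edges) and a variable `z e` for each edge,
all of them non-negative, and `∑_{F ∋ e} y F ≤ c e + z e` for each edge `e`. -/
structure DualFeasible (y : Finset (Fin m) → ℝ) (z : Fin m → ℝ) : Prop where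
  y_nonneg : ∀ F, 0 ≤ y F
  y_support : ∀ F, ¬ G.IsMaximalForest F → y F = 0
  z_nonneg : ∀ e, 0 ≤ z e
  packing : ∀ e, ∑ F : Finset (Fin m) with e ∈ F, y F ≤ G.cap e + z e

/-- The dual objective `(k - h) ∑_F y F - ∑_e z e`, which is `(k - 1) ∑_T y T - ∑_e z e` for a
connected graph. -/
noncomputable def dualValue (k : ℕ) (y : Finset (Fin m) → ℝ) (z : Fin m → ℝ) : ℝ :=
  ((k : ℝ) - (G.numComponents : ℝ)) * ∑ F, y F - ∑ e, z e

/-- The optimum solutions of the dual of the `k`-cut LP. -/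
def DualOptimal (k : ℕ) (y : Finset (Fin m) → ℝ) (z : Fin m → ℝ) : Prop :=
  G.DualFeasible y z ∧
    ∀ y' z', G.DualFeasible y' z' → G.dualValue k y' z' ≤ G.dualValue k y z

end CapGraph

/-! ### The machine model

A deterministic random access machine, programmed in a structured language. The memory consists of
named registers and arrays of natural numbers and named arrays of real numbers. Operations on natural
numbers are charged by the number of bits of their operands and results (logarithmic cost, so large
numbers give no advantage), exact operations on real numbers are charged one unit each. Real numbers
can be compared, but they cannot be rounded to or read as natural numbers. -/

/-- The memory of the machine. -/
structure State where
  reg : ℕ → ℕ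
  arr : ℕ → ℕ → ℕ
  rarr : ℕ → ℕ → ℝ

/-- Expressions with values in the natural numbers (`sub` truncates at `0`). -/
inductive NExp where
  | const (c : ℕ)
  | reg (x : ℕ)
  | get (a : ℕ) (i : NExp)
  | add (e f : NExp)
  | sub (e f : NExp)
  | mul (e f : NExp)
  | div (e f : NExp)
  | mod (e f : NExp)

def NExp.eval (s : State) : NExp → ℕ
  | .const c => c
  | .reg x => s.reg x
  | .get a i => s.arr a (i.eval s)
  | .add e f => e.eval s + f.eval s
  | .sub e f => e.eval s - f.eval s
  | .mul e f => e.eval s * f.eval s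
  | .div e f => e.eval s / f.eval s
  | .mod e f => e.eval s % f.eval s

/-- One unit and the bit length of the value, for the expression and each of its subexpressions. -/
def NExp.cost (s : State) : NExp → ℕ
  | .const c => 1 + c.size
  | .reg x => 1 + (s.reg x).size
  | .get a i => 1 + (s.arr a (i.eval s)).size + i.cost s
  | .add e f => 1 + (e.eval s + f.eval s).size + e.cost s + f.cost s
  | .sub e f => 1 + (e.eval s - f.eval s).size + e.cost s + f.cost s
  | .mul e f => 1 + (e.eval s * f.eval s).size + e.cost s + f.cost s
  | .div e f => 1 + (e.eval s / f.eval s).size + e.cost s + f.cost s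
  | .mod e f => 1 + (e.eval s % f.eval s).size + e.cost s + f.cost s

/-- Expressions with values in the real numbers. -/
inductive RExp where
  | ofNat (e : NExp)
  | get (a : ℕ) (i : NExp)
  | add (e f : RExp)
  | sub (e f : RExp)
  | mul (e f : RExp)
  | div (e f : RExp)

noncomputable def RExp.eval (s : State) : RExp → ℝ
  | .ofNat e => (e.eval s : ℝ)
  | .get a i => s.rarr a (i.eval s)
  | .add e f => e.eval s + f.eval s
  | .sub e f => e.eval s - f.eval s
  | .mul e f => e.eval s * f.eval s
  | .div e f => e.eval s / f.eval s

def RExp.cost (s : State) : RExp → ℕ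
  | .ofNat e => 1 + e.cost s
  | .get _ i => 1 + i.cost s
  | .add e f => 1 + e.cost s + f.cost s
  | .sub e f => 1 + e.cost s + f.cost s
  | .mul e f => 1 + e.cost s + f.cost s
  | .div e f => 1 + e.cost s + f.cost s

/-- Tests. -/
inductive BExp where
  | le (e f : NExp)
  | rle (e f : RExp)
  | neg (b : BExp)
  | conj (b c : BExp)

def BExp.holds (s : State) : BExp → Prop
  | .le e f => e.eval s ≤ f.eval s
  | .rle e f => e.eval s ≤ f.eval s
  | .neg b => ¬ b.holds s
  | .conj b c => b.holds s ∧ c.holds s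

def BExp.cost (s : State) : BExp → ℕ
  | .le e f => 1 + e.cost s + f.cost s
  | .rle e f => 1 + e.cost s + f.cost s
  | .neg b => 1 + b.cost s
  | .conj b c => 1 + b.cost s + c.cost s

/-- Programs. The names of registers and arrays are fixed in the program text. -/
inductive Prog where
  | skip
  | setReg (x : ℕ) (e : NExp)
  | store (a : ℕ) (i : NExp) (e : NExp)
  | rstore (a : ℕ) (i : NExp) (e : RExp)
  | seq (p q : Prog)
  | cond (b : BExp) (p q : Prog)
  | loop (b : BExp) (p : Prog)

/-- `Exec p s s' t`: the program `p`, started in the state `s`, halts in the state `s'` and takes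
time `t`. -/
inductive Exec : Prog → State → State → ℕ → Prop where
  | skip (s : State) : Exec .skip s s 1
  | setReg (s : State) (x : ℕ) (e : NExp) :
      Exec (.setReg x e) s { s with reg := Function.update s.reg x (e.eval s) } (1 + e.cost s)
  | store (s : State) (a : ℕ) (i e : NExp) :
      Exec (.store a i e) s
        { s with arr := Function.update s.arr a (Function.update (s.arr a) (i.eval s) (e.eval s)) }
        (1 + i.cost s + e.cost s)
  | rstore (s : State) (a : ℕ) (i : NExp) (e : RExp) :
      Exec (.rstore a i e) s
        { s with
          rarr := Function.update s.rarr a (Function.update (s.rarr a) (i.eval s) (e.eval s)) }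
        (1 + i.cost s + e.cost s)
  | seq {p q : Prog} {s s' s'' : State} {t t' : ℕ} :
      Exec p s s' t → Exec q s' s'' t' → Exec (.seq p q) s s'' (t + t')
  | cond_true {b : BExp} {p q : Prog} {s s' : State} {t : ℕ} :
      b.holds s → Exec p s s' t → Exec (.cond b p q) s s' (1 + b.cost s + t)
  | cond_false {b : BExp} {p q : Prog} {s s' : State} {t : ℕ} :
      ¬ b.holds s → Exec q s s' t → Exec (.cond b p q) s s' (1 + b.cost s + t)
  | loop_done {b : BExp} {p : Prog} {s : State} :
      ¬ b.holds s → Exec (.loop b p) s s (1 + b.cost s)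
  | loop_step {b : BExp} {p : Prog} {s s' s'' : State} {t t' : ℕ} :
      b.holds s → Exec p s s' t → Exec (.loop b p) s' s'' t' →
        Exec (.loop b p) s s'' (1 + b.cost s + t + t')

/-! ### Input and output -/

namespace CapGraph

variable {n m : ℕ} (G : CapGraph n m)

/-- The initial state on the input `G`: register `0` holds `n`, register `1` holds `m`, the arrays
`0` and `1` of natural numbers hold the ends of the edges, and the array `0` of real numbers holds the
capacities. All other cells hold `0`. -/
noncomputable def input : State where
  reg x := if x = 0 then n else if x = 1 then m else 0
  arr a i :=
    if h : i < m then
      if a = 0 then (G.fst ⟨i, h⟩ : ℕ) else if a = 1 then (G.snd ⟨i, h⟩ : ℕ) else 0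
    else 0
  rarr a i := if h : i < m then if a = 0 then G.cap ⟨i, h⟩ else 0 else 0

end CapGraph

/-- The `j`-th set of edges stored in the array `2`. It occupies the `n` cells with the addresses
`j * n, …, j * n + n - 1`; a cell with the value `e + 1` stands for the edge `e`, a cell with the
value `0` is unused. -/
def storedSet (n m : ℕ) (s : State) (j : ℕ) : Finset (Fin m) :=
  Finset.univ.filter fun e => ∃ i < n, s.arr 2 (j * n + i) = (e : ℕ) + 1

/-- The state `s` lists `(y, z)` explicitly, with at most `m` sets in the support of `y`: register
`2` holds a number `L ≤ m`, the array `2` holds `L` different sets of edges that include the support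
of `y`, and the arrays `1` and `2` of real numbers hold the values of `y` on these sets and the values
of `z`. -/
structure ListsSolution (n m : ℕ) (s : State) (y : Finset (Fin m) → ℝ) (z : Fin m → ℝ) :
    Prop where
  count_le : s.reg 2 ≤ m
  cell_le : ∀ j < s.reg 2, ∀ i < n, s.arr 2 (j * n + i) ≤ m
  distinct : ∀ j < s.reg 2, ∀ j' < s.reg 2, storedSet n m s j = storedSet n m s j' → j = j'
  y_listed : ∀ j < s.reg 2, y (storedSet n m s j) = s.rarr 1 j
  y_unlisted : ∀ F, (∀ j < s.reg 2, storedSet n m s j ≠ F) → y F = 0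
  z_listed : ∀ e : Fin m, z e = s.rarr 2 e

/-- The state in which a reporting program starts when it is asked for the item number `i` of what
has been computed in `s`: register `3` holds `i`, and the real numbers (so in particular the
capacities) are erased, so that nothing but the natural numbers in the memory can be used. -/
noncomputable def State.query (s : State) (i : ℕ) : State where
  reg := Function.update s.reg 3 i
  arr := s.arr
  rarr := fun _ _ => 0

namespace CapGraph

variable {n m : ℕ} (G : CapGraph n m)

/-- On the input `G`, the program `S` finds within time `t` an optimum solution of the dual of the
`k`-cut LP whose support has at most `m` maximal forests. -/
def SolvesLP (k : ℕ) (S : Prog) (t : ℕ) : Prop :=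
  ∃ s τ, Exec S G.input s τ ∧ τ ≤ t ∧
    ∃ y z, G.DualOptimal k y z ∧ ListsSolution n m s y z

/-- On the input `G`, the program `P` enumerates within time `t` all minimum `k`-cuts: it halts in a
state `s` that represents a list `K 0, …, K (N - 1)`, where `N` is the content of register `2`, of
exactly the minimum `k`-cuts of `G`. For each `i < N` the program `D` writes the characteristic
vector of `K i` into the array `3`, within time `r`. -/
def EnumeratesMinKCuts (k : ℕ) (P D : Prog) (t r : ℕ) : Prop :=
  ∃ s τ, Exec P G.input s τ ∧ τ ≤ t ∧
    ∃ K : ℕ → Finset (Fin m),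
      (∀ A, G.IsMinKCut k A ↔ ∃ i < s.reg 2, K i = A) ∧
      ∀ i < s.reg 2, ∃ s' τ', Exec D (s.query i) s' τ' ∧ τ' ≤ r ∧
        ∀ e : Fin m, s'.arr 3 e = if e ∈ K i then 1 else 0

end CapGraph

end KCut

/-! An optimum dual solution is a fractional packing of maximal forests, and every minimum `k`-cut
`A` meets some packed forest in fewer than 2(k - h) edges (`DualOptimal.exists_card_inter_lt`). The
average of |A ∩ F| over the packing is at most (c(A) + ∑ z) / ∑ y, and c(A) is less than twice the
LP value (k - h) ∑ y - ∑ z. That strict gap is `DualOptimal.capOf_lt`. Take a primal optimum x,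
which exists by strong duality. By complementary slackness each packed forest has minimum x-length,
so by exchange it spans the components of the edges with x = 0 and also those of the edges with x <
1. This determines the capacity of the edges with 0 < x < 1 and of those with x = 1. Cutting the
latter, and isolating the cheapest of the parts left after contracting the edges with x = 0, gives a
`k`-cut below twice the LP value.

Hence every minimum `k`-cut has a short code. A packed forest is completed to a rooted tree by h - 1
artificial links. A labelling of the nodes whose classes are the parts of the cut changes along at
most |A ∩ F| + h - 1 ≤ 2k - 3 edges of this tree (`Grow.exists_changes`), and 2k - 2 labels suffice.
With labels in `ZMod (2k - 2)` the labelling is given by 2k - 3 pairs of a node and an increment,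
the increment being added to all descendants of the node (`IsMinKCut.exists_code`). For at most m
forests this makes O(m n^(2k-3)) codes.

A code is evaluated in a number of operations that depends only on k. For each tree a table holds
the capacity between the descendants of x and the descendants of y, for all x and y. Telescoping
along chains of ancestors (`sum_anc_mul`, `sum_weight_eq`) turns the capacity inside the parts into
a combination of (2k - 2)² entries, and all labels are already seen at the nodes of the code and the
root (`image_lbl`). The table costs O(n³) operations per tree, which is affordable because 2k - 3 ≥
3. The codes with at least k labels and the largest inner capacity represent exactly the minimum
`k`-cuts (`isMinKCut_iff`). Decoding them needs the ancestor tables but no real numbers.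

The programs are written in `Code`, where all loops are counting loops; `WP.sound` yields
termination, time, word size and correctness together. The LP solver is an arbitrary program, so it
runs on renamed memory (`Exec.shift`). All other numbers have O(log(n + m)) bits (`exists_fits`),
which accounts for the single logarithmic factor. -/

namespace KCut

/-! ### Size and cost of expressions -/

/-- The number of bits of a value, in multiples of the word length. -/
def NExp.len : NExp → ℕ
  | .const c => 1 + c.size
  | .reg _ => 1
  | .get _ _ => 1
  | .add e f => e.len + f.len
  | .sub e _ => e.len
  | .mul e f => e.len + f.len
  | .div e _ => e.len
  | .mod e _ => e.len

/-- The cost of an evaluation, in multiples of the word length. -/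
def NExp.wt : NExp → ℕ
  | .const c => 1 + c.size
  | .reg _ => 2
  | .get _ i => 2 + i.wt
  | .add e f => 1 + (e.len + f.len) + e.wt + f.wt
  | .sub e f => 1 + e.len + e.wt + f.wt
  | .mul e f => 1 + (e.len + f.len) + e.wt + f.wt
  | .div e f => 1 + e.len + e.wt + f.wt
  | .mod e f => 1 + e.len + e.wt + f.wt

/-- The cells that are read hold numbers of at most `w` bits, as far as their names do not
guarantee this. -/
def NExp.Ok (w : ℕ) (s : State) : NExp → Prop
  | .const _ => True
  | .reg x => x < 100 ∨ s.reg x < 2 ^ w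
  | .get a i => (a < 100 ∨ s.arr a (i.eval s) < 2 ^ w) ∧ i.Ok w s
  | .add e f => e.Ok w s ∧ f.Ok w s
  | .sub e f => e.Ok w s ∧ f.Ok w s
  | .mul e f => e.Ok w s ∧ f.Ok w s
  | .div e f => e.Ok w s ∧ f.Ok w s
  | .mod e f => e.Ok w s ∧ f.Ok w s

/-- All registers and arrays with names below `100` hold numbers of at most `w` bits. -/
structure Small (w : ℕ) (s : State) : Prop where
  reg : ∀ x < 100, s.reg x < 2 ^ w
  arr : ∀ a < 100, ∀ i, s.arr a i < 2 ^ w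

theorem NExp.one_le_len (e : NExp) : 1 ≤ e.len := by
  induction e <;> simp only [NExp.len] <;> omega

/-- Only sums and products enlarge a value, and they at most add the bit lengths; differences,
quotients and remainders are bounded by the first operand. For sums this needs both lengths to be at
least 1, whence `NExp.one_le_len`. -/
theorem NExp.eval_lt {w : ℕ} (hw : 1 ≤ w) {s : State} (hs : Small w s) (e : NExp)
    (he : e.Ok w s) : e.eval s < 2 ^ (e.len * w) := by
  have key : ∀ {a b A B : ℕ}, 1 ≤ A → 1 ≤ B → a < 2 ^ A → b < 2 ^ B → a + b < 2 ^ (A + B) := by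
    intro a b A B hA hB ha hb
    have h1 : 2 ≤ 2 ^ A := by simpa using Nat.pow_le_pow_right (n := 2) (by norm_num) hA
    have h2 : 2 ≤ 2 ^ B := by simpa using Nat.pow_le_pow_right (n := 2) (by norm_num) hB
    rw [pow_add]
    nlinarith
  induction e with
  | const c =>
    simp only [NExp.eval, NExp.len]
    refine (Nat.lt_size_self c).trans_le (Nat.pow_le_pow_right (by norm_num) ?_)
    nlinarith
  | reg x =>
    simp only [NExp.eval, NExp.len, one_mul]
    exact he.elim (hs.reg x) id
  | get a i ih =>
    simp only [NExp.eval, NExp.len, one_mul]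
    exact he.1.elim (fun h => hs.arr a h _) id
  | add e f ihe ihf =>
    simp only [NExp.eval, NExp.len, add_mul]
    exact key (Nat.mul_pos e.one_le_len hw) (Nat.mul_pos f.one_le_len hw) (ihe he.1) (ihf he.2)
  | mul e f ihe ihf =>
    simp only [NExp.eval, NExp.len, add_mul, pow_add]
    exact Nat.mul_lt_mul'' (ihe he.1) (ihf he.2)
  | sub e f ihe ihf => exact (Nat.sub_le _ _).trans_lt (ihe he.1)
  | div e f ihe ihf => exact (Nat.div_le_self _ _).trans_lt (ihe he.1)
  | mod e f ihe ihf => exact (Nat.mod_le _ _).trans_lt (ihe he.1)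

theorem NExp.cost_le {w : ℕ} (hw : 1 ≤ w) {s : State} (hs : Small w s) (e : NExp)
    (he : e.Ok w s) : e.cost s ≤ e.wt * w := by
  induction e with
  | const c => simp only [NExp.cost, NExp.wt]; nlinarith
  | reg x =>
    have := Nat.size_le.2 (NExp.eval_lt hw hs (.reg x) he)
    simp only [NExp.cost, NExp.wt, NExp.eval, NExp.len] at *; nlinarith
  | get a i ih =>
    have := Nat.size_le.2 (NExp.eval_lt hw hs (.get a i) he)
    have := ih he.2
    simp only [NExp.cost, NExp.wt, NExp.eval, NExp.len] at *; nlinarith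
  | add e f ihe ihf =>
    have := Nat.size_le.2 (NExp.eval_lt hw hs (.add e f) he)
    have := ihe he.1
    have := ihf he.2
    simp only [NExp.cost, NExp.wt, NExp.eval, NExp.len] at *; nlinarith
  | sub e f ihe ihf =>
    have := Nat.size_le.2 (NExp.eval_lt hw hs (.sub e f) he)
    have := ihe he.1
    have := ihf he.2
    simp only [NExp.cost, NExp.wt, NExp.eval, NExp.len] at *; nlinarith
  | mul e f ihe ihf =>
    have := Nat.size_le.2 (NExp.eval_lt hw hs (.mul e f) he)
    have := ihe he.1
    have := ihf he.2
    simp only [NExp.cost, NExp.wt, NExp.eval, NExp.len] at *; nlinarith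
  | div e f ihe ihf =>
    have := Nat.size_le.2 (NExp.eval_lt hw hs (.div e f) he)
    have := ihe he.1
    have := ihf he.2
    simp only [NExp.cost, NExp.wt, NExp.eval, NExp.len] at *; nlinarith
  | mod e f ihe ihf =>
    have := Nat.size_le.2 (NExp.eval_lt hw hs (.mod e f) he)
    have := ihe he.1
    have := ihf he.2
    simp only [NExp.cost, NExp.wt, NExp.eval, NExp.len] at *; nlinarith

def RExp.wt : RExp → ℕ
  | .ofNat e => 1 + e.wt
  | .get _ i => 1 + i.wt
  | .add e f => 1 + e.wt + f.wt
  | .sub e f => 1 + e.wt + f.wt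
  | .mul e f => 1 + e.wt + f.wt
  | .div e f => 1 + e.wt + f.wt

def RExp.Ok (w : ℕ) (s : State) : RExp → Prop
  | .ofNat e => e.Ok w s
  | .get _ i => i.Ok w s
  | .add e f => e.Ok w s ∧ f.Ok w s
  | .sub e f => e.Ok w s ∧ f.Ok w s
  | .mul e f => e.Ok w s ∧ f.Ok w s
  | .div e f => e.Ok w s ∧ f.Ok w s

theorem RExp.cost_le {w : ℕ} (hw : 1 ≤ w) {s : State} (hs : Small w s) (e : RExp)
    (he : e.Ok w s) : e.cost s ≤ e.wt * w := by
  induction e with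
  | ofNat e => have := e.cost_le hw hs he; simp only [RExp.cost, RExp.wt]; nlinarith
  | get a i => have := i.cost_le hw hs he; simp only [RExp.cost, RExp.wt]; nlinarith
  | add e f ihe ihf | sub e f ihe ihf | mul e f ihe ihf | div e f ihe ihf =>
    have := ihe he.1
    have := ihf he.2
    simp only [RExp.cost, RExp.wt]; nlinarith

def BExp.wt : BExp → ℕ
  | .le e f => 1 + e.wt + f.wt
  | .rle e f => 1 + e.wt + f.wt
  | .neg b => 1 + b.wt
  | .conj b c => 1 + b.wt + c.wt

def BExp.Ok (w : ℕ) (s : State) : BExp → Prop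
  | .le e f => e.Ok w s ∧ f.Ok w s
  | .rle e f => e.Ok w s ∧ f.Ok w s
  | .neg b => b.Ok w s
  | .conj b c => b.Ok w s ∧ c.Ok w s

theorem BExp.cost_le {w : ℕ} (hw : 1 ≤ w) {s : State} (hs : Small w s) (b : BExp)
    (hb : b.Ok w s) : b.cost s ≤ b.wt * w := by
  induction b with
  | le e f =>
    have := e.cost_le hw hs hb.1
    have := f.cost_le hw hs hb.2
    simp only [BExp.cost, BExp.wt]; nlinarith
  | rle e f =>
    have := e.cost_le hw hs hb.1
    have := f.cost_le hw hs hb.2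
    simp only [BExp.cost, BExp.wt]; nlinarith
  | neg b ih => have := ih hb; simp only [BExp.cost, BExp.wt]; nlinarith
  | conj b c ihb ihc =>
    have := ihb hb.1
    have := ihc hb.2
    simp only [BExp.cost, BExp.wt]; nlinarith

/-! ### Programs with counting loops -/

def State.setReg (s : State) (x v : ℕ) : State := { s with reg := Function.update s.reg x v }

def State.setArr (s : State) (a i v : ℕ) : State :=
  { s with arr := Function.update s.arr a (Function.update (s.arr a) i v) }

noncomputable def State.setRArr (s : State) (a i : ℕ) (v : ℝ) : State :=
  { s with rarr := Function.update s.rarr a (Function.update (s.rarr a) i v) }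

section
variable (s : State) (x y v a b i j : ℕ) (c : ℝ)

@[simp] theorem State.setReg_reg :
    (s.setReg x v).reg y = if y = x then v else s.reg y := by
  simp [State.setReg, Function.update_apply]
@[simp] theorem State.setReg_arr : (s.setReg x v).arr = s.arr := rfl
@[simp] theorem State.setReg_rarr : (s.setReg x v).rarr = s.rarr := rfl
@[simp] theorem State.setArr_reg : (s.setArr a i v).reg = s.reg := rfl
@[simp] theorem State.setArr_rarr : (s.setArr a i v).rarr = s.rarr := rfl
@[simp] theorem State.setArr_arr :
    (s.setArr a i v).arr b = if b = a then Function.update (s.arr a) i v else s.arr b := by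
  simp [State.setArr, Function.update_apply]
@[simp] theorem State.setRArr_reg : (s.setRArr a i c).reg = s.reg := rfl
@[simp] theorem State.setRArr_arr : (s.setRArr a i c).arr = s.arr := rfl
@[simp] theorem State.setRArr_rarr :
    (s.setRArr a i c).rarr b = if b = a then Function.update (s.rarr a) i c else s.rarr b := by
  simp [State.setRArr, Function.update_apply]
end

/-- Programs in which all loops are counting loops: `rep x b p` repeats `p` for the values
`0, 1, …` of the register `x` below the content of the register `b`. -/
inductive Code where
  | skip
  | set (x : ℕ) (e : NExp)
  | store (a : ℕ) (i e : NExp)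
  | rstore (a : ℕ) (i : NExp) (e : RExp)
  | seq (p q : Code)
  | cond (b : BExp) (p q : Code)
  | rep (x b : ℕ) (p : Code)

namespace Code

def toProg : Code → Prog
  | skip => .skip
  | set x e => .setReg x e
  | store a i e => .store a i e
  | rstore a i e => .rstore a i e
  | seq p q => .seq p.toProg q.toProg
  | cond b p q => .cond b p.toProg q.toProg
  | rep x b p => .seq (.setReg x (.const 0))
      (.loop (.neg (.le (.reg b) (.reg x))) (.seq p.toProg (.setReg x (.add (.reg x) (.const 1)))))

def regs : Code → List ℕ
  | skip => []
  | set x _ => [x]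
  | store _ _ _ => []
  | rstore _ _ _ => []
  | seq p q => p.regs ++ q.regs
  | cond _ p q => p.regs ++ q.regs
  | rep x _ p => x :: p.regs

def arrs : Code → List ℕ
  | skip => []
  | set _ _ => []
  | store a _ _ => [a]
  | rstore _ _ _ => []
  | seq p q => p.arrs ++ q.arrs
  | cond _ p q => p.arrs ++ q.arrs
  | rep _ _ p => p.arrs

def rarrs : Code → List ℕ
  | skip => []
  | set _ _ => []
  | store _ _ _ => []
  | rstore a _ _ => [a]
  | seq p q => p.rarrs ++ q.rarrs
  | cond _ p q => p.rarrs ++ q.rarrs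
  | rep _ _ p => p.rarrs

def bounds : Code → List ℕ
  | skip => []
  | set _ _ => []
  | store _ _ _ => []
  | rstore _ _ _ => []
  | seq p q => p.bounds ++ q.bounds
  | cond _ p q => p.bounds ++ q.bounds
  | rep _ b p => b :: p.bounds

/-- The counters of the loops are not changed in their bodies. -/
def Counting : Code → Prop
  | skip => True
  | set _ _ => True
  | store _ _ _ => True
  | rstore _ _ _ => True
  | seq p q => p.Counting ∧ q.Counting
  | cond _ p q => p.Counting ∧ q.Counting
  | rep x b p => x ∉ p.regs ∧ x < 100 ∧ b < 100 ∧ p.Counting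

/-- The running time, in multiples of the word length, when `ν` bounds the contents of the
registers that bound the loops. -/
def time (ν : ℕ → ℕ) : Code → ℕ
  | skip => 1
  | set _ e => 1 + e.wt
  | store _ i e => 1 + i.wt + e.wt
  | rstore _ i e => 1 + i.wt + e.wt
  | seq p q => p.time ν + q.time ν
  | cond b p q => 1 + b.wt + p.time ν + q.time ν
  | rep _ b p => ν b * (p.time ν + 20) + 20

/-- What `p` leaves unchanged. -/
structure Frame (p : Code) (s s' : State) : Prop where
  reg : ∀ x, x ∉ p.regs → s'.reg x = s.reg x
  arr : ∀ a, a ∉ p.arrs → s'.arr a = s.arr a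
  rarr : ∀ a, a ∉ p.rarrs → s'.rarr a = s.rarr a

/-- A sufficient condition for `p`, started in `s` with words of `w` bits, to halt in a state with
property `Q`. -/
def WP (w : ℕ) : Code → State → (State → Prop) → Prop
  | skip, s, Q => Q s
  | set x e, s, Q => e.Ok w s ∧ (x < 100 → Small w s → e.eval s < 2 ^ w) ∧ Q (s.setReg x (e.eval s))
  | store a i e, s, Q => i.Ok w s ∧ e.Ok w s ∧ (a < 100 → Small w s → e.eval s < 2 ^ w) ∧
      Q (s.setArr a (i.eval s) (e.eval s))
  | rstore a i e, s, Q => i.Ok w s ∧ e.Ok w s ∧ Q (s.setRArr a (i.eval s) (e.eval s))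
  | seq p q, s, Q => p.WP w s fun s' => q.WP w s' Q
  | cond b p q, s, Q => b.Ok w s ∧ (b.holds s → p.WP w s Q) ∧ (¬ b.holds s → q.WP w s Q)
  | rep x b p, s, Q => ∃ I : ℕ → State → Prop, I 0 (s.setReg x 0) ∧
      (∀ i < s.reg b, ∀ s', Frame (rep x b p) s s' → s'.reg x = i → I i s' →
        p.WP w s' fun s'' => I (i + 1) (s''.setReg x (i + 1))) ∧
      ∀ s', Frame (rep x b p) s s' → s'.reg x = s.reg b → I (s.reg b) s' → Q s'

theorem Frame.refl (p : Code) (s : State) : Frame p s s := ⟨by simp, by simp, by simp⟩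

theorem Frame.trans {p : Code} {s s' s'' : State} (h : Frame p s s') (h' : Frame p s' s'') :
    Frame p s s'' :=
  ⟨fun x hx => (h'.reg x hx).trans (h.reg x hx), fun x hx => (h'.arr x hx).trans (h.arr x hx),
    fun x hx => (h'.rarr x hx).trans (h.rarr x hx)⟩

theorem Frame.mono {p q : Code} {s s' : State} (h : Frame p s s') (h1 : p.regs ⊆ q.regs)
    (h2 : p.arrs ⊆ q.arrs) (h3 : p.rarrs ⊆ q.rarrs) : Frame q s s' :=
  ⟨fun x hx => h.reg x fun h => hx (h1 h), fun x hx => h.arr x fun h => hx (h2 h),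
    fun x hx => h.rarr x fun h => hx (h3 h)⟩

theorem Frame.setReg {p : Code} {s s' : State} (h : Frame p s s') {x v : ℕ} (hx : x ∈ p.regs) :
    Frame p s (s'.setReg x v) := by
  refine ⟨fun y hy => ?_, fun y hy => h.arr y hy, fun y hy => h.rarr y hy⟩
  rw [State.setReg_reg, if_neg (by rintro rfl; exact hy hx), h.reg y hy]

/-- The frame is available when a postcondition is weakened, so a specification need not mention the
memory that a program leaves alone. -/
theorem WP.mono {w : ℕ} {p : Code} {s : State} {Q Q' : State → Prop} (h : p.WP w s Q)
    (hQ : ∀ s', Frame p s s' → Q s' → Q' s') : p.WP w s Q' := by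
  induction p generalizing s Q Q' with
  | skip => exact hQ _ (Frame.refl _ s) h
  | set x e =>
    refine ⟨h.1, h.2.1, hQ _ ?_ h.2.2⟩
    exact (Frame.refl _ s).setReg (by simp [regs])
  | store a i e =>
    refine ⟨h.1, h.2.1, h.2.2.1, hQ _ ⟨fun _ _ => rfl, fun b hb => ?_, fun _ _ => rfl⟩ h.2.2.2⟩
    rw [State.setArr_arr, if_neg (by simpa [arrs] using hb)]
  | rstore a i e =>
    refine ⟨h.1, h.2.1, hQ _ ⟨fun _ _ => rfl, fun _ _ => rfl, fun b hb => ?_⟩ h.2.2⟩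
    rw [State.setRArr_rarr, if_neg (by simpa [rarrs] using hb)]
  | seq p q ihp ihq =>
    refine ihp h fun s' hf h' => ihq h' fun s'' hf' h'' => hQ _ ?_ h''
    exact (hf.mono (by simp [regs]) (by simp [arrs]) (by simp [rarrs])).trans
      (hf'.mono (by simp [regs]) (by simp [arrs]) (by simp [rarrs]))
  | cond b p q ihp ihq =>
    refine ⟨h.1, fun hb => ihp (h.2.1 hb) fun s' hf h' => hQ _ ?_ h',
      fun hb => ihq (h.2.2 hb) fun s' hf h' => hQ _ ?_ h'⟩
    · exact hf.mono (by simp [regs]) (by simp [arrs]) (by simp [rarrs])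
    · exact hf.mono (by simp [regs]) (by simp [arrs]) (by simp [rarrs])
  | rep x b p ih =>
    obtain ⟨I, h0, h1, h2⟩ := h
    exact ⟨I, h0, h1, fun s' hf hx hI => hQ _ hf (h2 s' hf hx hI)⟩

theorem Small.setReg {w : ℕ} {s : State} (hs : Small w s) {x v : ℕ} (h : x < 100 → v < 2 ^ w) :
    Small w (s.setReg x v) := by
  refine ⟨fun y hy => ?_, hs.arr⟩
  rw [State.setReg_reg]
  split_ifs with hyx
  · exact h (hyx ▸ hy)
  · exact hs.reg y hy

theorem Small.setArr {w : ℕ} {s : State} (hs : Small w s) {a i v : ℕ} (h : a < 100 → v < 2 ^ w) :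
    Small w (s.setArr a i v) := by
  refine ⟨hs.reg, fun b hb j => ?_⟩
  rw [State.setArr_arr]
  split_ifs with hba
  · rw [Function.update_apply]
    split_ifs
    · exact h (hba ▸ hb)
    · exact hs.arr a (hba ▸ hb) j
  · exact hs.arr b hb j

/-- The only passage from `Code` to `Exec`. Registers that bound loops are never written, so `ν` has
to bound them only at the start. -/
theorem WP.sound {w : ℕ} (hw : 1 ≤ w) (ν : ℕ → ℕ) {p : Code} (hp : p.Counting)
    (hd : ∀ b ∈ p.bounds, b ∉ p.regs) {s : State} (hs : Small w s)
    (hν : ∀ b ∈ p.bounds, s.reg b ≤ ν b) {Q : State → Prop} (h : p.WP w s Q) :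
    ∃ s' τ, Exec p.toProg s s' τ ∧ τ ≤ p.time ν * w ∧ Small w s' ∧ Frame p s s' ∧ Q s' := by
  induction p generalizing s Q with
  | skip => exact ⟨s, 1, Exec.skip s, by simpa [time] using hw, hs, Frame.refl _ s, h⟩
  | set x e =>
    refine ⟨_, _, Exec.setReg s x e, ?_, Small.setReg hs fun hx => h.2.1 hx hs,
      (Frame.refl _ s).setReg (by simp [regs]), h.2.2⟩
    have := e.cost_le hw hs h.1
    simp only [time]; nlinarith
  | store a i e =>
    refine ⟨_, _, Exec.store s a i e, ?_, Small.setArr hs fun ha => h.2.2.1 ha hs,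
      ⟨fun _ _ => rfl, fun b hb => ?_, fun _ _ => rfl⟩, h.2.2.2⟩
    · have := i.cost_le hw hs h.1
      have := e.cost_le hw hs h.2.1
      simp only [time]; nlinarith
    · exact Function.update_of_ne (by simpa [arrs] using hb) _ _
  | rstore a i e =>
    refine ⟨_, _, Exec.rstore s a i e, ?_, ⟨hs.reg, hs.arr⟩,
      ⟨fun _ _ => rfl, fun _ _ => rfl, fun b hb => ?_⟩, h.2.2⟩
    · have := i.cost_le hw hs h.1
      have := e.cost_le hw hs h.2.1
      simp only [time]; nlinarith
    · exact Function.update_of_ne (by simpa [rarrs] using hb) _ _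
  | seq p q ihp ihq =>
    simp only [regs, bounds, List.mem_append, not_or] at hd hν
    obtain ⟨s', τ, hx, ht, hs', hf, h'⟩ := ihp hp.1 (fun b hb => (hd b (.inl hb)).1) hs
      (fun b hb => hν b (.inl hb)) h
    obtain ⟨s'', τ', hx', ht', hs'', hf', h''⟩ := ihq hp.2 (fun b hb => (hd b (.inr hb)).2) hs'
      (fun b hb => (hf.reg b (hd b (.inr hb)).1).trans_le (hν b (.inr hb))) h'
    refine ⟨s'', _, Exec.seq hx hx', ?_, hs'', ?_, h''⟩
    · simp only [time]; nlinarith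
    · exact (hf.mono (by simp [regs]) (by simp [arrs]) (by simp [rarrs])).trans
        (hf'.mono (by simp [regs]) (by simp [arrs]) (by simp [rarrs]))
  | cond b p q ihp ihq =>
    simp only [regs, bounds, List.mem_append, not_or] at hd hν
    have hc := b.cost_le hw hs h.1
    by_cases hb : b.holds s
    · obtain ⟨s', τ, hx, ht, hs', hf, h'⟩ := ihp hp.1 (fun b hb => (hd b (.inl hb)).1) hs
        (fun b hb => hν b (.inl hb)) (h.2.1 hb)
      refine ⟨s', _, Exec.cond_true hb hx, ?_, hs',
        hf.mono (by simp [regs]) (by simp [arrs]) (by simp [rarrs]), h'⟩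
      simp only [time]; nlinarith
    · obtain ⟨s', τ, hx, ht, hs', hf, h'⟩ := ihq hp.2 (fun b hb => (hd b (.inr hb)).2) hs
        (fun b hb => hν b (.inr hb)) (h.2.2 hb)
      refine ⟨s', _, Exec.cond_false hb hx, ?_, hs',
        hf.mono (by simp [regs]) (by simp [arrs]) (by simp [rarrs]), h'⟩
      simp only [time]; nlinarith
  | rep x b p ih =>
    obtain ⟨I, h0, h1, h2⟩ := h
    obtain ⟨hxp, hx100, hb100, hp⟩ := hp
    simp only [regs, bounds, List.mem_cons, not_or, forall_eq_or_imp] at hd hν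
    obtain ⟨⟨hbx, hbp⟩, hd⟩ := hd
    have hbN : s.reg b < 2 ^ w := hs.reg b hb100
    -- Here `j` counts the rounds that remain. In each round 20 words pay for the test and the
    -- increment of the counter; the final 10 pay for the failing test.
    have main : ∀ j i s', i + j = s.reg b → Frame (rep x b p) s s' → s'.reg x = i → I i s' →
        Small w s' → ∃ s'' τ, Exec (.loop (.neg (.le (.reg b) (.reg x)))
          (.seq p.toProg (.setReg x (.add (.reg x) (.const 1))))) s' s'' τ ∧
          τ ≤ (j * (p.time ν + 20) + 10) * w ∧ Small w s'' ∧ Frame (rep x b p) s s'' ∧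
          s''.reg x = s.reg b ∧ I (s.reg b) s'' := by
      intro j
      induction j with
      | zero =>
        intro i s' hij hf hx hI hs'
        have hb' : s'.reg b = s.reg b := hf.reg b (by simp [regs, hbx, hbp])
        refine ⟨s', _, Exec.loop_done ?_, ?_, hs', hf, by omega, ?_⟩
        · simp only [BExp.holds, NExp.eval]; omega
        · have := BExp.cost_le hw hs' (.neg (.le (.reg b) (.reg x)))
            ⟨.inl hb100, .inl hx100⟩
          simp only [BExp.wt, NExp.wt] at this
          nlinarith
        · rwa [show s.reg b = i by omega]
      | succ j ihj =>
        intro i s' hij hf hx hI hs'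
        have hb' : s'.reg b = s.reg b := hf.reg b (by simp [regs, hbx, hbp])
        obtain ⟨t, τ, ht, hτ, hts, htf, htI⟩ := ih hp (fun b hb => (hd b hb).2) hs'
          (fun b hb => (hf.reg b (by simpa [regs] using hd b hb)).trans_le (hν.2 b hb))
          (h1 i (by omega) s' hf hx hI)
        have htx : t.reg x = i := (htf.reg x hxp).trans hx
        have hft : Frame (rep x b p) s t :=
          hf.trans (htf.mono (by simp [regs]) (by simp [arrs]) (by simp [rarrs]))
        -- The counter never exceeds the bounding register, which is a word already.
        have hsmall : i + 1 < 2 ^ w := by omega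
        obtain ⟨t', τ', ht', hτ', hrest⟩ := ihj (i + 1) (t.setReg x (i + 1)) (by omega)
          (hft.setReg (by simp [regs])) (by simp) htI (Small.setReg hts fun _ => hsmall)
        have hset : Exec (.setReg x (.add (.reg x) (.const 1))) t (t.setReg x (i + 1))
            (1 + NExp.cost t (.add (.reg x) (.const 1))) := by
          have := Exec.setReg t x (.add (.reg x) (.const 1))
          simpa only [NExp.eval, htx, State.setReg] using this
        refine ⟨t', _, Exec.loop_step ?_ (Exec.seq ht hset) ht', ?_, hrest⟩
        · simp only [BExp.holds, NExp.eval]; omega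
        · have c1 := BExp.cost_le hw hs' (.neg (.le (.reg b) (.reg x)))
            ⟨.inl hb100, .inl hx100⟩
          have c2 := NExp.cost_le hw hts (.add (.reg x) (.const 1)) ⟨.inl hx100, trivial⟩
          simp only [BExp.wt, NExp.wt, NExp.len, Nat.size_one] at c1 c2
          nlinarith
    obtain ⟨s', τ, hx, ht, hs', hf, hxN, hI⟩ := main (s.reg b) 0 (s.setReg x 0) (by omega)
      ((Frame.refl _ s).setReg (by simp [regs])) (by simp) h0
      (Small.setReg hs fun _ => by positivity)
    refine ⟨s', _, Exec.seq (Exec.setReg s x (.const 0)) hx, ?_, hs', hf, h2 s' hf hxN hI⟩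
    have c := NExp.cost_le hw hs (.const 0) trivial
    simp only [NExp.wt, Nat.size_zero] at c
    have := Nat.mul_le_mul_right (p.time ν + 20) hν.1
    have := Nat.mul_le_mul_right w this
    simp only [time]
    nlinarith

end Code
end KCut

namespace KCut

/-! ### Renaming a program -/

def NExp.shift : NExp → NExp
  | .const c => .const c
  | .reg x => .reg (x + 100)
  | .get a i => .get (a + 100) i.shift
  | .add e f => .add e.shift f.shift
  | .sub e f => .sub e.shift f.shift
  | .mul e f => .mul e.shift f.shift
  | .div e f => .div e.shift f.shift
  | .mod e f => .mod e.shift f.shift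

def RExp.shift : RExp → RExp
  | .ofNat e => .ofNat e.shift
  | .get a i => .get (a + 100) i.shift
  | .add e f => .add e.shift f.shift
  | .sub e f => .sub e.shift f.shift
  | .mul e f => .mul e.shift f.shift
  | .div e f => .div e.shift f.shift

def BExp.shift : BExp → BExp
  | .le e f => .le e.shift f.shift
  | .rle e f => .rle e.shift f.shift
  | .neg b => .neg b.shift
  | .conj b c => .conj b.shift c.shift

/-- The program that uses the name `x + 100` wherever `p` uses the name `x`. -/
def Prog.shift : Prog → Prog
  | .skip => .skip
  | .setReg x e => .setReg (x + 100) e.shift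
  | .store a i e => .store (a + 100) i.shift e.shift
  | .rstore a i e => .rstore (a + 100) i.shift e.shift
  | .seq p q => .seq p.shift q.shift
  | .cond b p q => .cond b.shift p.shift q.shift
  | .loop b p => .loop b.shift p.shift

/-- The names from `100` on hold in `r` what the names from `0` on hold in `s`. -/
structure Simulates (s r : State) : Prop where
  reg : ∀ x, r.reg (x + 100) = s.reg x
  arr : ∀ a, r.arr (a + 100) = s.arr a
  rarr : ∀ a, r.rarr (a + 100) = s.rarr a

/-- The names below `100` hold the same values. -/
structure SameLow (r r' : State) : Prop where
  reg : ∀ x < 100, r'.reg x = r.reg x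
  arr : ∀ a < 100, r'.arr a = r.arr a
  rarr : ∀ a < 100, r'.rarr a = r.rarr a

theorem SameLow.refl (r : State) : SameLow r r :=
  ⟨fun _ _ => rfl, fun _ _ => rfl, fun _ _ => rfl⟩

theorem SameLow.trans {r r' r'' : State} (h : SameLow r r') (h' : SameLow r' r'') :
    SameLow r r'' :=
  ⟨fun x hx => (h'.reg x hx).trans (h.reg x hx), fun x hx => (h'.arr x hx).trans (h.arr x hx),
    fun x hx => (h'.rarr x hx).trans (h.rarr x hx)⟩

section
variable {s r : State} (h : Simulates s r)
include h

theorem NExp.eval_shift (e : NExp) : e.shift.eval r = e.eval s := by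
  induction e <;> simp_all [NExp.shift, NExp.eval, h.reg, h.arr]

theorem NExp.cost_shift (e : NExp) : e.shift.cost r = e.cost s := by
  induction e <;> simp_all [NExp.shift, NExp.cost, NExp.eval_shift h, h.reg, h.arr]

theorem RExp.eval_shift (e : RExp) : e.shift.eval r = e.eval s := by
  induction e <;> simp_all [RExp.shift, RExp.eval, NExp.eval_shift h, h.rarr]

theorem RExp.cost_shift (e : RExp) : e.shift.cost r = e.cost s := by
  induction e <;> simp_all [RExp.shift, RExp.cost, NExp.cost_shift h]

theorem BExp.holds_shift (b : BExp) : b.shift.holds r ↔ b.holds s := by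
  induction b <;> simp_all [BExp.shift, BExp.holds, NExp.eval_shift h, RExp.eval_shift h]

theorem BExp.cost_shift (b : BExp) : b.shift.cost r = b.cost s := by
  induction b <;> simp_all [BExp.shift, BExp.cost, NExp.cost_shift h, RExp.cost_shift h]
end

/-- Costs depend on the values but not on the names of cells, so the simulation takes exactly the
same time. An unknown program can thus be run without touching the names below 100. -/
theorem Exec.shift {p : Prog} {s s' : State} {t : ℕ} (hx : Exec p s s' t) {r : State}
    (h : Simulates s r) : ∃ r', Exec p.shift r r' t ∧ Simulates s' r' ∧ SameLow r r' := by
  induction hx generalizing r with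
  | skip s => exact ⟨r, Exec.skip r, h, .refl r⟩
  | setReg s x e =>
    have hx := Exec.setReg r (x + 100) e.shift
    rw [NExp.cost_shift h] at hx
    refine ⟨_, hx, ?_, ?_⟩
    · refine ⟨fun y => ?_, h.arr, h.rarr⟩
      simp [Function.update_apply, NExp.eval_shift h, h.reg]
    · refine ⟨fun y hy => ?_, fun _ _ => rfl, fun _ _ => rfl⟩
      simp [show y ≠ x + 100 by omega]
  | store s a i e =>
    have hx := Exec.store r (a + 100) i.shift e.shift
    rw [NExp.cost_shift h, NExp.cost_shift h] at hx
    refine ⟨_, hx, ?_, ?_⟩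
    · refine ⟨h.reg, fun y => ?_, h.rarr⟩
      simp [Function.update_apply, NExp.eval_shift h, h.arr]
    · refine ⟨fun _ _ => rfl, fun y hy => ?_, fun _ _ => rfl⟩
      simp [show y ≠ a + 100 by omega]
  | rstore s a i e =>
    have hx := Exec.rstore r (a + 100) i.shift e.shift
    rw [NExp.cost_shift h, RExp.cost_shift h] at hx
    refine ⟨_, hx, ?_, ?_⟩
    · refine ⟨h.reg, h.arr, fun y => ?_⟩
      simp [Function.update_apply, NExp.eval_shift h, RExp.eval_shift h, h.rarr]
    · refine ⟨fun _ _ => rfl, fun _ _ => rfl, fun y hy => ?_⟩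
      simp [show y ≠ a + 100 by omega]
  | seq _ _ ih ih' =>
    obtain ⟨r', hx, hs, hl⟩ := ih h
    obtain ⟨r'', hx', hs', hl'⟩ := ih' hs
    exact ⟨r'', Exec.seq hx hx', hs', hl.trans hl'⟩
  | @cond_true b p q s s' t hb _ ih =>
    obtain ⟨r', hx, hs, hl⟩ := ih h
    refine ⟨r', ?_, hs, hl⟩
    rw [← BExp.cost_shift h]
    exact Exec.cond_true ((BExp.holds_shift h b).2 hb) hx
  | @cond_false b p q s s' t hb _ ih =>
    obtain ⟨r', hx, hs, hl⟩ := ih h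
    refine ⟨r', ?_, hs, hl⟩
    rw [← BExp.cost_shift h]
    exact Exec.cond_false (mt (BExp.holds_shift h b).1 hb) hx
  | @loop_done b p s hb =>
    refine ⟨r, ?_, h, .refl r⟩
    rw [← BExp.cost_shift h]
    exact Exec.loop_done (mt (BExp.holds_shift h b).1 hb)
  | @loop_step b p s s' s'' t t' hb _ _ ih ih' =>
    obtain ⟨r', hx, hs, hl⟩ := ih h
    obtain ⟨r'', hx', hs', hl'⟩ := ih' hs
    refine ⟨r'', ?_, hs', hl.trans hl'⟩
    rw [← BExp.cost_shift h]
    exact Exec.loop_step ((BExp.holds_shift h b).2 hb) hx hx'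

end KCut

namespace KCut
namespace CapGraph

/-! ### Connectivity and forests -/

section
variable {n m : ℕ} {G : CapGraph n m} {A B F : Finset (Fin m)} {e : Fin m} {u v : Fin n}

theorem reachable_of_mem (he : e ∈ B) : (G.span B).Reachable (G.fst e) (G.snd e) := by
  by_cases h : G.fst e = G.snd e
  · rw [h]
  · exact SimpleGraph.Adj.reachable ((SimpleGraph.fromRel_adj _ _ _).2 ⟨h, .inl ⟨e, he, rfl, rfl⟩⟩)

theorem reachable_induction {r : Fin n → Fin n → Prop} (hr : Equivalence r)
    (h : ∀ e ∈ B, r (G.fst e) (G.snd e)) (huv : (G.span B).Reachable u v) : r u v := by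
  obtain ⟨p⟩ := huv
  induction p with
  | nil => exact hr.refl _
  | cons hadj _ ih =>
    refine hr.trans ?_ ih
    obtain ⟨-, ⟨e, he, rfl, rfl⟩ | ⟨e, he, rfl, rfl⟩⟩ := (SimpleGraph.fromRel_adj _ _ _).1 hadj
    · exact h e he
    · exact hr.symm (h e he)

theorem reachable_equivalence (G : CapGraph n m) (B : Finset (Fin m)) :
    Equivalence (G.span B).Reachable :=
  SimpleGraph.reachable_is_equivalence _

theorem reachable_of_edges (h : ∀ e ∈ A, (G.span B).Reachable (G.fst e) (G.snd e))
    (huv : (G.span A).Reachable u v) : (G.span B).Reachable u v :=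
  reachable_induction (G.reachable_equivalence B) h huv

theorem reachable_mono (h : A ⊆ B) (huv : (G.span A).Reachable u v) :
    (G.span B).Reachable u v :=
  reachable_of_edges (fun _ he => reachable_of_mem (h he)) huv

theorem reachable_insert : (G.span (insert e B)).Reachable u v ↔ (G.span B).Reachable u v ∨
    ((G.span B).Reachable u (G.fst e) ∧ (G.span B).Reachable (G.snd e) v) ∨
    ((G.span B).Reachable u (G.snd e) ∧ (G.span B).Reachable (G.fst e) v) := by
  constructor
  · refine reachable_induction (r := fun u v => (G.span B).Reachable u v ∨
      ((G.span B).Reachable u (G.fst e) ∧ (G.span B).Reachable (G.snd e) v) ∨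
      ((G.span B).Reachable u (G.snd e) ∧ (G.span B).Reachable (G.fst e) v)) ⟨?_, ?_, ?_⟩ ?_
    · exact fun x => .inl (.refl x)
    · rintro x y (h | ⟨h1, h2⟩ | ⟨h1, h2⟩)
      · exact .inl h.symm
      · exact .inr (.inr ⟨h2.symm, h1.symm⟩)
      · exact .inr (.inl ⟨h2.symm, h1.symm⟩)
    · rintro x y z (h | ⟨h1, h2⟩ | ⟨h1, h2⟩) (h' | ⟨h1', h2'⟩ | ⟨h1', h2'⟩)
      · exact .inl (h.trans h')
      · exact .inr (.inl ⟨h.trans h1', h2'⟩)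
      · exact .inr (.inr ⟨h.trans h1', h2'⟩)
      · exact .inr (.inl ⟨h1, h2.trans h'⟩)
      · exact .inr (.inl ⟨h1, h2'⟩)
      · exact .inl (h1.trans h2')
      · exact .inr (.inr ⟨h1, h2.trans h'⟩)
      · exact .inl (h1.trans h2')
      · exact .inr (.inr ⟨h1, h2'⟩)
    · intro f hf
      rcases Finset.mem_insert.1 hf with rfl | hf
      · exact .inr (.inl ⟨.refl _, .refl _⟩)
      · exact .inl (reachable_of_mem hf)
  · have hs : B ⊆ insert e B := Finset.subset_insert e B
    have he := reachable_of_mem (G := G) (Finset.mem_insert_self e B)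
    rintro (h | ⟨h1, h2⟩ | ⟨h1, h2⟩)
    · exact reachable_mono hs h
    · exact ((reachable_mono hs h1).trans he).trans (reachable_mono hs h2)
    · exact ((reachable_mono hs h1).trans he.symm).trans (reachable_mono hs h2)

/-- The number of connected components of the spanning subgraph with edge set `B`. -/
noncomputable def comps (G : CapGraph n m) (B : Finset (Fin m)) : ℕ :=
  Nat.card (G.span B).ConnectedComponent

theorem comps_congr
    (h : ∀ u v, (G.span A).Reachable u v ↔ (G.span B).Reachable u v) : G.comps A = G.comps B :=
  Nat.card_congr (Quot.congr (Equiv.refl _) h)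

theorem comps_empty (G : CapGraph n m) : G.comps ∅ = n := by
  have h : ∀ u v, (G.span ∅).Reachable u v → u = v := fun u v =>
    reachable_induction (r := fun u v => u = v) ⟨fun _ => rfl, Eq.symm, Eq.trans⟩ (by simp)
  have hb : Function.Bijective (G.span ∅).connectedComponentMk := by
    refine ⟨fun u v huv => h u v (SimpleGraph.ConnectedComponent.eq.1 huv), fun c => ?_⟩
    induction c using SimpleGraph.ConnectedComponent.ind with
    | h v => exact ⟨v, rfl⟩
  rw [comps, ← Nat.card_eq_of_bijective _ hb, Nat.card_eq_fintype_card, Fintype.card_fin]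

/-- The new edge merges two components. The components other than that of `G.snd e` correspond to
the components after the insertion. -/
theorem comps_insert (h : ¬ (G.span B).Reachable (G.fst e) (G.snd e)) :
    G.comps (insert e B) + 1 = G.comps B := by
  classical
  set c := (G.span B).connectedComponentMk (G.snd e) with hc
  have hcard : Nat.card {x : (G.span B).ConnectedComponent // x ≠ c} + 1 = G.comps B := by
    have := Fintype.ofFinite (G.span B).ConnectedComponent
    rw [comps, Nat.card_eq_fintype_card, Nat.card_eq_fintype_card, Fintype.card_subtype_compl,
      Fintype.card_subtype_eq]
    exact Nat.sub_add_cancel (Fintype.card_pos_iff.2 ⟨c⟩)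
  rw [← hcard]
  congr 1
  symm
  have hle : ∀ u v, (G.span B).Reachable u v → (G.span (insert e B)).Reachable u v :=
    fun u v => reachable_mono (Finset.subset_insert e B)
  let f : (G.span B).ConnectedComponent → (G.span (insert e B)).ConnectedComponent :=
    Quot.map id hle
  have hf : ∀ v, f ((G.span B).connectedComponentMk v) =
    (G.span (insert e B)).connectedComponentMk v := fun v => rfl
  refine Nat.card_eq_of_bijective (fun x : {x // x ≠ c} => f x.1) ⟨?_, ?_⟩
  · rintro ⟨x, hx⟩ ⟨y, hy⟩ hxy
    induction x using SimpleGraph.ConnectedComponent.ind with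
    | h x =>
    induction y using SimpleGraph.ConnectedComponent.ind with
    | h y =>
    simp only [hf, SimpleGraph.ConnectedComponent.eq, reachable_insert] at hxy
    rw [Ne, hc, SimpleGraph.ConnectedComponent.eq] at hx hy
    rw [Subtype.mk.injEq, SimpleGraph.ConnectedComponent.eq]
    rcases hxy with h | ⟨h1, h2⟩ | ⟨h1, h2⟩
    · exact h
    · exact absurd h2.symm hy
    · exact absurd h1 hx
  · intro y
    induction y using SimpleGraph.ConnectedComponent.ind with
    | h y =>
    by_cases hy : (G.span B).Reachable y (G.snd e)
    · refine ⟨⟨(G.span B).connectedComponentMk (G.fst e), ?_⟩, ?_⟩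
      · rwa [Ne, hc, SimpleGraph.ConnectedComponent.eq]
      · simp only [hf, SimpleGraph.ConnectedComponent.eq, reachable_insert]
        exact .inr (.inl ⟨.refl _, hy.symm⟩)
    · refine ⟨⟨(G.span B).connectedComponentMk y, ?_⟩, hf y⟩
      rwa [Ne, hc, SimpleGraph.ConnectedComponent.eq]

theorem IsForest.subset (hF : G.IsForest F) (h : A ⊆ F) : G.IsForest A := fun e he hr =>
  hF e (h he) (reachable_mono (Finset.erase_subset_erase e h) hr)

theorem IsForest.card_add_comps (hF : G.IsForest F) : F.card + G.comps F = n := by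
  classical
  induction F using Finset.induction_on with
  | empty => simpa using G.comps_empty
  | insert e F he ih =>
    have h := hF e (Finset.mem_insert_self e F)
    rw [Finset.erase_insert he] at h
    rw [Finset.card_insert_of_notMem he, add_assoc, add_comm 1, comps_insert h]
    exact ih (hF.subset (Finset.subset_insert e F))

theorem IsForest.insert (hF : G.IsForest F) (h : ¬ (G.span F).Reachable (G.fst e) (G.snd e)) :
    G.IsForest (insert e F) := by
  classical
  have he : e ∉ F := fun he => h (reachable_of_mem he)
  intro f hf hr
  rcases Finset.mem_insert.1 hf with rfl | hf
  · rw [Finset.erase_insert he] at hr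
    exact h hr
  · have hef : e ≠ f := by rintro rfl; exact he hf
    rw [Finset.erase_insert_of_ne hef, reachable_insert] at hr
    have hs : ∀ {u v}, (G.span (F.erase f)).Reachable u v → (G.span F).Reachable u v :=
      reachable_mono (Finset.erase_subset f F)
    have hf' := reachable_of_mem (G := G) hf
    rcases hr with hr | ⟨h1, h2⟩ | ⟨h1, h2⟩
    · exact hF f hf hr
    · exact h (((hs h1).symm.trans hf').trans (hs h2).symm)
    · exact h (((hs h2).trans hf'.symm).trans (hs h1))

theorem isMaximalForest_iff : G.IsMaximalForest F ↔ G.IsForest F ∧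
    ∀ u v, (G.span Finset.univ).Reachable u v → (G.span F).Reachable u v := by
  classical
  constructor
  · intro h
    refine ⟨h.1, fun u v => reachable_of_edges fun e _ => ?_⟩
    by_contra hr
    have := h.2 (h.1.insert hr) (Finset.subset_insert e F) (Finset.mem_insert_self e F)
    exact hr (reachable_of_mem this)
  · rintro ⟨hF, h⟩
    refine ⟨hF, fun F' hF' hs e he => ?_⟩
    by_contra heF
    refine hF' e he (reachable_mono (fun f hf => Finset.mem_erase.2 ⟨?_, hs hf⟩)
      (h _ _ (reachable_of_mem (Finset.mem_univ e))))
    rintro rfl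
    exact heF hf

theorem IsMaximalForest.comps_eq (hF : G.IsMaximalForest F) : G.comps F = G.numComponents :=
  comps_congr fun u v =>
    ⟨reachable_mono (Finset.subset_univ _), (isMaximalForest_iff.1 hF).2 u v⟩

/-- Exchange: if `e` joins two parts that the edges of the maximal forest `F` in `B` do not
connect, then `e` can replace an edge of `F` outside `B`. -/
theorem IsMaximalForest.exchange (hF : G.IsMaximalForest F)
    (h : ¬ (G.span (F ∩ B)).Reachable (G.fst e) (G.snd e)) :
    e ∈ F ∨ ∃ f ∈ F, f ∉ B ∧ e ∉ F.erase f ∧ G.IsMaximalForest (insert e (F.erase f)) := by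
  classical
  by_cases heF : e ∈ F
  · exact .inl heF
  right
  obtain ⟨hFf, hFr⟩ := isMaximalForest_iff.1 hF
  have hre : (G.span F).Reachable (G.fst e) (G.snd e) := hFr _ _ (reachable_of_mem (Finset.mem_univ e))
  -- Instead of following a path in `F`, take a maximal part `F'` of `F` that contains `F ∩ B` and
  -- does not connect the ends of `e`. Any edge `f` of `F` outside `F'` then lies on the cycle that
  -- `e` closes.
  obtain ⟨F', hBF', hF'⟩ := (Set.toFinite {F' : Finset (Fin m) | F' ⊆ F ∧
    ¬ (G.span F').Reachable (G.fst e) (G.snd e)}).exists_le_maximal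
      (a := F ∩ B) ⟨Finset.inter_subset_left, h⟩
  obtain ⟨⟨hF'F, hF'r⟩, hmax⟩ := hF'
  obtain ⟨f, hfF, hfF'⟩ : ∃ f ∈ F, f ∉ F' := by
    by_contra hcon
    push Not at hcon
    exact hF'r (reachable_mono hcon hre)
  have hfB : f ∉ B := fun hfB => hfF' (hBF' (Finset.mem_inter.2 ⟨hfF, hfB⟩))
  have hrf : (G.span (insert f F')).Reachable (G.fst e) (G.snd e) := by
    by_contra hcon
    exact hfF' (hmax ⟨Finset.insert_subset hfF hF'F, hcon⟩ (Finset.subset_insert f F')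
      (Finset.mem_insert_self f F'))
  have hF'e : F' ⊆ F.erase f := fun g hg =>
    Finset.mem_erase.2 ⟨fun hgf => hfF' (hgf ▸ hg), hF'F hg⟩
  -- Adding `f` to `F'` connects the ends of `e`, so conversely adding `e` connects the ends of `f`.
  have hswap : (G.span (insert e (F.erase f))).Reachable (G.fst f) (G.snd f) := by
    refine reachable_mono (Finset.insert_subset_insert e hF'e) ?_
    rw [reachable_insert] at hrf ⊢
    rcases hrf with hr | ⟨h1, h2⟩ | ⟨h1, h2⟩
    · exact absurd hr hF'r
    · exact .inr (.inl ⟨h1.symm, h2.symm⟩)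
    · exact .inr (.inr ⟨h2, h1⟩)
  have hne : ¬ (G.span (F.erase f)).Reachable (G.fst e) (G.snd e) := by
    intro hr
    refine hFf f hfF ?_
    rw [reachable_insert] at hswap
    rcases hswap with hs | ⟨h1, h2⟩ | ⟨h1, h2⟩
    · exact hs
    · exact (h1.trans hr).trans h2
    · exact (h1.trans hr.symm).trans h2
  refine ⟨f, hfF, hfB, fun he => heF (Finset.mem_of_mem_erase he), isMaximalForest_iff.2
    ⟨(hFf.subset (Finset.erase_subset f F)).insert hne, fun u v huv => ?_⟩⟩
  refine reachable_of_edges (fun g hg => ?_) (hFr u v huv)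
  by_cases hgf : g = f
  · exact hgf ▸ hswap
  · exact reachable_of_mem (Finset.mem_insert_of_mem (Finset.mem_erase.2 ⟨hgf, hg⟩))

/-- If the edges in `B` are lighter than the other ones and no exchange makes `F` lighter, then
the edges of `F` in `B` connect what `B` connects. -/
theorem IsMaximalForest.reachable_inter {x : Fin m → ℝ} (hF : G.IsMaximalForest F)
    (hmin : ∀ F', G.IsMaximalForest F' → ∑ e ∈ F, x e ≤ ∑ e ∈ F', x e)
    (hB : ∀ e ∈ B, ∀ f ∉ B, x e < x f) (huv : (G.span B).Reachable u v) :
    (G.span (F ∩ B)).Reachable u v := by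
  classical
  refine reachable_of_edges (fun e he => ?_) huv
  by_contra hr
  rcases hF.exchange hr with heF | ⟨f, hfF, hfB, hef, hF'⟩
  · exact hr (reachable_of_mem (Finset.mem_inter.2 ⟨heF, he⟩))
  · have h1 := hmin _ hF'
    rw [Finset.sum_insert hef, ← Finset.add_sum_erase F x hfF] at h1
    linarith [hB e he f hfB]

/-- `F ∩ B` is a forest with the same components as `B`. For threshold sets `B` of x this makes the
number of edges in `B` the same for all forests of minimum length. -/
theorem IsMaximalForest.card_inter_add_comps {x : Fin m → ℝ} (hF : G.IsMaximalForest F)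
    (hmin : ∀ F', G.IsMaximalForest F' → ∑ e ∈ F, x e ≤ ∑ e ∈ F', x e)
    (hB : ∀ e ∈ B, ∀ f ∉ B, x e < x f) : (F ∩ B).card + G.comps B = n := by
  refine Eq.trans ?_
    (IsForest.card_add_comps ((isMaximalForest_iff.1 hF).1.subset (Finset.inter_subset_left (s₂ := B))))
  congr 1
  exact comps_congr fun u v =>
    ⟨hF.reachable_inter hmin hB, reachable_mono Finset.inter_subset_right⟩

end
end CapGraph
end KCut

namespace KCut
namespace CapGraph

/-! ### Optimum solutions of the `k`-cut LP -/

section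
variable {n m : ℕ} {G : CapGraph n m} {k : ℕ} {y : Finset (Fin m) → ℝ} {z : Fin m → ℝ}

theorem sum_mul_sum_mem (D : Finset (Fin m) → ℝ) (x : Fin m → ℝ) :
    ∑ F, D F * ∑ e ∈ F, x e = ∑ e, x e * ∑ F : Finset (Fin m) with e ∈ F, D F := by
  classical
  have h1 : ∀ F : Finset (Fin m), D F * ∑ e ∈ F, x e = ∑ e, if e ∈ F then x e * D F else 0 := by
    intro F
    rw [Finset.mul_sum, ← Finset.sum_filter, Finset.filter_mem_eq_inter, Finset.univ_inter]
    exact Finset.sum_congr rfl fun _ _ => mul_comm _ _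
  simp_rw [h1]
  rw [Finset.sum_comm]
  refine Finset.sum_congr rfl fun e _ => ?_
  rw [Finset.mul_sum, Finset.sum_filter]

/-- Strong duality. -/
theorem DualOptimal.exists_primal (h : G.DualOptimal k y z) : ∃ x : Fin m → ℝ,
    (∀ e, 0 ≤ x e) ∧ (∀ e, x e ≤ 1) ∧
    (∀ F, G.IsMaximalForest F → (k : ℝ) - G.numComponents ≤ ∑ e ∈ F, x e) ∧
    ∑ e, G.cap e * x e ≤ G.dualValue k y z := by
  classical
  obtain ⟨⟨hy, hys, hz, hp⟩, hopt⟩ := h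
  set κ : ℝ := (k : ℝ) - G.numComponents with hκ
  set opt := G.dualValue k y z with hoptdef
  have hval : ∀ y z, G.dualValue k y z = κ * ∑ F, y F - ∑ e, z e := fun _ _ => rfl
  -- A point of the cube is mapped to the lengths of all maximal forests and its cost. Other edge
  -- sets get the value `κ`, which makes their constraint void. A common point of `K` and `T` is the
  -- primal solution sought.
  let φ : (Fin m → ℝ) → (Finset (Fin m) → ℝ) × ℝ := fun x =>
    (fun F => if G.IsMaximalForest F then ∑ e ∈ F, x e else κ, ∑ e, G.cap e * x e)
  let K : Set ((Finset (Fin m) → ℝ) × ℝ) := φ '' Set.Icc 0 1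
  let T : Set ((Finset (Fin m) → ℝ) × ℝ) := {p | (∀ F, κ ≤ p.1 F) ∧ p.2 ≤ opt}
  have hKc : Convex ℝ K := by
    rintro _ ⟨x, hx, rfl⟩ _ ⟨x', hx', rfl⟩ a b ha hb hab
    refine ⟨a • x + b • x', convex_Icc 0 1 hx hx' ha hb hab, ?_⟩
    ext F
    · simp only [φ, Prod.fst_add, Prod.smul_fst, Pi.add_apply, Pi.smul_apply, smul_eq_mul]
      split_ifs
      · rw [Finset.sum_add_distrib, Finset.mul_sum, Finset.mul_sum]
      · rw [← add_mul, hab, one_mul]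
    · simp only [φ, Prod.snd_add, Prod.smul_snd, Pi.add_apply, Pi.smul_apply, smul_eq_mul]
      rw [Finset.mul_sum, Finset.mul_sum, ← Finset.sum_add_distrib]
      exact Finset.sum_congr rfl fun _ _ => by ring
  have hφ : Continuous φ := by
    refine Continuous.prodMk (continuous_pi fun F => ?_) (by fun_prop)
    by_cases hF : G.IsMaximalForest F
    · simp only [hF, if_true]; fun_prop
    · simp only [hF, if_false]; fun_prop
  have hKk : IsCompact K := isCompact_Icc.image hφ
  have hTc : Convex ℝ T := by
    rintro p hp q hq a b ha hb hab
    refine ⟨fun F => ?_, ?_⟩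
    · have h1 := mul_le_mul_of_nonneg_left (hp.1 F) ha
      have h2 := mul_le_mul_of_nonneg_left (hq.1 F) hb
      have h3 : κ = a * κ + b * κ := by rw [← add_mul, hab, one_mul]
      simp only [Prod.fst_add, Prod.smul_fst, Pi.add_apply, Pi.smul_apply, smul_eq_mul]
      linarith
    · have h1 := mul_le_mul_of_nonneg_left hp.2 ha
      have h2 := mul_le_mul_of_nonneg_left hq.2 hb
      have h3 : opt = a * opt + b * opt := by rw [← add_mul, hab, one_mul]
      simp only [Prod.snd_add, Prod.smul_snd, smul_eq_mul]
      linarith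
  have hTl : IsClosed T := by
    refine IsClosed.inter ?_ (isClosed_le continuous_snd continuous_const)
    have : {p : (Finset (Fin m) → ℝ) × ℝ | ∀ F, κ ≤ p.1 F} = ⋂ F, {p | κ ≤ p.1 F} := by
      ext; simp
    change IsClosed {p : (Finset (Fin m) → ℝ) × ℝ | ∀ F, κ ≤ p.1 F}
    rw [this]
    exact isClosed_iInter fun F => isClosed_le continuous_const (by fun_prop)
  by_cases hdis : Disjoint K T
  swap
  · obtain ⟨_, ⟨x, hx, rfl⟩, hx1, hx2⟩ := Set.not_disjoint_iff.1 hdis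
    refine ⟨x, hx.1, hx.2, fun F hF => ?_, hx2⟩
    simpa [φ, hF] using hx1 F
  exfalso
  obtain ⟨f, u, v, hfK, huv, hfT⟩ := geometric_hahn_banach_compact_closed hKc hKk hTc hTl hdis
  set d : Finset (Fin m) → ℝ := fun F => f (Pi.single F 1, 0) with hd
  set t : ℝ := - f (0, 1) with ht
  have hf : ∀ p, f p = ∑ F, d F * p.1 F - t * p.2 := by
    intro p
    have h1 : p = ∑ F, p.1 F • ((Pi.single F 1, 0) : (Finset (Fin m) → ℝ) × ℝ) + p.2 • (0, 1) := by
      ext F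
      · simp [Finset.sum_apply, Prod.fst_sum, Pi.single_apply]
      · simp [Prod.snd_sum]
    conv_lhs => rw [h1]
    rw [map_add, map_sum, map_smul]
    simp only [map_smul, smul_eq_mul, hd, ht]
    rw [neg_mul, sub_neg_eq_add, mul_comm (p.2)]
    congr 1
    exact Finset.sum_congr rfl fun _ _ => mul_comm _ _
  set q : (Finset (Fin m) → ℝ) × ℝ := (fun _ => κ, opt) with hq
  have hqT : q ∈ T := ⟨fun _ => le_rfl, le_rfl⟩
  have hvq := hfT q hqT
  -- `T` is `q` plus a cone and `f` is bounded below on it, so `f` is non-negative on the cone. This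
  -- gives the signs of the multipliers.
  have hray : ∀ p : (Finset (Fin m) → ℝ) × ℝ, (∀ s : ℝ, 0 ≤ s → q + s • p ∈ T) → 0 ≤ f p := by
    intro p hp
    by_contra hneg
    push Not at hneg
    have hs : 0 ≤ (f q - v) / (- f p) := div_nonneg (by linarith) (by linarith)
    have := hfT _ (hp _ hs)
    rw [map_add, map_smul, smul_eq_mul, div_neg, neg_mul, div_mul_cancel₀ _ hneg.ne] at this
    linarith
  have hd0 : ∀ F, 0 ≤ d F := by
    intro F
    refine hray _ fun s hs => ⟨fun F' => ?_, ?_⟩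
    · simp only [hq, Prod.fst_add, Prod.smul_fst, Pi.add_apply, Pi.smul_apply, smul_eq_mul,
        Pi.single_apply]
      split_ifs <;> linarith
    · simp [hq]
  have ht0 : 0 ≤ t := by
    have := hray (0, -1) fun s hs => ⟨fun F' => by simp [hq], by simp [hq, hs]⟩
    have h2 : ((0, -1) : (Finset (Fin m) → ℝ) × ℝ) = -(0, 1) := by simp
    rwa [h2, map_neg] at this
  set D : Finset (Fin m) → ℝ := fun F => if G.IsMaximalForest F then d F else 0 with hD
  have hD0 : ∀ F, 0 ≤ D F := fun F => by
    simp only [hD]; split_ifs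
    · exact hd0 F
    · exact le_rfl
  have hDs : ∀ F, ¬ G.IsMaximalForest F → D F = 0 := fun F hF => by simp [hD, hF]
  set dd : Fin m → ℝ := fun e => ∑ F : Finset (Fin m) with e ∈ F, D F with hdd
  -- The least slack that makes `D` a packing for the capacities t · c.
  set z' : Fin m → ℝ := fun e => max 0 (dd e - t * G.cap e) with hz'
  have hz'0 : ∀ e, 0 ≤ z' e := fun e => le_max_left _ _
  have hz'1 : ∀ e, dd e ≤ t * G.cap e + z' e := fun e => by
    have : dd e - t * G.cap e ≤ z' e := le_max_right _ _
    linarith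
  have hkey : ∑ e, z' e < κ * ∑ F, D F - t * opt := by
    -- This vertex of the cube maximises the separating functional on `K`, and its part that depends
    -- on x has there the value `∑ e, z' e`.
    let x : Fin m → ℝ := fun e => if 0 ≤ dd e - t * G.cap e then 1 else 0
    have hx : x ∈ Set.Icc (0 : Fin m → ℝ) 1 := by
      constructor <;> intro e <;> simp only [x, Pi.zero_apply, Pi.one_apply] <;> split_ifs <;> norm_num
    have h1 := hfK _ ⟨x, hx, rfl⟩
    have h2 : f (φ x) < f q := by linarith
    rw [hf, hf] at h2
    have h3 : ∑ F, d F * (φ x).1 F = ∑ F, D F * ∑ e ∈ F, x e + ∑ F, (d F - D F) * κ := by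
      rw [← Finset.sum_add_distrib]
      refine Finset.sum_congr rfl fun F _ => ?_
      by_cases hF : G.IsMaximalForest F <;> simp [φ, hD, hF]
    have h4 : ∑ F, d F * q.1 F = κ * ∑ F, D F + ∑ F, (d F - D F) * κ := by
      rw [Finset.mul_sum, ← Finset.sum_add_distrib]
      exact Finset.sum_congr rfl fun F _ => by simp only [hq]; ring
    rw [h3, h4, sum_mul_sum_mem] at h2
    have h5 : ∑ e, z' e = ∑ e, x e * dd e - t * ∑ e, G.cap e * x e := by
      rw [Finset.mul_sum, ← Finset.sum_sub_distrib]
      refine Finset.sum_congr rfl fun e _ => ?_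
      simp only [hz', x]
      split_ifs with h
      · rw [max_eq_right h]; ring
      · rw [max_eq_left (by linarith)]; ring
    rw [h5]
    simp only [φ, hq] at h2
    linarith
  -- If t = 0, then `(D, z')` is an improving ray and is added to the optimum. If t > 0, then `(D,
  -- z')` divided by t is itself feasible and better than the optimum.
  rcases ht0.eq_or_lt with ht0 | ht0
  · have hfeas : G.DualFeasible (fun F => y F + D F) (fun e => z e + z' e) := by
      refine ⟨fun F => add_nonneg (hy F) (hD0 F), fun F hF => ?_,
        fun e => add_nonneg (hz e) (hz'0 e), fun e => ?_⟩
      · simp only [hys F hF, hDs F hF, add_zero]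
      · rw [Finset.sum_add_distrib]
        have := hp e
        have := hz'1 e
        rw [← ht0, zero_mul, zero_add] at this
        simp only [hdd] at this
        linarith
    have := hopt _ _ hfeas
    rw [hval, Finset.sum_add_distrib, Finset.sum_add_distrib] at this
    have h6 := hval y z
    rw [← ht0, zero_mul, sub_zero] at hkey
    rw [← hoptdef] at h6
    linarith
  · have hfeas : G.DualFeasible (fun F => t⁻¹ * D F) (fun e => t⁻¹ * z' e) := by
      have hti : 0 ≤ t⁻¹ := by positivity
      refine ⟨fun F => mul_nonneg hti (hD0 F), fun F hF => ?_,
        fun e => mul_nonneg hti (hz'0 e), fun e => ?_⟩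
      · simp only [hDs F hF, mul_zero]
      · rw [← Finset.mul_sum]
        have := mul_le_mul_of_nonneg_left (hz'1 e) hti
        rwa [mul_add, inv_mul_cancel_left₀ ht0.ne'] at this
    have := hopt _ _ hfeas
    rw [hval, ← Finset.mul_sum, ← Finset.mul_sum] at this
    have h6 := mul_lt_mul_of_pos_left hkey (inv_pos.2 ht0)
    rw [mul_sub, inv_mul_cancel_left₀ ht0.ne'] at h6
    linarith [mul_left_comm κ t⁻¹ (∑ F, D F)]

/-- Complementary slackness. -/
theorem DualOptimal.exists_complementary (h : G.DualOptimal k y z) : ∃ x : Fin m → ℝ,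
    (∀ e, 0 ≤ x e) ∧ (∀ e, x e ≤ 1) ∧
    (∀ F, G.IsMaximalForest F → (k : ℝ) - G.numComponents ≤ ∑ e ∈ F, x e) ∧
    (∀ F, 0 < y F → ∑ e ∈ F, x e = (k : ℝ) - G.numComponents) ∧
    (∀ e, x e < 1 → z e = 0) ∧
    (∀ e, 0 < x e → ∑ F : Finset (Fin m) with e ∈ F, y F = G.cap e + z e) := by
  classical
  obtain ⟨x, hx0, hx1, hxF, hopt⟩ := h.exists_primal
  obtain ⟨⟨hy, hys, hz, hp⟩, -⟩ := h
  set κ : ℝ := (k : ℝ) - G.numComponents with hκ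
  have hval : G.dualValue k y z = κ * ∑ F, y F - ∑ e, z e := rfl
  have a0 : ∀ F, 0 ≤ y F * (∑ e ∈ F, x e - κ) := by
    intro F
    by_cases hF : G.IsMaximalForest F
    · exact mul_nonneg (hy F) (sub_nonneg.2 (hxF F hF))
    · rw [hys F hF, zero_mul]
  have b0 : ∀ e, 0 ≤ x e * (G.cap e + z e - ∑ F : Finset (Fin m) with e ∈ F, y F) :=
    fun e => mul_nonneg (hx0 e) (sub_nonneg.2 (hp e))
  have c0 : ∀ e, 0 ≤ (1 - x e) * z e := fun e => mul_nonneg (sub_nonneg.2 (hx1 e)) (hz e)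
  -- The sum of all slackness terms is the primal cost minus the dual value. As every term is
  -- non-negative, each vanishes.
  have hsum : ∑ F, y F * (∑ e ∈ F, x e - κ) +
      ∑ e, x e * (G.cap e + z e - ∑ F : Finset (Fin m) with e ∈ F, y F) +
      ∑ e, (1 - x e) * z e ≤ 0 := by
    simp only [mul_sub, mul_add, sub_mul, one_mul, Finset.sum_sub_distrib, Finset.sum_add_distrib,
      sum_mul_sum_mem, ← Finset.sum_mul]
    have : ∑ e, x e * G.cap e = ∑ e, G.cap e * x e :=
      Finset.sum_congr rfl fun _ _ => mul_comm _ _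
    linarith [mul_comm κ (∑ F, y F)]
  have sa := Finset.sum_nonneg fun F (_ : F ∈ Finset.univ) => a0 F
  have sb := Finset.sum_nonneg fun e (_ : e ∈ Finset.univ) => b0 e
  have sc := Finset.sum_nonneg fun e (_ : e ∈ Finset.univ) => c0 e
  have ea := (Finset.sum_eq_zero_iff_of_nonneg fun F _ => a0 F).1 (le_antisymm (by linarith) sa)
  have eb := (Finset.sum_eq_zero_iff_of_nonneg fun e _ => b0 e).1 (le_antisymm (by linarith) sb)
  have ec := (Finset.sum_eq_zero_iff_of_nonneg fun e _ => c0 e).1 (le_antisymm (by linarith) sc)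
  refine ⟨x, hx0, hx1, hxF, fun F hF => ?_, fun e he => ?_, fun e he => ?_⟩
  · have := (mul_eq_zero.1 (ea F (Finset.mem_univ F))).resolve_left hF.ne'
    linarith
  · exact (mul_eq_zero.1 (ec e (Finset.mem_univ e))).resolve_left (by linarith)
  · have := (mul_eq_zero.1 (eb e (Finset.mem_univ e))).resolve_left he.ne'
    linarith

end
end CapGraph
end KCut

namespace KCut
namespace CapGraph

/-! ### Every minimum `k`-cut meets few edges of a forest in the support -/

section
variable {n m : ℕ} {G : CapGraph n m} {k : ℕ} {y : Finset (Fin m) → ℝ} {z : Fin m → ℝ}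

/-- From here on cuts are handled by labellings rather than partitions; the parts are the fibres of
`f`. -/
theorem isKCut_of_label {α : Type*} [DecidableEq α] (f : Fin n → α)
    (h : k ≤ (Finset.univ.image f).card) :
    G.IsKCut k (Finset.univ.filter fun e => f (G.fst e) ≠ f (G.snd e)) := by
  classical
  let P := Finpartition.ofSetoid (Setoid.ker f)
  have hP : ∀ u v, P.part u = P.part v ↔ f u = f v := by
    intro u v
    rw [P.part_eq_iff_mem (P.part_mem.2 (Finset.mem_univ v)), Finpartition.mem_part_ofSetoid_iff_rel,
      Setoid.ker_def, eq_comm]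
  refine ⟨P, h.trans ?_, ?_⟩
  -- `Option` supplies a value on the empty set, so that no default label has to be chosen.
  · let g : Finset (Fin n) → Option α := fun s => if h : s.Nonempty then some (f h.choose) else none
    have hg : ∀ v, g (P.part v) = some (f v) := by
      intro v
      have hne : (P.part v).Nonempty := ⟨v, P.mem_part (Finset.mem_univ v)⟩
      simp only [g, hne, dif_pos]
      congr 1
      rw [← hP]
      exact P.part_eq_of_mem (P.part_mem.2 (Finset.mem_univ v)) hne.choose_spec
    have : (Finset.univ.image f).image some ⊆ P.parts.image g := by
      intro x hx
      simp only [Finset.mem_image, Finset.mem_univ, true_and, exists_exists_eq_and] at hx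
      obtain ⟨v, rfl⟩ := hx
      exact Finset.mem_image.2 ⟨P.part v, P.part_mem.2 (Finset.mem_univ v), hg v⟩
    calc (Finset.univ.image f).card = ((Finset.univ.image f).image some).card :=
          (Finset.card_image_of_injective _ (Option.some_injective α)).symm
      _ ≤ (P.parts.image g).card := Finset.card_le_card this
      _ ≤ _ := Finset.card_image_le
  · ext e
    simp [crossing, hP]

theorem IsKCut.exists_label {A : Finset (Fin m)} (h : G.IsKCut k A) :
    ∃ f : Fin n → Finset (Fin n), k ≤ (Finset.univ.image f).card ∧
      A = Finset.univ.filter fun e => f (G.fst e) ≠ f (G.snd e) := by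
  obtain ⟨P, hP, rfl⟩ := h
  refine ⟨P.part, hP.trans (Finset.card_le_card fun s hs => ?_), ?_⟩
  · obtain ⟨v, hv⟩ := P.nonempty_of_mem_parts hs
    exact Finset.mem_image.2 ⟨v, Finset.mem_univ v, P.part_eq_of_mem hs hv⟩
  · ext e; simp [crossing]

/-- The `j` smallest weights have at most the average of all weights: discarding a largest element
never raises the average. The inequality is multiplied out to avoid division by zero. -/
theorem exists_subset_sum_le {α : Type*} (w : α → ℝ) (T : Finset α) (j : ℕ) (hj : j ≤ T.card) :
    ∃ S ⊆ T, S.card = j ∧ T.card * ∑ a ∈ S, w a ≤ j * ∑ a ∈ T, w a := by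
  classical
  induction hN : T.card generalizing T with
  | zero =>
    have hT : T = ∅ := Finset.card_eq_zero.1 hN
    have hj0 : j = 0 := by omega
    subst hT hj0
    exact ⟨∅, by simp⟩
  | succ N ih =>
    rcases hj.eq_or_lt with hj | hj
    · exact ⟨T, subset_rfl, hj.symm, by rw [hj, hN]⟩
    obtain ⟨a, haT, ha⟩ := T.exists_max_image w (Finset.card_pos.1 (by omega))
    have hc : (T.erase a).card = N := by rw [Finset.card_erase_of_mem haT, hN]; rfl
    obtain ⟨S, hST, hSj, hS⟩ := ih (T.erase a) (by omega) hc
    refine ⟨S, hST.trans (Finset.erase_subset a T), hSj, ?_⟩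
    have hsum := Finset.add_sum_erase T w haT
    have hle : ∑ b ∈ T.erase a, w b ≤ N * w a := by
      have := Finset.sum_le_card_nsmul (T.erase a) w (w a)
        fun b hb => ha b (Finset.mem_of_mem_erase hb)
      rwa [hc, nsmul_eq_mul] at this
    rw [← hsum]
    push_cast
    rcases Nat.eq_zero_or_pos N with rfl | hNpos
    · have hj0 : j = 0 := by omega
      subst hj0
      rw [Finset.card_eq_zero.1 hSj]
      simp
    · have hN' : (0 : ℝ) < N := by exact_mod_cast hNpos
      have hj' : (0 : ℝ) ≤ j := by positivity
      refine le_of_mul_le_mul_left ?_ hN'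
      have h1 := mul_le_mul_of_nonneg_left hS (by positivity : (0 : ℝ) ≤ N + 1)
      have h2 := mul_le_mul_of_nonneg_left hle hj'
      linarith

theorem exists_isMaximalForest (G : CapGraph n m) : ∃ F, G.IsMaximalForest F := by
  obtain ⟨F, -, hF⟩ := (Set.toFinite {F | G.IsForest F}).exists_le_maximal (a := ∅)
    (by simp [IsForest])
  exact ⟨F, hF⟩

/-- The integrality gap of the `k`-cut LP is less than `2`. -/
theorem DualOptimal.capOf_lt (h : G.DualOptimal k y z) (hpos : ∀ A, G.IsKCut k A → 0 < G.capOf A) {A : Finset (Fin m)} (hA : G.IsMinKCut k A) :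
    G.capOf A < 2 * G.dualValue k y z ∧ 0 < ∑ F, y F := by
  classical
  obtain ⟨x, hx0, hx1, hxF, hyx, hxz, hxt⟩ := h.exists_complementary
  obtain ⟨⟨hy, hys, hz, hp⟩, -⟩ := h
  set Y := ∑ F, y F with hY
  set Z := ∑ e, z e with hZ
  have hZ0 : 0 ≤ Z := Finset.sum_nonneg fun e _ => hz e
  have hY0 : 0 ≤ Y := Finset.sum_nonneg fun F _ => hy F
  have hval : G.dualValue k y z = ((k : ℝ) - G.numComponents) * Y - Z := rfl
  set h0 : ℕ := G.numComponents with hh0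
  set E0 : Finset (Fin m) := Finset.univ.filter fun e => x e ≤ 0 with hE0
  set B1 : Finset (Fin m) := Finset.univ.filter fun e => x e < 1 with hB1
  have hE0B1 : E0 ⊆ B1 := fun e he => by
    simp only [hE0, hB1, Finset.mem_filter, Finset.mem_univ, true_and] at he ⊢; linarith
  have hlt0 : ∀ e ∈ E0, ∀ f ∉ E0, x e < x f := fun e he f hf => by
    simp only [hE0, Finset.mem_filter, Finset.mem_univ, true_and] at he hf; linarith
  have hlt1 : ∀ e ∈ B1, ∀ f ∉ B1, x e < x f := fun e he f hf => by
    simp only [hB1, Finset.mem_filter, Finset.mem_univ, true_and] at he hf; linarith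
  set q := G.comps E0 with hq
  set h1 := G.comps B1 with hh1
  -- A packed forest has length exactly k - h, which primal feasibility makes the least possible.
  have hmin : ∀ F, 0 < y F → ∀ F', G.IsMaximalForest F' → ∑ e ∈ F, x e ≤ ∑ e ∈ F', x e :=
    fun F hF F' hF' => (hyx F hF).trans_le (hxF F' hF')
  have hmax : ∀ F, 0 < y F → G.IsMaximalForest F := fun F hF => by
    by_contra hcon
    exact hF.ne' (hys F hcon)
  -- the load of a set of light edges
  have hload : ∀ B : Finset (Fin m), (∀ e ∈ B, ∀ f ∉ B, x e < x f) →
      ∑ e ∈ B, ∑ F : Finset (Fin m) with e ∈ F, y F = ((n : ℝ) - G.comps B) * Y := by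
    intro B hB
    have h1 := sum_mul_sum_mem y (fun e => if e ∈ B then (1 : ℝ) else 0)
    simp only [ite_mul, one_mul, zero_mul, Finset.sum_ite_mem, Finset.univ_inter,
      Finset.sum_const, nsmul_eq_mul, mul_one] at h1
    rw [← h1, hY, Finset.mul_sum]
    refine Finset.sum_congr rfl fun F _ => ?_
    rcases (hy F).eq_or_lt with hF | hF
    · rw [← hF]; ring
    · have := (hmax F hF).card_inter_add_comps (hmin F hF) hB
      have : ((F ∩ B).card : ℝ) + G.comps B = n := by exact_mod_cast this
      rw [← this]; ring
  have hl0 := hload E0 hlt0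
  have hl1 := hload B1 hlt1
  have hlu := hload Finset.univ fun e _ f hf => absurd (Finset.mem_univ f) hf
  have hcu : G.comps Finset.univ = h0 := rfl
  rw [hcu] at hlu
  set dd : Fin m → ℝ := fun e => ∑ F : Finset (Fin m) with e ∈ F, y F with hdd
  -- Edges outside `B1` have x = 1, so their load is c + z; and `z` vanishes on `B1`, so all of `Z`
  -- is found outside it.
  have hcap1 : G.capOf B1ᶜ = ((h1 : ℝ) - h0) * Y - Z := by
    have e1 : ∑ e ∈ B1ᶜ, (G.cap e + z e) = ∑ e ∈ B1ᶜ, dd e := by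
      refine Finset.sum_congr rfl fun e he => (hxt e ?_).symm
      simp only [hB1, Finset.mem_compl, Finset.mem_filter, Finset.mem_univ, true_and] at he
      linarith
    have e2 : ∑ e ∈ B1ᶜ, z e = Z := by
      refine Finset.sum_subset (Finset.subset_univ _) fun e _ he => hxz e ?_
      simpa [hB1] using he
    have e3 := Finset.sum_add_sum_compl B1 dd
    rw [Finset.sum_add_distrib, e2] at e1
    rw [capOf]
    linarith
  -- Where 0 < x < 1, the slack is 0 and the load equals the capacity.
  have hcap' : G.capOf (B1 \ E0) = ((q : ℝ) - h1) * Y := by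
    have e1 : ∑ e ∈ B1 \ E0, G.cap e = ∑ e ∈ B1 \ E0, dd e := by
      refine Finset.sum_congr rfl fun e he => ?_
      simp only [hB1, hE0, Finset.mem_sdiff, Finset.mem_filter, Finset.mem_univ, true_and,
        not_le] at he
      have := hxt e he.2
      rw [hxz e he.1, add_zero] at this
      exact this.symm
    have e3 := Finset.sum_sdiff (f := dd) hE0B1
    rw [capOf, e1]
    linarith
  have hcap_nonneg : ∀ B, 0 ≤ G.capOf B := fun B => Finset.sum_nonneg fun e _ => G.cap_nonneg e
  have hcap_mono : ∀ B B', B ⊆ B' → G.capOf B ≤ G.capOf B' := fun B B' hB =>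
    Finset.sum_le_sum_of_subset_of_nonneg hB fun e _ _ => G.cap_nonneg e
  set c0 : Fin n → (G.span E0).ConnectedComponent := (G.span E0).connectedComponentMk with hc0
  set c1 : Fin n → (G.span B1).ConnectedComponent := (G.span B1).connectedComponentMk with hc1
  have := Fintype.ofFinite (G.span E0).ConnectedComponent
  have := Fintype.ofFinite (G.span B1).ConnectedComponent
  have hsurj0 : Function.Surjective c0 := fun c => by
    induction c using SimpleGraph.ConnectedComponent.ind with
    | h v => exact ⟨v, rfl⟩
  have hsurj1 : Function.Surjective c1 := fun c => by
    induction c using SimpleGraph.ConnectedComponent.ind with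
    | h v => exact ⟨v, rfl⟩
  have hcard0 : Fintype.card (G.span E0).ConnectedComponent = q := by
    rw [hq, comps, Nat.card_eq_fintype_card]
  have hcard1 : Fintype.card (G.span B1).ConnectedComponent = h1 := by
    rw [hh1, comps, Nat.card_eq_fintype_card]
  have hedge0 : ∀ e ∈ E0, c0 (G.fst e) = c0 (G.snd e) := fun e he =>
    SimpleGraph.ConnectedComponent.eq.2 (reachable_of_mem he)
  have hedge1 : ∀ e ∈ B1, c1 (G.fst e) = c1 (G.snd e) := fun e he =>
    SimpleGraph.ConnectedComponent.eq.2 (reachable_of_mem he)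
  have h01 : ∀ u v, c0 u = c0 v → c1 u = c1 v := fun u v huv =>
    SimpleGraph.ConnectedComponent.eq.2
      (reachable_mono hE0B1 (SimpleGraph.ConnectedComponent.eq.1 huv))
  -- at least `k` parts remain when the edges of length `0` are contracted
  have hqk : k ≤ q := by
    obtain ⟨F, hF, hFmin⟩ := (Set.toFinite {F | G.IsMaximalForest F}).exists_minimalFor
      (fun F => ∑ e ∈ F, x e) _ G.exists_isMaximalForest
    have hFmin' : ∀ F', G.IsMaximalForest F' → ∑ e ∈ F, x e ≤ ∑ e ∈ F', x e := fun F' hF' =>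
      (le_total _ _).elim id fun hle => hFmin hF' hle
    have e1 := hF.card_inter_add_comps hFmin' hlt0
    have e2 := IsForest.card_add_comps (isMaximalForest_iff.1 hF).1
    rw [hF.comps_eq] at e2
    have e3 : ∑ e ∈ F, x e ≤ ((F \ E0).card : ℝ) := by
      rw [← Finset.sum_sdiff (Finset.inter_subset_left (s₁ := F) (s₂ := E0)),
        Finset.sdiff_inter_self_left]
      have e4 : ∑ e ∈ F ∩ E0, x e ≤ 0 := Finset.sum_nonpos fun e he =>
        (Finset.mem_filter.1 (Finset.mem_inter.1 he).2).2
      have e5 : ∑ e ∈ F \ E0, x e ≤ ∑ e ∈ F \ E0, (1 : ℝ) := Finset.sum_le_sum fun e _ => hx1 e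
      rw [Finset.sum_const, nsmul_eq_mul, mul_one] at e5
      linarith
    have e4 := hxF F hF
    have e5 := Finset.card_sdiff_add_card_inter F E0
    have e6 : (k : ℝ) - h0 ≤ ((F \ E0).card : ℝ) := e4.trans e3
    have e7 : k ≤ (F \ E0).card + h0 := by
      have : (k : ℝ) ≤ (((F \ E0).card + h0 : ℕ) : ℝ) := by push_cast; linarith
      exact_mod_cast this
    omega
  -- Separating the components of `E0` is a `k`-cut; its positive capacity is at most (q - h0) Y -
  -- Z.
  have hYpos : 0 < Y := by
    have e1 := hpos _ (isKCut_of_label (G := G) c0 (k := k) (by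
      rwa [Finset.image_univ_of_surjective hsurj0, Finset.card_univ, hcard0]))
    have e2 : G.capOf (Finset.univ.filter fun e => c0 (G.fst e) ≠ c0 (G.snd e)) ≤
        G.capOf B1ᶜ + G.capOf (B1 \ E0) := by
      rw [capOf, capOf, capOf, ← Finset.sum_union
        (Finset.disjoint_left.2 fun e he he' =>
          (Finset.mem_compl.1 he) (Finset.mem_sdiff.1 he').1)]
      refine hcap_mono _ _ fun e he => ?_
      simp only [Finset.mem_filter, Finset.mem_univ, true_and, Finset.mem_union,
        Finset.mem_compl, Finset.mem_sdiff] at he ⊢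
      by_cases heB : e ∈ B1
      · exact .inr ⟨heB, fun h => he (hedge0 e h)⟩
      · exact .inl heB
    rw [hcap1, hcap'] at e2
    have e3 : 0 < ((q : ℝ) - h0) * Y := by linarith
    rcases hY0.eq_or_lt with h | h
    · rw [← h, mul_zero] at e3; exact absurd e3 (lt_irrefl 0)
    · exact h
  refine ⟨?_, hYpos⟩
  obtain ⟨F, -, hF⟩ : ∃ F ∈ Finset.univ, 0 < y F := by
    by_contra hcon
    push Not at hcon
    exact hYpos.not_ge (Finset.sum_nonpos hcon)
  -- A packed forest has length k - h0, and its h1 - h0 edges outside `B1` have length 1 each.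
  have hh1k : h1 ≤ k := by
    have e1 := (hmax F hF).card_inter_add_comps (hmin F hF) hlt1
    have e2 := IsForest.card_add_comps (isMaximalForest_iff.1 (hmax F hF)).1
    rw [(hmax F hF).comps_eq] at e2
    have e3 : ((F \ B1).card : ℝ) ≤ ∑ e ∈ F, x e := by
      calc ((F \ B1).card : ℝ) = ∑ e ∈ F \ B1, (1 : ℝ) := by simp
        _ ≤ ∑ e ∈ F \ B1, x e := Finset.sum_le_sum fun e he => by
          simpa [hB1] using (Finset.mem_sdiff.1 he).2
        _ ≤ ∑ e ∈ F, x e :=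
          Finset.sum_le_sum_of_subset_of_nonneg Finset.sdiff_subset fun e _ _ => hx0 e
    rw [hyx F hF] at e3
    have e5 := Finset.card_sdiff_add_card_inter F B1
    have e7 : (F \ B1).card + h0 ≤ k := by
      have : (((F \ B1).card + h0 : ℕ) : ℝ) ≤ k := by push_cast; linarith
      exact_mod_cast this
    omega
  rw [hval]
  -- If h1 = k, the components of `B1` already form a `k`-cut of capacity at most the LP value.
  rcases hh1k.eq_or_lt with hh1k | hh1k
  · have e0 := isKCut_of_label (G := G) c1 (k := k) (by
      rw [Finset.image_univ_of_surjective hsurj1, Finset.card_univ, hcard1, hh1k])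
    have e1 := hpos _ e0
    have e2 := hA.2 _ e0
    have e3 : G.capOf (Finset.univ.filter fun e => c1 (G.fst e) ≠ c1 (G.snd e)) ≤ G.capOf B1ᶜ := by
      refine hcap_mono _ _ fun e he => ?_
      simp only [Finset.mem_filter, Finset.mem_univ, true_and, Finset.mem_compl] at he ⊢
      exact fun h => he (hedge1 e h)
    rw [hcap1, hh1k] at e3
    linarith
  -- the degrees of the parts
  set deg : (G.span E0).ConnectedComponent → ℝ := fun p =>
    ∑ e ∈ B1 \ E0, G.cap e * ((if c0 (G.fst e) = p then 1 else 0) +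
      (if c0 (G.snd e) = p then 1 else 0)) with hdeg
  have hdeg0 : ∀ p, 0 ≤ deg p := fun p => Finset.sum_nonneg fun e _ =>
    mul_nonneg (G.cap_nonneg e) (by split_ifs <;> norm_num)
  have hdegS : ∀ S : Finset (G.span E0).ConnectedComponent, ∑ p ∈ S, deg p =
      ∑ e ∈ B1 \ E0, G.cap e * ((if c0 (G.fst e) ∈ S then 1 else 0) +
        (if c0 (G.snd e) ∈ S then 1 else 0)) := by
    intro S
    simp only [hdeg]
    rw [Finset.sum_comm]
    refine Finset.sum_congr rfl fun e _ => ?_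
    rw [← Finset.mul_sum, Finset.sum_add_distrib, Finset.sum_ite_eq, Finset.sum_ite_eq]
  have hdegU : ∑ p, deg p = 2 * G.capOf (B1 \ E0) := by
    rw [hdegS, capOf, Finset.mul_sum]
    exact Finset.sum_congr rfl fun e _ => by simp only [Finset.mem_univ, if_true]; ring
  -- In each component of `B1` a part of largest degree is never isolated. It keeps the label of the
  -- component in use, and its degree makes the final inequality strict.
  have hrep : ∀ c : (G.span B1).ConnectedComponent, ∃ v, c1 v = c ∧
      ∀ v', c1 v' = c → deg (c0 v') ≤ deg (c0 v) := by
    intro c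
    obtain ⟨v, hv, hmax⟩ := (Finset.univ.filter fun v => c1 v = c).exists_max_image
      (fun v => deg (c0 v)) (by
        obtain ⟨v, hv⟩ := hsurj1 c
        exact ⟨v, by simp [hv]⟩)
    exact ⟨v, by simpa using hv, fun v' hv' => hmax v' (by simp [hv'])⟩
  choose rep hrep1 hrep2 using hrep
  have hinj : Function.Injective fun c => c0 (rep c) := fun c c' hcc => by
    rw [← hrep1 c, ← hrep1 c']; exact h01 _ _ hcc
  set R : Finset (G.span E0).ConnectedComponent := Finset.univ.image fun c => c0 (rep c) with hR
  have hRcard : R.card = h1 := by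
    rw [hR, Finset.card_image_of_injective _ hinj, Finset.card_univ, hcard1]
  have hTcard : Rᶜ.card = q - h1 := by rw [Finset.card_compl, hcard0, hRcard]
  -- The k - h1 cheapest parts that are not representatives will be isolated.
  obtain ⟨S, hST, hSk, hS⟩ := exists_subset_sum_le deg Rᶜ (k - h1) (by omega)
  rw [hTcard, Nat.cast_sub (by omega), Nat.cast_sub (by omega)] at hS
  have hkh : (0 : ℝ) < (k : ℝ) - h1 := by rw [sub_pos]; exact_mod_cast hh1k
  have hqh : (0 : ℝ) < (q : ℝ) - h1 := by rw [sub_pos]; exact_mod_cast hh1k.trans_le hqk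
  have hE'pos : 0 < G.capOf (B1 \ E0) := by rw [hcap']; positivity
  -- If all representatives had degree 0, so would all parts, while the degrees add up to twice a
  -- positive capacity.
  have hRpos : 0 < ∑ p ∈ R, deg p := by
    by_contra hcon
    have hz0 := (Finset.sum_eq_zero_iff_of_nonneg fun p _ => hdeg0 p).1
      (le_antisymm (not_lt.1 hcon) (Finset.sum_nonneg fun p _ => hdeg0 p))
    have : ∑ p, deg p ≤ 0 := Finset.sum_nonpos fun p _ => by
      obtain ⟨v, rfl⟩ := hsurj0 p
      exact (hrep2 (c1 v) v rfl).trans (hz0 _ (Finset.mem_image_of_mem _ (Finset.mem_univ _))).le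
    linarith
  have hTsum : ∑ p ∈ Rᶜ, deg p < 2 * G.capOf (B1 \ E0) := by
    have := Finset.sum_add_sum_compl R deg
    linarith
  have hSsum : ∑ p ∈ S, deg p < 2 * ((k : ℝ) - h1) * Y := by
    have e1 : ((q : ℝ) - h1) * ∑ p ∈ S, deg p < ((q : ℝ) - h1) * (2 * ((k : ℝ) - h1) * Y) := by
      refine hS.trans_lt ((mul_lt_mul_of_pos_left hTsum hkh).trans_eq ?_)
      rw [hcap']; ring
    exact lt_of_mul_lt_mul_left e1 hqh.le
  -- Isolated parts are labelled by themselves, all other nodes by their component of `B1`: (k - h1)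
  -- + h1 labels.
  let f : Fin n → (G.span E0).ConnectedComponent ⊕ (G.span B1).ConnectedComponent := fun v =>
    if c0 v ∈ S then .inl (c0 v) else .inr (c1 v)
  have hfcard : k ≤ (Finset.univ.image f).card := by
    have e1 : S.disjSum Finset.univ ⊆ Finset.univ.image f := by
      rintro (p | c) hp
      · obtain ⟨v, rfl⟩ := hsurj0 p
        rw [Finset.inl_mem_disjSum] at hp
        exact Finset.mem_image.2 ⟨v, Finset.mem_univ v, by simp [f, hp]⟩
      · refine Finset.mem_image.2 ⟨rep c, Finset.mem_univ _, ?_⟩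
        have : c0 (rep c) ∉ S := fun h => Finset.mem_compl.1 (hST h)
          (Finset.mem_image_of_mem (fun c => c0 (rep c)) (Finset.mem_univ c))
        simp [f, this, hrep1]
    have e2 := Finset.card_le_card e1
    rw [Finset.card_disjSum, hSk, Finset.card_univ, hcard1] at e2
    omega
  have e1 := hA.2 _ (isKCut_of_label (G := G) f hfcard)
  have e2 : G.capOf (Finset.univ.filter fun e => f (G.fst e) ≠ f (G.snd e)) ≤
      G.capOf B1ᶜ + ∑ p ∈ S, deg p := by
    have hsplit : ∀ e, f (G.fst e) ≠ f (G.snd e) → e ∉ B1 ∨ e ∈ B1 \ E0 ∧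
        (c0 (G.fst e) ∈ S ∨ c0 (G.snd e) ∈ S) := by
      intro e he
      by_cases heB : e ∈ B1
      · right
        refine ⟨Finset.mem_sdiff.2 ⟨heB, fun he0 => he ?_⟩, ?_⟩
        · simp only [f, hedge0 e he0, hedge1 e heB]
        · by_contra hcon
          push Not at hcon
          exact he (by simp only [f, hcon.1, hcon.2, if_false, hedge1 e heB])
      · exact .inl heB
    calc G.capOf (Finset.univ.filter fun e => f (G.fst e) ≠ f (G.snd e))
        ≤ G.capOf (B1ᶜ ∪ (B1 \ E0).filter fun e => c0 (G.fst e) ∈ S ∨ c0 (G.snd e) ∈ S) := by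
          refine hcap_mono _ _ fun e he => ?_
          simpa only [Finset.mem_union, Finset.mem_compl, Finset.mem_filter] using
            hsplit e (Finset.mem_filter.1 he).2
      _ ≤ G.capOf B1ᶜ + G.capOf ((B1 \ E0).filter fun e => c0 (G.fst e) ∈ S ∨ c0 (G.snd e) ∈ S) := by
          rw [capOf, capOf, capOf, ← Finset.sum_union_inter]
          exact le_add_of_nonneg_right (hcap_nonneg _)
      _ ≤ G.capOf B1ᶜ + ∑ p ∈ S, deg p := by
          refine add_le_add_right ?_ _
          rw [hdegS, capOf, Finset.sum_filter]
          refine Finset.sum_le_sum fun e _ => ?_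
          have := G.cap_nonneg e
          by_cases ha : c0 (G.fst e) ∈ S <;> by_cases hb : c0 (G.snd e) ∈ S <;>
            simp only [ha, hb, or_true, true_or, or_self, if_true, if_false] <;> linarith
  -- The bound (h1 - h0) Y - Z + 2 (k - h1) Y falls short of twice the LP value by exactly c(`B1ᶜ`).
  have e3 := hcap_nonneg B1ᶜ
  rw [hcap1] at e2 e3
  linarith

/-- Averaging: otherwise 2 (k - h) ∑ y would be at most the total load of `A`, which is at most c(A)
+ ∑ z and hence less than 2 (k - h) ∑ y - ∑ z. -/
theorem DualOptimal.exists_card_inter_lt (h : G.DualOptimal k y z) (hpos : ∀ A, G.IsKCut k A → 0 < G.capOf A) {A : Finset (Fin m)} (hA : G.IsMinKCut k A) :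
    ∃ F, 0 < y F ∧ (A ∩ F).card + 2 * G.numComponents < 2 * k := by
  classical
  obtain ⟨hlt, hY⟩ := h.capOf_lt hpos hA
  obtain ⟨⟨hy, hys, hz, hp⟩, -⟩ := h
  have hval : G.dualValue k y z = ((k : ℝ) - G.numComponents) * ∑ F, y F - ∑ e, z e := rfl
  by_contra hcon
  push Not at hcon
  have h1 := sum_mul_sum_mem y (fun e => if e ∈ A then (1 : ℝ) else 0)
  simp only [ite_mul, one_mul, zero_mul, Finset.sum_ite_mem, Finset.univ_inter,
    Finset.sum_const, nsmul_eq_mul, mul_one] at h1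
  have h2 : ∑ e ∈ A, ∑ F : Finset (Fin m) with e ∈ F, y F ≤ G.capOf A + ∑ e, z e := by
    calc _ ≤ ∑ e ∈ A, (G.cap e + z e) := Finset.sum_le_sum fun e _ => hp e
      _ ≤ _ := by
        rw [Finset.sum_add_distrib, capOf]
        exact add_le_add_right
          (Finset.sum_le_sum_of_subset_of_nonneg (Finset.subset_univ A) fun e _ _ => hz e) _
  have h3 : ∑ F, y F * (2 * ((k : ℝ) - G.numComponents)) ≤ ∑ F, y F * ((F ∩ A).card : ℝ) := by
    refine Finset.sum_le_sum fun F _ => ?_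
    rcases (hy F).eq_or_lt with hF | hF
    · rw [← hF, zero_mul, zero_mul]
    · refine mul_le_mul_of_nonneg_left ?_ hF.le
      have := hcon F hF
      rw [Finset.inter_comm] at this
      have : (2 * k : ℝ) ≤ ((F ∩ A).card : ℝ) + 2 * G.numComponents := by exact_mod_cast this
      linarith
  rw [← Finset.sum_mul] at h3
  have hZ0 : 0 ≤ ∑ e, z e := Finset.sum_nonneg fun e _ => hz e
  linarith

end
end CapGraph
end KCut

namespace KCut
namespace CapGraph

/-! ### Growing a rooted tree -/

section
variable {n m : ℕ} {G : CapGraph n m} {F : Finset (Fin m)} {r : Fin n}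

/-- `Grow G F r V D`: the set `V` of nodes is reached from the root `r` by attaching nodes one by
one, by an edge of `F` whenever an edge of `F` leaves the current set, and `D` is the relation
between ancestors and descendants. -/
inductive Grow (G : CapGraph n m) (F : Finset (Fin m)) (r : Fin n) :
    Finset (Fin n) → (Fin n → Fin n → Prop) → Prop
  | root : Grow G F r {r} fun a b => a = r ∧ b = r
  | step {V : Finset (Fin n)} {D : Fin n → Fin n → Prop} (h : Grow G F r V D) {u w : Fin n}
      (hu : u ∈ V) (hw : w ∉ V)
      (huw : (∃ e ∈ F, G.fst e = u ∧ G.snd e = w ∨ G.fst e = w ∧ G.snd e = u) ∨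
        ∀ e ∈ F, G.fst e ∈ V ↔ G.snd e ∈ V) :
      Grow G F r (insert w V) fun a b => D a b ∨ b = w ∧ (a = w ∨ D a u)

variable {V : Finset (Fin n)} {D : Fin n → Fin n → Prop} {a b c : Fin n}

theorem Grow.root_mem (h : Grow G F r V D) : r ∈ V := by
  induction h with
  | root => simp
  | step _ _ _ _ ih => exact Finset.mem_insert_of_mem ih

theorem Grow.mem (h : Grow G F r V D) (hab : D a b) : a ∈ V ∧ b ∈ V := by
  induction h generalizing a b with
  | root => simp [hab.1, hab.2]
  | step _ hu hw _ ih =>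
    rcases hab with hab | ⟨rfl, rfl | hau⟩
    · exact ⟨Finset.mem_insert_of_mem (ih hab).1, Finset.mem_insert_of_mem (ih hab).2⟩
    · simp
    · exact ⟨Finset.mem_insert_of_mem (ih hau).1, Finset.mem_insert_self _ _⟩

theorem Grow.refl (h : Grow G F r V D) (ha : a ∈ V) : D a a := by
  induction h with
  | root => simp_all
  | step _ hu hw _ ih =>
    rcases Finset.mem_insert.1 ha with rfl | ha
    · exact .inr ⟨rfl, .inl rfl⟩
    · exact .inl (ih ha)

theorem Grow.root_le (h : Grow G F r V D) (ha : a ∈ V) : D r a := by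
  induction h generalizing a with
  | root => simp_all
  | step h hu hw _ ih =>
    rcases Finset.mem_insert.1 ha with rfl | ha
    · exact .inr ⟨rfl, .inr (ih hu)⟩
    · exact .inl (ih ha)

theorem Grow.trans (h : Grow G F r V D) (hab : D a b) (hbc : D b c) : D a c := by
  induction h generalizing a b c with
  | root => exact ⟨hab.1, hbc.2⟩
  | step h hu hw _ ih =>
    rcases hbc with hbc | ⟨rfl, rfl | hbu⟩
    · rcases hab with hab | ⟨rfl, -⟩
      · exact .inl (ih hab hbc)
      · exact absurd (h.mem hbc).1 hw
    · exact hab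
    · rcases hab with hab | ⟨rfl, -⟩
      · exact .inr ⟨rfl, .inr (ih hab hbu)⟩
      · exact absurd (h.mem hbu).1 hw

theorem Grow.antisymm (h : Grow G F r V D) (hab : D a b) (hba : D b a) : a = b := by
  induction h generalizing a b with
  | root => exact hab.1.trans hab.2.symm
  | step h hu hw _ ih =>
    rcases hab with hab | ⟨rfl, rfl | hau⟩
    · rcases hba with hba | ⟨rfl, -⟩
      · exact ih hab hba
      · exact absurd (h.mem hab).1 hw
    · rfl
    · rcases hba with hba | ⟨rfl, -⟩
      · exact absurd (h.mem hba).1 hw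
      · exact absurd (h.mem hau).1 hw

/-- The ancestors of a node form a chain. Beyond a partial order with a least element, this is all
that the evaluation of codes needs from the tree. -/
theorem Grow.total (h : Grow G F r V D) (hac : D a c) (hbc : D b c) : D a b ∨ D b a := by
  induction h generalizing a b c with
  | root => exact .inl ⟨hac.1, hbc.1⟩
  | step h hu hw _ ih =>
    rcases hac with hac | ⟨rfl, rfl | hau⟩
    · rcases hbc with hbc | ⟨rfl, -⟩
      · exact (ih hac hbc).imp .inl .inl
      · exact absurd (h.mem hac).2 hw
    · exact .inr hbc
    · rcases hbc with hbc | ⟨-, rfl | hbu⟩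
      · exact absurd (h.mem hbc).2 hw
      · exact .inl (.inr ⟨rfl, .inr hau⟩)
      · exact (ih hau hbu).imp .inl .inl

open Classical in
/-- A labelling of the nodes is determined by the changes along the edges of the tree, and there
are few of them. -/
theorem Grow.exists_changes (h : Grow G F r V D) : ∃ R : Finset (Fin n), R ⊆ V ∧
    (∀ a ∈ R, ∀ b ∈ R, (G.span F).Reachable a b → a = b) ∧
    ∀ {q : ℕ} (f : Fin n → ZMod q), f r = 0 → ∃ δ : Fin n → ZMod q, δ r = 0 ∧
      (∀ u ∈ V, f u = ∑ v with D v u, δ v) ∧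
      (Finset.univ.filter fun v => δ v ≠ 0).card + 1 ≤ (F.filter fun e =>
        G.fst e ∈ V ∧ G.snd e ∈ V ∧ f (G.fst e) ≠ f (G.snd e)).card + R.card := by
  induction h with
  | root =>
    refine ⟨{r}, subset_rfl, by simp, fun f hf => ⟨0, rfl, fun u hu => ?_, by simp⟩⟩
    rw [Finset.mem_singleton.1 hu, hf]; simp
  | @step V D h u w hu hw huw ih =>
    obtain ⟨R, hRV, hR, ih⟩ := ih
    -- The ancestors of the new node `w` are `w` and those of its parent `u`, so the increment at
    -- `w` must be `f w - f u`.
    have hsum : ∀ {q : ℕ} (f δ : Fin n → ZMod q), (∀ u ∈ V, f u = ∑ v with D v u, δ v) →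
        ∀ x ∈ insert w V, f x = ∑ v with D v x ∨ x = w ∧ (v = w ∨ D v u),
          Function.update δ w (f w - f u) v := by
      intro q f δ hδ x hx
      have hup : ∀ x, ∑ v with D v x, Function.update δ w (f w - f u) v = ∑ v with D v x, δ v := by
        intro x
        refine Finset.sum_congr rfl fun v hv => Function.update_of_ne ?_ _ _
        rintro rfl
        exact hw (h.mem (Finset.mem_filter.1 hv).2).1
      rcases Finset.mem_insert.1 hx with rfl | hx'
      · have hset : (Finset.univ.filter fun v => D v x ∨ x = x ∧ (v = x ∨ D v u)) =
            insert x (Finset.univ.filter fun v => D v u) := by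
          ext v
          simp only [Finset.mem_filter, Finset.mem_univ, true_and, Finset.mem_insert]
          exact ⟨fun hv => hv.elim (fun hv => absurd (h.mem hv).2 hw) id, .inr⟩
        rw [hset, Finset.sum_insert, Function.update_self, hup, ← hδ u hu]
        · ring
        · simp only [Finset.mem_filter, Finset.mem_univ, true_and]
          exact fun hv => hw (h.mem hv).1
      · have hxw : x ≠ w := by rintro rfl; exact hw hx'
        simp only [hxw, false_and, or_false]
        rw [hup, hδ x hx']
    have hmono : ∀ {q : ℕ} (f : Fin n → ZMod q),
        (F.filter fun e => G.fst e ∈ V ∧ G.snd e ∈ V ∧ f (G.fst e) ≠ f (G.snd e)) ⊆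
        F.filter fun e => G.fst e ∈ insert w V ∧ G.snd e ∈ insert w V ∧
          f (G.fst e) ≠ f (G.snd e) := fun f e he => by
      simp only [Finset.mem_filter, Finset.mem_insert] at he ⊢
      exact ⟨he.1, .inr he.2.1, .inr he.2.2.1, he.2.2.2⟩
    have hsupp : ∀ {q : ℕ} (f δ : Fin n → ZMod q),
        (Finset.univ.filter fun v => Function.update δ w (f w - f u) v ≠ 0) ⊆
          insert w (Finset.univ.filter fun v => δ v ≠ 0) := fun f δ v hv => by
      simp only [Finset.mem_filter, Finset.mem_univ, true_and, Finset.mem_insert] at hv ⊢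
      by_cases hvw : v = w
      · exact .inl hvw
      · rw [Function.update_of_ne hvw] at hv; exact .inr hv
    have hrw : r ≠ w := by rintro rfl; exact hw h.root_mem
    -- If a forest edge attaches `w`, a non-zero increment is paid for by this edge, whose ends have
    -- different labels. Otherwise `V` is closed under `F`, so `w` starts a new component and is
    -- added to `R` to pay.
    rcases huw with ⟨e, heF, he⟩ | hcl
    · refine ⟨R, hRV.trans (Finset.subset_insert w V), hR, fun f hf => ?_⟩
      obtain ⟨δ, hδr, hδ, hcard⟩ := ih f hf
      refine ⟨Function.update δ w (f w - f u), by rw [Function.update_of_ne hrw, hδr],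
        fun x hx => by convert hsum f δ hδ x hx, ?_⟩
      by_cases hfw : f w = f u
      · refine (Nat.succ_le_succ (Finset.card_le_card fun v hv => ?_)).trans
          (hcard.trans (Nat.add_le_add_right (Finset.card_le_card (hmono f)) _))
        simp only [Finset.mem_filter, Finset.mem_univ, true_and] at hv ⊢
        by_cases hvw : v = w
        · subst hvw; rw [Function.update_self, hfw, sub_self] at hv; exact absurd rfl hv
        · rwa [Function.update_of_ne hvw] at hv
      · have h1 := (Finset.card_le_card (hsupp f δ)).trans (Finset.card_insert_le _ _)
        have h2 : (F.filter fun e => G.fst e ∈ V ∧ G.snd e ∈ V ∧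
            f (G.fst e) ≠ f (G.snd e)).card + 1 ≤ (F.filter fun e => G.fst e ∈ insert w V ∧
              G.snd e ∈ insert w V ∧ f (G.fst e) ≠ f (G.snd e)).card := by
          rw [Nat.succ_le_iff]
          refine Finset.card_lt_card ⟨hmono f, fun hcon => ?_⟩
          have he' : e ∈ F.filter fun e => G.fst e ∈ insert w V ∧
              G.snd e ∈ insert w V ∧ f (G.fst e) ≠ f (G.snd e) := by
            rcases he with ⟨rfl, rfl⟩ | ⟨rfl, rfl⟩
            · simp [heF, hu, Ne.symm hfw]
            · simp [heF, hu, hfw]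
          have := (Finset.mem_filter.1 (hcon he')).2
          rcases he with ⟨rfl, rfl⟩ | ⟨rfl, rfl⟩
          · exact hw this.2.1
          · exact hw this.1
        omega
    · have hclr : ∀ a b, (G.span F).Reachable a b → (a ∈ V ↔ b ∈ V) := fun a b =>
        reachable_induction (r := fun a b => a ∈ V ↔ b ∈ V)
          ⟨fun _ => Iff.rfl, Iff.symm, Iff.trans⟩ hcl
      have hwR : w ∉ R := fun hwR => hw (hRV hwR)
      refine ⟨insert w R, Finset.insert_subset_insert w hRV, ?_, fun f hf => ?_⟩
      · intro a ha b hb hab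
        rcases Finset.mem_insert.1 ha with ha' | ha' <;> rcases Finset.mem_insert.1 hb with hb' | hb'
        · exact ha'.trans hb'.symm
        · exact absurd ((hclr _ _ hab).2 (hRV hb')) (ha' ▸ hw)
        · exact absurd ((hclr _ _ hab).1 (hRV ha')) (hb' ▸ hw)
        · exact hR a ha' b hb' hab
      · obtain ⟨δ, hδr, hδ, hcard⟩ := ih f hf
        refine ⟨Function.update δ w (f w - f u), by rw [Function.update_of_ne hrw, hδr],
          fun x hx => by convert hsum f δ hδ x hx, ?_⟩
        have h1 := (Finset.card_le_card (hsupp f δ)).trans (Finset.card_insert_le _ _)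
        have h2 := Finset.card_le_card (hmono f)
        rw [Finset.card_insert_of_notMem hwR]
        omega

-- The set `R` of starting nodes has at most one node in each component of `F`, the root being one
-- of them; hence the `+ 1`.
open Classical in
theorem Grow.exists_few_changes (h : Grow G F r Finset.univ D) {q : ℕ} (f : Fin n → ZMod q)
    (hf : f r = 0) : ∃ δ : Fin n → ZMod q, δ r = 0 ∧ (∀ u, f u = ∑ v with D v u, δ v) ∧
      (Finset.univ.filter fun v => δ v ≠ 0).card + 1 ≤
        (F.filter fun e => f (G.fst e) ≠ f (G.snd e)).card + G.comps F := by
  obtain ⟨R, -, hR, h⟩ := h.exists_changes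
  obtain ⟨δ, hδr, hδ, hcard⟩ := h f hf
  refine ⟨δ, hδr, fun u => hδ u (Finset.mem_univ u), hcard.trans ?_⟩
  simp only [Finset.mem_univ, true_and]
  refine Nat.add_le_add_left ?_ _
  have := Fintype.ofFinite (G.span F).ConnectedComponent
  rw [comps, Nat.card_eq_fintype_card]
  exact Finset.card_le_card_of_injOn (G.span F).connectedComponentMk (by simp)
    fun a ha b hb hab => hR a ha b hb (SimpleGraph.ConnectedComponent.eq.1 hab)

end
end CapGraph

/-! ### Labels along a chain -/

/-- The relation need only be total and transitive on `S`, because ancestors are comparable only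
above a common node. -/
theorem exists_greatest {ι : Type*} {le : ι → ι → Prop} (S : Finset ι) (hS : S.Nonempty)
    (total : ∀ i ∈ S, ∀ j ∈ S, le i j ∨ le j i)
    (trans : ∀ i ∈ S, ∀ j ∈ S, ∀ l ∈ S, le i j → le j l → le i l) :
    ∃ i ∈ S, ∀ j ∈ S, le j i := by
  classical
  induction hS using Finset.Nonempty.cons_induction with
  | singleton a => exact ⟨a, by simp, by simpa using total a (by simp) a (by simp)⟩
  | cons a S ha hS ih =>
    obtain ⟨i, hi, hmax⟩ := ih (fun i hi j hj => total i (by simp [hi]) j (by simp [hj]))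
      fun i hi j hj l hl => trans i (by simp [hi]) j (by simp [hj]) l (by simp [hl])
    have haa : le a a := (total a (by simp) a (by simp)).elim id id
    rcases total a (by simp) i (by simp [hi]) with hai | hia
    · refine ⟨i, by simp [hi], fun j hj => ?_⟩
      rcases Finset.mem_cons.1 hj with rfl | hj
      · exact hai
      · exact hmax j hj
    · refine ⟨a, by simp, fun j hj => ?_⟩
      rcases Finset.mem_cons.1 hj with rfl | hj'
      · exact haa
      · exact trans j hj i (by simp [hi]) a (by simp) (hmax j hj') hia

/-- Along a chain, the partial sum up to `i` without `d i` is the partial sum up to the predecessor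
of `i`. The induction removes the greatest element, which affects no other partial sum. -/
theorem sum_telescope {ι H A : Type*} [AddCommGroup H] [AddCommGroup A] {le : ι → ι → Prop}
    [DecidableRel le]
    (S : Finset ι) (total : ∀ i ∈ S, ∀ j ∈ S, le i j ∨ le j i)
    (trans : ∀ i ∈ S, ∀ j ∈ S, ∀ l ∈ S, le i j → le j l → le i l)
    (antisymm : ∀ i ∈ S, ∀ j ∈ S, le i j → le j i → i = j) (d : ι → H) (φ : H → A) :
    ∑ i ∈ S, (φ (∑ j ∈ S with le j i, d j) - φ (∑ j ∈ S with le j i, d j - d i)) =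
      φ (∑ i ∈ S, d i) - φ 0 := by
  classical
  induction hN : S.card generalizing S with
  | zero => simp [Finset.card_eq_zero.1 hN]
  | succ N ih =>
    obtain ⟨x, hx, hmax⟩ := exists_greatest S (Finset.card_pos.1 (by omega)) total trans
    have hsub : ∀ {i}, i ∈ S.erase x → i ∈ S := Finset.mem_of_mem_erase
    have ih := ih (S.erase x) (fun i hi j hj => total i (hsub hi) j (hsub hj))
      (fun i hi j hj l hl => trans i (hsub hi) j (hsub hj) l (hsub hl))
      (fun i hi j hj => antisymm i (hsub hi) j (hsub hj))
      (by rw [Finset.card_erase_of_mem hx, hN]; rfl)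
    have h1 : S.filter (fun j => le j x) = S := Finset.filter_true_of_mem hmax
    have h2 : ∀ i ∈ S.erase x, S.filter (fun j => le j i) = (S.erase x).filter fun j => le j i := by
      intro i hi
      ext j
      simp only [Finset.mem_filter, Finset.mem_erase]
      refine ⟨fun hj => ⟨⟨?_, hj.1⟩, hj.2⟩, fun hj => ⟨hj.1.2, hj.2⟩⟩
      rintro rfl
      exact (Finset.mem_erase.1 hi).1 (antisymm i (hsub hi) j hx (hmax i (hsub hi)) hj.2)
    have h3 : ∑ i ∈ S.erase x, (φ (∑ j ∈ S with le j i, d j) - φ (∑ j ∈ S with le j i, d j - d i)) =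
        φ (∑ i ∈ S.erase x, d i) - φ 0 :=
      (Finset.sum_congr rfl fun i hi => by rw [h2 i hi]).trans ih
    rw [← Finset.add_sum_erase S _ hx, h1, h3,
      ← Finset.add_sum_erase S d hx, add_sub_cancel_left]
    abel

end KCut

namespace KCut

/-! ### Codes of labellings -/

/-- The test for equality, as a number. -/
def eqN (a b : ℕ) : ℕ := 1 - ((a - b) + (b - a))

theorem eqN_eq (a b : ℕ) : eqN a b = if a = b then 1 else 0 := by
  unfold eqN; split_ifs <;> omega

/-- The label of the node `u`, if `d i` is added to the labels of all descendants of `v i`. -/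
def lab (r q : ℕ) (anc : ℕ → ℕ → ℕ) (v d : ℕ → ℕ) (u : ℕ) : ℕ :=
  (∑ i ∈ Finset.range r, d i * anc (v i) u) % q

/-- The sum of the increments down to the `i`-th node, where repetitions of a node are ordered. -/
def tot (r : ℕ) (anc : ℕ → ℕ → ℕ) (v d : ℕ → ℕ) (i : ℕ) : ℕ :=
  ∑ j ∈ Finset.range r, d j * (anc (v j) (v i) * (1 - eqN (v j) (v i) * (1 - (1 - (j - i)))))

/-- `top` and `bot` are the labels just below and just above the `i`-th node of the code. The index
`r` is a sentinel for the root: the label 0 below it, and above it the value `q`, which no node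
carries. -/
def top (r q : ℕ) (anc : ℕ → ℕ → ℕ) (v d : ℕ → ℕ) (i : ℕ) : ℕ :=
  if i < r then tot r anc v d i % q else 0

def bot (r q : ℕ) (anc : ℕ → ℕ → ℕ) (v d : ℕ → ℕ) (i : ℕ) : ℕ :=
  if i < r then (tot r anc v d i - d i) % q else q

def nod (r : ℕ) (v : ℕ → ℕ) (i : ℕ) : ℕ := if i < r then v i else 0

def lbl (r q : ℕ) (anc : ℕ → ℕ → ℕ) (v d : ℕ → ℕ) (i : ℕ) : ℕ :=
  if i < r then lab r q anc v d (v i) else 0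

/-- A table of the ancestors in a rooted tree on `0, …, n - 1` with root `0`. -/
structure IsAncTable (n : ℕ) (anc : ℕ → ℕ → ℕ) : Prop where
  zero_or_one : ∀ a < n, ∀ u < n, anc a u = 0 ∨ anc a u = 1
  refl : ∀ a < n, anc a a = 1
  root : ∀ u < n, anc 0 u = 1
  trans : ∀ a < n, ∀ b < n, ∀ c < n, anc a b = 1 → anc b c = 1 → anc a c = 1
  antisymm : ∀ a < n, ∀ b < n, anc a b = 1 → anc b a = 1 → a = b
  total : ∀ a < n, ∀ b < n, ∀ c < n, anc a c = 1 → anc b c = 1 → anc a b = 1 ∨ anc b a = 1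

section
variable {n r q : ℕ} {anc : ℕ → ℕ → ℕ} {v d : ℕ → ℕ}

theorem tot_eq (h : IsAncTable n anc) (hv : ∀ i < r, v i < n) {i : ℕ} (hi : i < r) :
    tot r anc v d i = ∑ j ∈ Finset.range r with anc (v j) (v i) = 1 ∧ ¬ (v j = v i ∧ i < j), d j := by
  rw [tot, Finset.sum_filter]
  refine Finset.sum_congr rfl fun j hj => ?_
  rw [eqN_eq]
  have hj := Finset.mem_range.1 hj
  rcases h.zero_or_one _ (hv j hj) _ (hv i hi) with h0 | h0
  · simp [h0]
  · by_cases h1 : v j = v i <;> by_cases h2 : i < j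
    · have : 1 - (1 - (j - i)) = 1 := by omega
      simp [h1, h2, this]
    · have : 1 - (1 - (j - i)) = 0 := by omega
      simp [h0, h2, this]
    · simp [h0, h1]
    · simp [h0, h1]

/-- The code nodes above `u` form a chain on which the increments add up to the label of `u`, so the
differences of `φ` telescope. The sentinel contributes `φ 0 - φ q`, which replaces `φ 0` by `φ q`.
The point is that the dependence on `u` becomes linear in the ancestor table. -/
theorem sum_anc_mul (h : IsAncTable n anc) (hv : ∀ i < r, v i < n) (hq : 0 < q) {u : ℕ} (hu : u < n)
    (φ : ℕ → ℝ) :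
    ∑ i ∈ Finset.range (r + 1), (anc (nod r v i) u : ℝ) *
      (φ (top r q anc v d i) - φ (bot r q anc v d i)) = φ (lab r q anc v d u) - φ q := by
  classical
  have : NeZero q := ⟨hq.ne'⟩
  rw [Finset.sum_range_succ]
  have hlast : (anc (nod r v r) u : ℝ) * (φ (top r q anc v d r) - φ (bot r q anc v d r)) =
      φ 0 - φ q := by
    simp [nod, top, bot, h.root u hu]
  set S := (Finset.range r).filter fun i => anc (v i) u = 1 with hS
  have hSr : ∀ {i}, i ∈ S → i < r ∧ anc (v i) u = 1 := fun hi => by simpa [hS] using hi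
  -- Equal nodes are ordered by their index; this makes the relation antisymmetric on indices and
  -- agrees with `tot`.
  let le : ℕ → ℕ → Prop := fun j i => anc (v j) (v i) = 1 ∧ ¬ (v j = v i ∧ i < j)
  have : DecidableRel le := fun j i => inferInstanceAs (Decidable (_ ∧ _))
  have htel := sum_telescope (le := le) S
    (fun i hi j hj => by
      have hi := hSr hi
      have hj := hSr hj
      by_cases hij : v i = v j
      · have := h.refl _ (hv j hj.1)
        simp only [le, hij, this, true_and]; omega
      · rcases h.total _ (hv i hi.1) _ (hv j hj.1) _ hu hi.2 hj.2 with h1 | h1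
        · exact .inl ⟨h1, fun h => hij h.1⟩
        · exact .inr ⟨h1, fun h => hij h.1.symm⟩)
    (fun i hi j hj l hl hij hjl => by
      have hi := hv i (hSr hi).1
      have hj := hv j (hSr hj).1
      have hl := hv l (hSr hl).1
      refine ⟨h.trans _ hi _ hj _ hl hij.1 hjl.1, fun hil => ?_⟩
      have h1 : v i = v j := h.antisymm _ hi _ hj hij.1 (hil.1 ▸ hjl.1)
      have h2 := hij.2
      have h3 := hjl.2
      rw [← hil.1] at h3
      simp only [h1, true_and] at h2 h3
      omega)
    (fun i hi j hj hij hji => by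
      have h1 : v i = v j := h.antisymm _ (hv i (hSr hi).1) _ (hv j (hSr hj).1) hij.1 hji.1
      have h2 := hij.2
      have h3 := hji.2
      simp only [h1, true_and] at h2 h3
      omega)
    (fun i => (d i : ZMod q)) (fun x => φ x.val)
  have hsum : ∑ i ∈ Finset.range r, (anc (v i) u : ℝ) *
      (φ (tot r anc v d i % q) - φ ((tot r anc v d i - d i) % q)) =
      φ (lab r q anc v d u) - φ 0 := by
    calc _ = ∑ i ∈ S, (φ (tot r anc v d i % q) - φ ((tot r anc v d i - d i) % q)) := by
          rw [hS, Finset.sum_filter]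
          refine Finset.sum_congr rfl fun i hi => ?_
          rcases h.zero_or_one _ (hv i (Finset.mem_range.1 hi)) _ hu with h0 | h0 <;> simp [h0]
      _ = _ := by
          have hlab : ((∑ i ∈ S, (d i : ZMod q)).val) = lab r q anc v d u := by
            rw [← Nat.cast_sum, ZMod.val_natCast, lab]
            congr 1
            rw [hS, Finset.sum_filter]
            refine Finset.sum_congr rfl fun i hi => ?_
            rcases h.zero_or_one _ (hv i (Finset.mem_range.1 hi)) _ hu with h0 | h0 <;> simp [h0]
          rw [hlab, ZMod.val_zero] at htel
          rw [← htel]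
          refine Finset.sum_congr rfl fun i hi => ?_
          have hi' := hSr hi
          have hfil : S.filter (fun j => le j i) = (Finset.range r).filter fun j => le j i := by
            ext j
            simp only [hS, Finset.mem_filter, and_assoc]
            refine ⟨fun hj => ⟨hj.1, hj.2.2⟩, fun hj => ⟨hj.1, ?_, hj.2⟩⟩
            exact h.trans _ (hv j (Finset.mem_range.1 hj.1)) _ (hv i hi'.1) _ hu hj.2.1 hi'.2
          have hcast : ∑ j ∈ S with le j i, (d j : ZMod q) = (tot r anc v d i : ZMod q) := by
            rw [hfil, tot_eq h hv hi'.1, Nat.cast_sum]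
            exact Finset.sum_congr (by ext; simp [le]) fun _ _ => rfl
          have hle : d i ≤ tot r anc v d i := by
            rw [tot_eq h hv hi'.1]
            exact Finset.single_le_sum (f := d) (fun _ _ => Nat.zero_le _)
              (by simp [hi'.1, h.refl _ (hv i hi'.1)])
          rw [hcast, ← Nat.cast_sub hle, ZMod.val_natCast, ZMod.val_natCast]
  have hrest : ∀ i ∈ Finset.range r, (anc (nod r v i) u : ℝ) *
      (φ (top r q anc v d i) - φ (bot r q anc v d i)) = (anc (v i) u : ℝ) *
      (φ (tot r anc v d i % q) - φ ((tot r anc v d i - d i) % q)) := fun i hi => by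
    simp [nod, top, bot, Finset.mem_range.1 hi]
  rw [Finset.sum_congr rfl hrest, hsum, hlast]
  ring

theorem lab_lt (hq : 0 < q) (u : ℕ) : lab r q anc v d u < q := Nat.mod_lt _ hq

/-- The weight inside the parts is a sum over pairs of nodes. -/
theorem sum_weight_eq {ι : Type*} (E : Finset ι) (c : ι → ℝ) (a b : ι → ℕ)
    (ha : ∀ e ∈ E, a e < n) (hb : ∀ e ∈ E, b e < n) (W : ℕ → ℕ → ℝ)
    (hW : ∀ x < n, ∀ y < n, W x y = ∑ e ∈ E, c e * (anc x (a e) * anc y (b e)))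
    (h : IsAncTable n anc) (hn : 0 < n) (hv : ∀ i < r, v i < n) (hq : 0 < q) :
    ∑ i ∈ Finset.range (r + 1), ∑ j ∈ Finset.range (r + 1), W (nod r v i) (nod r v j) *
      ((eqN (top r q anc v d i) (top r q anc v d j) : ℝ)
        - eqN (bot r q anc v d i) (top r q anc v d j)
        - eqN (top r q anc v d i) (bot r q anc v d j)
        + eqN (bot r q anc v d i) (bot r q anc v d j)) - W 0 0 =
    ∑ e ∈ E, if lab r q anc v d (a e) = lab r q anc v d (b e) then c e else 0 := by
  have hnod : ∀ i, nod r v i < n := fun i => by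
    unfold nod; split_ifs with hi
    · exact hv i hi
    · exact hn
  have h1 : ∀ e ∈ E, ∀ x : ℕ, ∑ j ∈ Finset.range (r + 1), (anc (nod r v j) (b e) : ℝ) *
      ((eqN x (top r q anc v d j) : ℝ) - eqN x (bot r q anc v d j)) =
      eqN x (lab r q anc v d (b e)) - eqN x q := fun e he x =>
    sum_anc_mul h hv hq (hb e he) fun y => (eqN x y : ℝ)
  -- The identity of `sum_anc_mul` is used for both ends of the edge. Of the four terms, those
  -- comparing a label with `q` vanish, and comparing `q` with itself leaves the `+ 1`.
  have h2 : ∀ e ∈ E, ∑ i ∈ Finset.range (r + 1), (anc (nod r v i) (a e) : ℝ) *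
      (((eqN (top r q anc v d i) (lab r q anc v d (b e)) : ℝ) - eqN (top r q anc v d i) q) -
        (eqN (bot r q anc v d i) (lab r q anc v d (b e)) - eqN (bot r q anc v d i) q)) =
      (if lab r q anc v d (a e) = lab r q anc v d (b e) then 1 else 0) + 1 := fun e he => by
    rw [sum_anc_mul h hv hq (ha e he)
      fun y => (eqN y (lab r q anc v d (b e)) : ℝ) - eqN y q]
    have l1 : lab r q anc v d (a e) ≠ q := (lab_lt hq _).ne
    have l2 : q ≠ lab r q anc v d (b e) := (lab_lt hq _).ne'
    simp only [eqN_eq, l1, l2, if_true, if_false]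
    split_ifs <;> norm_num
  -- The root is above every node, so this entry is the total capacity; subtracting it removes the
  -- `+ 1`.
  have h3 : W 0 0 = ∑ e ∈ E, c e := by
    rw [hW 0 hn 0 hn]
    refine Finset.sum_congr rfl fun e he => ?_
    rw [h.root _ (ha e he), h.root _ (hb e he)]; simp
  have h4 : ∑ i ∈ Finset.range (r + 1), ∑ j ∈ Finset.range (r + 1), W (nod r v i) (nod r v j) *
      ((eqN (top r q anc v d i) (top r q anc v d j) : ℝ)
        - eqN (bot r q anc v d i) (top r q anc v d j)
        - eqN (top r q anc v d i) (bot r q anc v d j)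
        + eqN (bot r q anc v d i) (bot r q anc v d j)) =
      ∑ e ∈ E, c e * ((if lab r q anc v d (a e) = lab r q anc v d (b e) then 1 else 0) + 1) := by
    have h5 : ∀ i, ∑ j ∈ Finset.range (r + 1), W (nod r v i) (nod r v j) *
      ((eqN (top r q anc v d i) (top r q anc v d j) : ℝ)
        - eqN (bot r q anc v d i) (top r q anc v d j)
        - eqN (top r q anc v d i) (bot r q anc v d j)
        + eqN (bot r q anc v d i) (bot r q anc v d j)) =
        ∑ e ∈ E, c e * ((anc (nod r v i) (a e) : ℝ) *
      (((eqN (top r q anc v d i) (lab r q anc v d (b e)) : ℝ) - eqN (top r q anc v d i) q) -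
        (eqN (bot r q anc v d i) (lab r q anc v d (b e)) - eqN (bot r q anc v d i) q))) := by
      intro i
      have h6 : ∀ j, W (nod r v i) (nod r v j) *
        ((eqN (top r q anc v d i) (top r q anc v d j) : ℝ)
        - eqN (bot r q anc v d i) (top r q anc v d j)
        - eqN (top r q anc v d i) (bot r q anc v d j)
        + eqN (bot r q anc v d i) (bot r q anc v d j)) =
        ∑ e ∈ E, (c e * anc (nod r v i) (a e) * ((anc (nod r v j) (b e) : ℝ) *
          ((eqN (top r q anc v d i) (top r q anc v d j) : ℝ) -
            eqN (top r q anc v d i) (bot r q anc v d j))) -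
          c e * anc (nod r v i) (a e) * ((anc (nod r v j) (b e) : ℝ) *
          ((eqN (bot r q anc v d i) (top r q anc v d j) : ℝ) -
            eqN (bot r q anc v d i) (bot r q anc v d j)))) := by
        intro j
        rw [hW _ (hnod i) _ (hnod j), Finset.sum_mul]
        exact Finset.sum_congr rfl fun e _ => by ring
      simp_rw [h6]
      rw [Finset.sum_comm]
      refine Finset.sum_congr rfl fun e he => ?_
      rw [Finset.sum_sub_distrib, ← Finset.mul_sum, ← Finset.mul_sum, h1 e he, h1 e he]
      ring
    simp_rw [h5]
    rw [Finset.sum_comm]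
    refine Finset.sum_congr rfl fun e he => ?_
    rw [← Finset.mul_sum, h2 e he]
  rw [h4, h3, ← Finset.sum_sub_distrib]
  refine Finset.sum_congr rfl fun e _ => ?_
  split_ifs <;> ring

/-- A node has the label of the lowest code node above it, or label 0 if there is none. The root
shows label 0 because it is not a code node. -/
theorem image_lbl (h : IsAncTable n anc) (hn : 0 < n) (hv : ∀ i < r, v i < n)
    (hv0 : ∀ i < r, v i ≠ 0) :
    (Finset.range (r + 1)).image (lbl r q anc v d) = (Finset.range n).image (lab r q anc v d) := by
  have h0 : lab r q anc v d 0 = 0 := by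
    have : ∑ i ∈ Finset.range r, d i * anc (v i) 0 = 0 := Finset.sum_eq_zero fun i hi => by
      have hi := Finset.mem_range.1 hi
      rcases h.zero_or_one _ (hv i hi) 0 hn with h1 | h1
      · rw [h1, mul_zero]
      · exact absurd (h.antisymm _ (hv i hi) 0 hn h1 (h.root _ (hv i hi))) (hv0 i hi)
    rw [lab, this, Nat.zero_mod]
  ext l
  simp only [Finset.mem_image, Finset.mem_range]
  constructor
  · rintro ⟨i, -, rfl⟩
    unfold lbl
    split_ifs with hi
    · exact ⟨v i, hv i hi, rfl⟩
    · exact ⟨0, hn, h0⟩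
  · rintro ⟨u, hu, rfl⟩
    rcases ((Finset.range r).filter fun i => anc (v i) u = 1).eq_empty_or_nonempty with hS | hS
    · refine ⟨r, by omega, ?_⟩
      have : ∑ i ∈ Finset.range r, d i * anc (v i) u = 0 := Finset.sum_eq_zero fun i hi => by
        have hi' := Finset.mem_range.1 hi
        rcases h.zero_or_one _ (hv i hi') u hu with h1 | h1
        · rw [h1, mul_zero]
        · have : i ∈ (Finset.range r).filter fun i => anc (v i) u = 1 := by simp [hi', h1]
          rw [hS] at this; simp at this
      simp [lbl, lab, this]
    · have hSr : ∀ {i}, i ∈ (Finset.range r).filter (fun i => anc (v i) u = 1) →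
          i < r ∧ anc (v i) u = 1 := fun hi => by simpa using hi
      obtain ⟨i, hi, hmax⟩ := exists_greatest (le := fun j i => anc (v j) (v i) = 1) _ hS
        (fun i hi j hj => h.total _ (hv i (hSr hi).1) _ (hv j (hSr hj).1) _ hu (hSr hi).2 (hSr hj).2)
        (fun i hi j hj l hl => h.trans _ (hv i (hSr hi).1) _ (hv j (hSr hj).1) _ (hv l (hSr hl).1))
      have hi := hSr hi
      refine ⟨i, by omega, ?_⟩
      rw [lbl, if_pos hi.1, lab, lab]
      congr 1
      refine Finset.sum_congr rfl fun j hj => ?_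
      have hj' := Finset.mem_range.1 hj
      congr 1
      rcases h.zero_or_one _ (hv j hj') _ hu with h1 | h1
      · rcases h.zero_or_one _ (hv j hj') _ (hv i hi.1) with h2 | h2
        · rw [h1, h2]
        · rw [h.trans _ (hv j hj') _ (hv i hi.1) _ hu h2 hi.2] at h1; omega
      · rw [h1, hmax j (by simp [hj', h1])]

/-- With truncated subtraction, `1 - (1 - a)` is 1 for positive `a` and 0 otherwise, so each label
in use is counted once. -/
theorem card_image_eq_sum (s : Finset ℕ) (f : ℕ → ℕ) (hf : ∀ i ∈ s, f i < q) :
    (s.image f).card = ∑ l ∈ Finset.range q, (1 - (1 - ∑ i ∈ s, eqN (f i) l)) := by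
  have h1 : ∀ l, 1 - (1 - ∑ i ∈ s, eqN (f i) l) = if l ∈ s.image f then 1 else 0 := by
    intro l
    simp only [eqN_eq, Finset.sum_boole, Nat.cast_id]
    split_ifs with h
    · obtain ⟨i, hi, hl⟩ := Finset.mem_image.1 h
      have : 0 < (s.filter fun i => f i = l).card := Finset.card_pos.2 ⟨i, by simp [hi, hl]⟩
      omega
    · have : s.filter (fun i => f i = l) = ∅ := Finset.filter_eq_empty_iff.2 fun i hi hl =>
        h (Finset.mem_image.2 ⟨i, hi, hl⟩)
      rw [this]; simp
  simp_rw [h1]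
  rw [Finset.sum_boole, Nat.cast_id]
  congr 1
  ext l
  simp only [Finset.mem_filter, Finset.mem_range]
  refine ⟨fun h => ⟨?_, h⟩, fun h => h.2⟩
  obtain ⟨i, hi, rfl⟩ := Finset.mem_image.1 h
  exact hf i hi

end

/-! ### Digits -/

def dig (b x i : ℕ) : ℕ := x / b ^ i % b

/-- The `i`-th node of the code `x` in base `b`. -/
def vOf (n b x i : ℕ) : ℕ := 1 + dig b x i % (n - 1)

/-- The `i`-th increment of the code `x` in base `b`. -/
def dOf (n b x i : ℕ) : ℕ := dig b x i / (n - 1)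

theorem exists_digits (b r : ℕ) (y : ℕ → ℕ) (hy : ∀ i < r, y i < b) :
    ∃ x < b ^ r, ∀ i < r, dig b x i = y i := by
  induction r generalizing y with
  | zero => exact ⟨0, by simp, by simp⟩
  | succ r ih =>
    obtain ⟨x, hx, hd⟩ := ih (fun i => y (i + 1)) fun i hi => hy (i + 1) (by omega)
    have h0 := hy 0 (by omega)
    refine ⟨y 0 + b * x, ?_, fun i hi => ?_⟩
    · rw [pow_succ]; nlinarith
    · cases i with
      | zero => simp [dig, Nat.add_mul_mod_self_left, Nat.mod_eq_of_lt h0]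
      | succ i =>
        rw [← hd i (by omega), dig, dig, pow_succ', ← Nat.div_div_eq_div_mul,
          Nat.add_mul_div_left _ _ (by omega), Nat.div_eq_of_lt h0, zero_add]

/-- Increments at few nodes have a code. -/
theorem exists_code (n q r : ℕ) (hn : 1 < n) (hq : 0 < q) (S : Finset ℕ) (hS : S.card ≤ r)
    (hSn : ∀ s ∈ S, s ≠ 0 ∧ s < n) (δ : ℕ → ℕ) (hδ : ∀ s ∈ S, δ s < q) :
    ∃ x < ((n - 1) * q) ^ r, ∀ g : ℕ → ℕ,
      ∑ i ∈ Finset.range r, dOf n ((n - 1) * q) x i * g (vOf n ((n - 1) * q) x i) =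
        ∑ s ∈ S, δ s * g s := by
  have h1 : ∃ v d : ℕ → ℕ, (∀ i < r, v i ≠ 0 ∧ v i < n ∧ d i < q) ∧
      ∀ g : ℕ → ℕ, ∑ i ∈ Finset.range r, d i * g (v i) = ∑ s ∈ S, δ s * g s := by
    induction S using Finset.induction_on generalizing r with
    -- Unused places are padded with the node 1 and the increment 0.
    | empty => exact ⟨fun _ => 1, fun _ => 0, fun i _ => ⟨by simp, hn, hq⟩, by simp⟩
    | insert a S ha ih =>
      rw [Finset.card_insert_of_notMem ha] at hS
      obtain ⟨r, rfl⟩ : ∃ r', r = r' + 1 := ⟨r - 1, by omega⟩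
      obtain ⟨v, d, hvd, hsum⟩ := ih r (by omega)
        (fun s hs => hSn s (Finset.mem_insert_of_mem hs))
        fun s hs => hδ s (Finset.mem_insert_of_mem hs)
      refine ⟨Function.update v r a, Function.update d r (δ a), fun i hi => ?_, fun g => ?_⟩
      · by_cases hir : i = r
        · subst hir
          simp only [Function.update_self]
          have := hSn a (Finset.mem_insert_self a S)
          exact ⟨this.1, this.2, hδ a (Finset.mem_insert_self a S)⟩
        · simp only [Function.update_of_ne hir]
          exact hvd i (by omega)
      · rw [Finset.sum_range_succ, Finset.sum_insert ha, ← hsum g, add_comm]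
        simp only [Function.update_self]
        congr 1
        refine Finset.sum_congr rfl fun i hi => ?_
        have : i ≠ r := (Finset.mem_range.1 hi).ne
        simp only [Function.update_of_ne this]
  obtain ⟨v, d, hvd, hsum⟩ := h1
  -- A digit combines a node other than the root, as one of n - 1 values, with an increment below
  -- `q`.
  obtain ⟨x, hx, hd⟩ := exists_digits ((n - 1) * q) r (fun i => (v i - 1) + (n - 1) * d i)
    fun i hi => by
      obtain ⟨h1, h2, h3⟩ := hvd i hi
      have : (n - 1) * (d i + 1) ≤ (n - 1) * q := Nat.mul_le_mul_left _ h3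
      rw [mul_add] at this
      omega
  refine ⟨x, hx, fun g => ?_⟩
  rw [← hsum g]
  refine Finset.sum_congr rfl fun i hi => ?_
  have hi := Finset.mem_range.1 hi
  obtain ⟨h1, h2, -⟩ := hvd i hi
  have h3 : v i - 1 < n - 1 := by omega
  have h4 : vOf n ((n - 1) * q) x i = v i := by
    rw [vOf, hd i hi, Nat.add_mul_mod_self_left, Nat.mod_eq_of_lt h3]; omega
  have h5 : dOf n ((n - 1) * q) x i = d i := by
    rw [dOf, hd i hi, Nat.add_mul_div_left _ _ (by omega), Nat.div_eq_of_lt h3, zero_add]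
  rw [h4, h5]

end KCut

namespace KCut
namespace CapGraph

/-! ### The minimum `k`-cuts have codes -/

section
variable {n m : ℕ} {G : CapGraph n m} {F : Finset (Fin m)} {anc : ℕ → ℕ → ℕ}

/-- The table `anc` of ancestors comes from growing a tree with root `0` along `F`. -/
def TreeTable (G : CapGraph n m) (F : Finset (Fin m)) (anc : ℕ → ℕ → ℕ) : Prop :=
  ∃ (h0 : 0 < n) (D : Fin n → Fin n → Prop), Grow G F ⟨0, h0⟩ Finset.univ D ∧
    ∀ a u : Fin n, (D a u → anc a u = 1) ∧ (¬ D a u → anc a u = 0)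

theorem TreeTable.isAncTable (h : G.TreeTable F anc) : IsAncTable n anc := by
  obtain ⟨h0, D, hD, ha⟩ := h
  have hiff : ∀ a (ha : a < n) b (hb : b < n), anc a b = 1 ↔ D ⟨a, ha⟩ ⟨b, hb⟩ := by
    intro a ha' b hb'
    have := ha ⟨a, ha'⟩ ⟨b, hb'⟩
    simp only at this
    refine ⟨fun h => ?_, this.1⟩
    by_contra hcon
    rw [this.2 hcon] at h
    omega
  refine ⟨fun a ha' u hu => ?_, fun a ha' => ?_, fun u hu => ?_, fun a ha' b hb c hc => ?_,
    fun a ha' b hb => ?_, fun a ha' b hb c hc => ?_⟩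
  · by_cases hd : D ⟨a, ha'⟩ ⟨u, hu⟩
    · exact .inr ((ha _ _).1 hd)
    · exact .inl ((ha _ _).2 hd)
  · exact (hiff _ ha' _ ha').2 (hD.refl (Finset.mem_univ _))
  · exact (hiff _ h0 _ hu).2 (hD.root_le (Finset.mem_univ _))
  · rw [hiff _ ha' _ hb, hiff _ hb _ hc, hiff _ ha' _ hc]; exact hD.trans
  · rw [hiff _ ha' _ hb, hiff _ hb _ ha']
    exact fun h h' => Fin.mk.inj_iff.1 (hD.antisymm h h')
  · rw [hiff _ ha' _ hc, hiff _ hb _ hc, hiff _ ha' _ hb, hiff _ hb _ ha']; exact hD.total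

-- A forest with `comps F` components and that many cut edges forces at most `r` non-zero
-- increments, one for each digit. The root has none, since its label is 0.
open Classical in
theorem TreeTable.exists_code (h : G.TreeTable F anc) (hn : 1 < n) {q r : ℕ} (hq : 0 < q)
    (f : Fin n → ZMod q) (hf : ∀ h0 : 0 < n, f ⟨0, h0⟩ = 0)
    (hcard : (F.filter fun e => f (G.fst e) ≠ f (G.snd e)).card + G.comps F ≤ r + 1) :
    ∃ x < ((n - 1) * q) ^ r, ∀ u : Fin n,
      lab r q anc (vOf n ((n - 1) * q) x) (dOf n ((n - 1) * q) x) u = (f u).val := by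
  obtain ⟨h0, D, hD, ha⟩ := h
  have : NeZero q := ⟨hq.ne'⟩
  obtain ⟨δ, hδ0, hδ, hδc⟩ := hD.exists_few_changes f (hf h0)
  let S := Finset.univ.filter fun v => δ v ≠ 0
  obtain ⟨x, hx, hsum⟩ := KCut.exists_code n q r hn hq (S.map Fin.valEmbedding)
    (by rw [Finset.card_map]; simp only [S]; omega)
    (fun s hs => by
      obtain ⟨v, hv, rfl⟩ := Finset.mem_map.1 hs
      refine ⟨fun hv0 => ?_, v.2⟩
      have : v = ⟨0, h0⟩ := Fin.ext hv0
      simp [S, this, hδ0] at hv)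
    (fun s => if h : s < n then (δ ⟨s, h⟩).val else 0)
    (fun s hs => by
      obtain ⟨v, hv, rfl⟩ := Finset.mem_map.1 hs
      simp [ZMod.val_lt])
  refine ⟨x, hx, fun u => ?_⟩
  rw [lab, hsum fun a => anc a u, Finset.sum_map, ← ZMod.val_natCast, hδ u]
  congr 1
  rw [Nat.cast_sum]
  simp only [Fin.valEmbedding_apply, Fin.is_lt, dif_pos, Fin.eta, Nat.cast_mul,
    ZMod.natCast_zmod_val, S]
  rw [Finset.sum_filter, Finset.sum_filter]
  refine Finset.sum_congr rfl fun v _ => ?_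
  by_cases hd : D v u
  · rw [(ha v u).1 hd]; simpa [hd] using fun h => h.symm
  · rw [(ha v u).2 hd]; simp [hd]

theorem card_image_congr {ι α β : Type*} [DecidableEq α] [DecidableEq β] (s : Finset ι)
    (f : ι → α) (g : ι → β) (h : ∀ u v, f u = f v ↔ g u = g v) :
    (s.image f).card = (s.image g).card := by
  have h1 : s.image f = (s.image fun u => (f u, g u)).image Prod.fst := by
    rw [Finset.image_image]; rfl
  have h2 : s.image g = (s.image fun u => (f u, g u)).image Prod.snd := by
    rw [Finset.image_image]; rfl
  have h3 : Set.InjOn Prod.fst ((s.image fun u => (f u, g u) : Finset (α × β)) : Set (α × β)) := by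
    intro x hx y hy hxy
    simp only [Finset.coe_image, Set.mem_image] at hx hy
    obtain ⟨u, -, rfl⟩ := hx
    obtain ⟨v, -, rfl⟩ := hy
    exact Prod.ext hxy ((h u v).1 hxy)
  have h4 : Set.InjOn Prod.snd ((s.image fun u => (f u, g u) : Finset (α × β)) : Set (α × β)) := by
    intro x hx y hy hxy
    simp only [Finset.coe_image, Set.mem_image] at hx hy
    obtain ⟨u, -, rfl⟩ := hx
    obtain ⟨v, -, rfl⟩ := hy
    exact Prod.ext ((h u v).2 hxy) hxy
  rw [h1, h2, Finset.card_image_of_injOn h3, Finset.card_image_of_injOn h4]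

theorem card_image_le_comps {α : Type*} [DecidableEq α] (g : Fin n → α)
    (hF : ∀ e ∈ F, g (G.fst e) = g (G.snd e)) : (Finset.univ.image g).card ≤ G.comps F := by
  classical
  have := Fintype.ofFinite (G.span F).ConnectedComponent
  have hg : ∀ u v, (G.span F).Reachable u v → g u = g v := fun u v =>
    reachable_induction (r := fun u v => g u = g v) ⟨fun _ => rfl, Eq.symm, Eq.trans⟩ hF
  let g' : (G.span F).ConnectedComponent → α := Quot.lift g hg
  rw [comps, Nat.card_eq_fintype_card]
  refine (Finset.card_le_card (t := Finset.univ.image g') fun x hx => ?_).trans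
    Finset.card_image_le
  obtain ⟨u, -, rfl⟩ := Finset.mem_image.1 hx
  exact Finset.mem_image.2 ⟨(G.span F).connectedComponentMk u, Finset.mem_univ _, rfl⟩

/-- Each cut edge of the forest adds one component to the uncut rest, so `g` takes at most `q`
values. These embed into `ZMod q`, and a translation gives the root the label 0. The code determines
the labels only up to renaming, which is all that a cut depends on. -/
theorem TreeTable.exists_code_of_label (h : G.TreeTable F anc) (hF : G.IsMaximalForest F)
    (hn : 1 < n) {q r : ℕ} (hqr : q = r + 1) {α : Type*} [DecidableEq α] (g : Fin n → α)
    (hcard : (F.filter fun e => g (G.fst e) ≠ g (G.snd e)).card + G.numComponents ≤ q) :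
    ∃ x < ((n - 1) * q) ^ r, ∀ u v : Fin n,
      lab r q anc (vOf n ((n - 1) * q) x) (dOf n ((n - 1) * q) x) u =
        lab r q anc (vOf n ((n - 1) * q) x) (dOf n ((n - 1) * q) x) v ↔ g u = g v := by
  classical
  have : NeZero q := ⟨by omega⟩
  have himg : (Finset.univ.image g).card ≤ q := by
    have h1 := card_image_le_comps (G := G) (F := F.filter fun e => g (G.fst e) = g (G.snd e)) g
      (by simp)
    have h2 := ((isMaximalForest_iff.1 hF).1.subset
      (Finset.filter_subset (fun e => g (G.fst e) = g (G.snd e)) F)).card_add_comps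
    have h3 := (isMaximalForest_iff.1 hF).1.card_add_comps
    have h4 := Finset.card_filter_add_card_filter_not (s := F)
      (fun e => g (G.fst e) = g (G.snd e))
    rw [hF.comps_eq] at h3
    simp only [ne_eq] at hcard
    omega
  obtain ⟨ι⟩ := Function.Embedding.nonempty_of_card_le
    (α := ↥(Finset.univ.image g)) (β := ZMod q) (by simpa [ZMod.card] using himg)
  have h0 : 0 < n := by omega
  let f0 : Fin n → ZMod q := fun u => ι ⟨g u, Finset.mem_image_of_mem g (Finset.mem_univ u)⟩
  have hf0 : ∀ u v, f0 u = f0 v ↔ g u = g v := fun u v => by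
    simp only [f0, ι.injective.eq_iff, Subtype.mk.injEq]
  let f : Fin n → ZMod q := fun u => f0 u - f0 ⟨0, h0⟩
  have hf : ∀ u v, f u = f v ↔ g u = g v := fun u v => by
    simp only [f, sub_left_inj, hf0]
  obtain ⟨x, hx, hlab⟩ := h.exists_code hn (q := q) (r := r) (by omega) f (by simp [f]) (by
    rw [hF.comps_eq]
    simp only [ne_eq, hf]
    simp only [ne_eq] at hcard
    convert hcard using 3
    exact hqr.symm)
  refine ⟨x, hx, fun u v => ?_⟩
  rw [hlab, hlab, (ZMod.val_injective q).eq_iff, hf]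

/-- The label of the node `u` in the labelling with code `X`, where `T` are the tables of
ancestors. -/
def codeLab (n q r : ℕ) (T : ℕ → ℕ → ℕ → ℕ) (X u : ℕ) : ℕ :=
  lab r q (T (X / ((n - 1) * q) ^ r)) (vOf n ((n - 1) * q) (X % ((n - 1) * q) ^ r))
    (dOf n ((n - 1) * q) (X % ((n - 1) * q) ^ r)) u

def cutOf (G : CapGraph n m) (l : ℕ → ℕ) : Finset (Fin m) :=
  Finset.univ.filter fun e => l (G.fst e) ≠ l (G.snd e)

noncomputable def uncut (G : CapGraph n m) (l : ℕ → ℕ) : ℝ :=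
  ∑ e, if l (G.fst e) = l (G.snd e) then G.cap e else 0

/-- Minimum cuts are found by maximising the capacity inside the parts. That is the quantity the
tables yield, and 0 is a safe initial record for it. -/
theorem capOf_cutOf (l : ℕ → ℕ) : G.capOf (G.cutOf l) = G.capOf Finset.univ - G.uncut l := by
  have := Finset.sum_filter_add_sum_filter_not Finset.univ
    (fun e => l (G.fst e) = l (G.snd e)) G.cap
  rw [uncut, ← Finset.sum_filter, capOf, cutOf, capOf]
  linarith

theorem image_range_eq (l : ℕ → ℕ) :
    (Finset.range n).image l = Finset.univ.image fun u : Fin n => l u := by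
  ext x
  simp only [Finset.mem_image, Finset.mem_range, Finset.mem_univ, true_and]
  exact ⟨fun ⟨u, hu, h⟩ => ⟨⟨u, hu⟩, h⟩, fun ⟨u, h⟩ => ⟨u, u.2, h⟩⟩

theorem isKCut_cutOf {k : ℕ} (l : ℕ → ℕ) (h : k ≤ ((Finset.range n).image l).card) :
    G.IsKCut k (G.cutOf l) := by
  rw [image_range_eq] at h
  exact isKCut_of_label (G := G) (fun u : Fin n => l u) h

/-- Every minimum `k`-cut has a code, if the list of trees includes the support of an optimum
solution. -/
theorem IsMinKCut.exists_code {k q r L : ℕ} (hk : 2 < k) (hq : q = 2 * k - 2)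
    (hr : r = 2 * k - 3) (hn : k ≤ n) {y : Finset (Fin m) → ℝ} {z : Fin m → ℝ}
    (hopt : G.DualOptimal k y z) (hpos : ∀ A, G.IsKCut k A → 0 < G.capOf A)
    {Fs : ℕ → Finset (Fin m)} (hy : ∀ F, (∀ j < L, Fs j ≠ F) → y F = 0)
    {T : ℕ → ℕ → ℕ → ℕ} (hT : ∀ j < L, G.TreeTable (Fs j) (T j)) {A : Finset (Fin m)}
    (hA : G.IsMinKCut k A) :
    ∃ X < L * ((n - 1) * q) ^ r, k ≤ ((Finset.range n).image (codeLab n q r T X)).card ∧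
      G.cutOf (codeLab n q r T X) = A := by
  classical
  obtain ⟨F, hyF, hAF⟩ := hopt.exists_card_inter_lt hpos hA
  have hF : G.IsMaximalForest F := by
    by_contra hcon
    exact hyF.ne' (hopt.1.y_support F hcon)
  obtain ⟨j, hj, rfl⟩ : ∃ j < L, Fs j = F := by
    by_contra hcon
    push Not at hcon
    exact hyF.ne' (hy F hcon)
  -- With h ≥ 1, the bound |A ∩ F| + 2h < 2k yields |A ∩ F| + h ≤ 2k - 2 = q, which is the number of
  -- digits plus 1.
  have h1 : 0 < G.numComponents := by
    have : Nonempty (G.span Finset.univ).ConnectedComponent :=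
      ⟨(G.span Finset.univ).connectedComponentMk ⟨0, by omega⟩⟩
    exact Nat.card_pos
  obtain ⟨g, hg, rfl⟩ := hA.1.exists_label
  obtain ⟨x, hx, hlab⟩ := (hT j hj).exists_code_of_label hF (by omega) (q := q) (r := r)
    (by omega) g (by
      have : (Fs j).filter (fun e => g (G.fst e) ≠ g (G.snd e)) =
        (Finset.univ.filter fun e => g (G.fst e) ≠ g (G.snd e)) ∩ Fs j := by ext; simp [and_comm]
      rw [this]
      omega)
  set Q := ((n - 1) * q) ^ r with hQ
  have hQ0 : 0 < Q := by omega
  have hcl : codeLab n q r T (j * Q + x) =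
      lab r q (T j) (vOf n ((n - 1) * q) x) (dOf n ((n - 1) * q) x) := by
    funext u
    rw [codeLab, ← hQ, Nat.mul_comm j Q, Nat.mul_add_div hQ0, Nat.div_eq_of_lt hx, add_zero,
      Nat.mul_add_mod, Nat.mod_eq_of_lt hx]
  refine ⟨j * Q + x, ?_, ?_, ?_⟩
  · have : (j + 1) * Q ≤ L * Q := Nat.mul_le_mul_right Q hj
    rw [add_mul] at this
    omega
  · rw [hcl, image_range_eq]
    exact hg.trans_eq (card_image_congr _ _ _ fun u v => (hlab u v).symm)
  · rw [hcl]
    ext e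
    simp [cutOf, hlab]

/-- A list of the codes of all labellings that are best is a list of the minimum `k`-cuts. -/
theorem isMinKCut_iff {k q r L N : ℕ} {T : ℕ → ℕ → ℕ → ℕ} {code : ℕ → ℕ}
    (hcover : ∀ A, G.IsMinKCut k A → ∃ X < L * ((n - 1) * q) ^ r,
      k ≤ ((Finset.range n).image (codeLab n q r T X)).card ∧ G.cutOf (codeLab n q r T X) = A)
    (hcode : ∀ X, (∃ i < N, code i = X) ↔ X < L * ((n - 1) * q) ^ r ∧
      k ≤ ((Finset.range n).image (codeLab n q r T X)).card ∧
      ∀ X' < L * ((n - 1) * q) ^ r, k ≤ ((Finset.range n).image (codeLab n q r T X')).card →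
        G.uncut (codeLab n q r T X') ≤ G.uncut (codeLab n q r T X)) (A : Finset (Fin m)) :
    G.IsMinKCut k A ↔ ∃ i < N, G.cutOf (codeLab n q r T (code i)) = A := by
  constructor
  · intro hA
    obtain ⟨X, hX, hXk, rfl⟩ := hcover A hA
    obtain ⟨i, hi, hiX⟩ := (hcode X).2 ⟨hX, hXk, fun X' hX' hXk' => by
      have := hA.2 _ (isKCut_cutOf (G := G) _ hXk')
      rw [capOf_cutOf, capOf_cutOf] at this
      linarith⟩
    exact ⟨i, hi, by rw [hiX]⟩
  · rintro ⟨i, hi, rfl⟩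
    obtain ⟨hX, hXk, hmax⟩ := (hcode (code i)).1 ⟨i, hi, rfl⟩
    refine ⟨isKCut_cutOf _ hXk, fun B hB => ?_⟩
    -- Some minimum `k`-cut exists by finiteness and has a code; the listed code is at least as
    -- good.
    obtain ⟨A, hA, hAmin⟩ := (Set.toFinite {A | G.IsKCut k A}).exists_minimalFor G.capOf _ ⟨B, hB⟩
    have hAmin' : ∀ B, G.IsKCut k B → G.capOf A ≤ G.capOf B := fun B hB =>
      (le_total _ _).elim id fun hle => hAmin hB hle
    obtain ⟨X, hX', hXk', rfl⟩ := hcover A ⟨hA, hAmin'⟩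
    have h1 := hmax X hX' hXk'
    have h2 := hAmin' B hB
    rw [capOf_cutOf] at h2 ⊢
    linarith

end
end CapGraph
end KCut

namespace KCut

/-! ### The enumerating program -/

attribute [simp] NExp.eval NExp.Ok RExp.eval RExp.Ok BExp.holds BExp.Ok

infixl:65 "+ₙ" => NExp.add
infixl:65 "-ₙ" => NExp.sub
infixl:70 "*ₙ" => NExp.mul
infixl:70 "/ₙ" => NExp.div
infixl:70 "%ₙ" => NExp.mod
infixl:65 "+ᵣ" => RExp.add
infixl:65 "-ᵣ" => RExp.sub
infixl:70 "*ᵣ" => RExp.mul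
infixr:60 ";;" => Code.seq
notation "ℓ" c => NExp.const c
notation "ρ" x => NExp.reg x

/-- The test for equality, as a number. -/
def eqE (e f : NExp) : NExp := (ℓ 1) -ₙ ((e -ₙ f) +ₙ (f -ₙ e))

namespace Code

section
variable {w : ℕ} {s : State} {Q : State → Prop}

@[simp] theorem eqE_eval (e f : NExp) : (eqE e f).eval s = eqN (e.eval s) (f.eval s) := rfl
@[simp] theorem eqE_Ok (e f : NExp) : (eqE e f).Ok w s ↔ e.Ok w s ∧ f.Ok w s := by
  simp [eqE, and_comm]
@[simp] theorem WP_skip : skip.WP w s Q ↔ Q s := Iff.rfl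
@[simp] theorem WP_set (x : ℕ) (e : NExp) : (set x e).WP w s Q ↔
    e.Ok w s ∧ (x < 100 → Small w s → e.eval s < 2 ^ w) ∧ Q (s.setReg x (e.eval s)) := Iff.rfl
@[simp] theorem WP_store (a : ℕ) (i e : NExp) : (store a i e).WP w s Q ↔
    i.Ok w s ∧ e.Ok w s ∧ (a < 100 → Small w s → e.eval s < 2 ^ w) ∧
      Q (s.setArr a (i.eval s) (e.eval s)) := Iff.rfl
@[simp] theorem WP_rstore (a : ℕ) (i : NExp) (e : RExp) : (rstore a i e).WP w s Q ↔
    i.Ok w s ∧ e.Ok w s ∧ Q (s.setRArr a (i.eval s) (e.eval s)) := Iff.rfl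
@[simp] theorem WP_seq (p q : Code) : (p ;; q).WP w s Q ↔ p.WP w s fun s' => q.WP w s' Q := Iff.rfl
@[simp] theorem WP_cond (b : BExp) (p q : Code) : (cond b p q).WP w s Q ↔
    b.Ok w s ∧ (b.holds s → p.WP w s Q) ∧ (¬ b.holds s → q.WP w s Q) := Iff.rfl

theorem WP.rep {x b : ℕ} {p : Code} (I : ℕ → State → Prop) (h0 : I 0 (s.setReg x 0))
    (h1 : ∀ i < s.reg b, ∀ s', Frame (rep x b p) s s' → s'.reg x = i → I i s' →
      p.WP w s' fun s'' => I (i + 1) (s''.setReg x (i + 1)))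
    (h2 : ∀ s', Frame (rep x b p) s s' → s'.reg x = s.reg b → I (s.reg b) s' → Q s') :
    (rep x b p).WP w s Q := ⟨I, h0, h1, h2⟩

theorem WP.seq {p q : Code} {R : State → Prop} (h : p.WP w s R)
    (h' : ∀ s', Frame p s s' → R s' → q.WP w s' Q) : (p ;; q).WP w s Q :=
  (WP_seq p q).2 (WP.mono h h')
end

/-- Register `20` gets an unreached node and register `21` the node to which it is attached. -/
def pick : Code :=
  set 20 (ℓ 0) ;; set 21 (ℓ 0) ;;
  -- Default for the case that no forest edge leaves the reached set: any unreached node, attached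
  -- to the root 0.
  rep 14 0 (cond (.le (.get 6 (ρ 14)) (ℓ 0)) (set 20 (ρ 14)) skip) ;;
  rep 14 0 (
    set 15 (.get 4 ((ρ 12) *ₙ (ρ 0) +ₙ (ρ 14))) ;;
    cond (.le (ℓ 1) (ρ 15)) (
      set 16 (.get 0 ((ρ 15) -ₙ (ℓ 1))) ;; set 17 (.get 1 ((ρ 15) -ₙ (ℓ 1))) ;;
      cond (.conj (.le (ℓ 1) (.get 6 (ρ 16))) (.le (.get 6 (ρ 17)) (ℓ 0)))
        (set 20 (ρ 17) ;; set 21 (ρ 16))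
        (cond (.conj (.le (ℓ 1) (.get 6 (ρ 17))) (.le (.get 6 (ρ 16)) (ℓ 0)))
          (set 20 (ρ 16) ;; set 21 (ρ 17)) skip)) skip)

/-- The address of the entry `(e, f)` of the table of ancestors. -/
def ancE (e f : NExp) : NExp := .get 5 ((ρ 22) +ₙ e *ₙ (ρ 0) +ₙ f)

/-- The column of the new node is copied from its parent and the diagonal entry is set to 1: one
step of `Grow`. -/
def attach : Code :=
  rep 14 0 (store 5 ((ρ 22) +ₙ (ρ 14) *ₙ (ρ 0) +ₙ (ρ 20)) (ancE (ρ 14) (ρ 21))) ;;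
  store 5 ((ρ 22) +ₙ (ρ 20) *ₙ (ρ 0) +ₙ (ρ 20)) (ℓ 1) ;; store 6 (ρ 20) (ℓ 1)

/-- The table of ancestors for the tree with the number in register `12`. -/
def tree : Code :=
  set 22 ((ρ 12) *ₙ (ρ 5)) ;;
  rep 14 0 (store 6 (ρ 14) (ℓ 0)) ;;
  store 5 (ρ 22) (ℓ 1) ;; store 6 (ℓ 0) (ℓ 1) ;;
  rep 13 6 (pick ;; attach)

/-- The capacities between pairs of nodes. -/
def cmat : Code :=
  rep 14 1 (rstore 4 (.get 0 (ρ 14) *ₙ (ρ 0) +ₙ .get 1 (ρ 14))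
    (.get 4 (.get 0 (ρ 14) *ₙ (ρ 0) +ₙ .get 1 (ρ 14)) +ᵣ .get 0 (ρ 14)))

/-- The capacities between subtrees and nodes. -/
def rmat : Code :=
  rep 14 0 (rep 15 0 (rstore 7 (ℓ 0) (.ofNat (ℓ 0)) ;;
    rep 16 0 (rstore 7 (ℓ 0) (.get 7 (ℓ 0) +ᵣ
      .ofNat (ancE (ρ 14) (ρ 16)) *ᵣ .get 4 ((ρ 16) *ₙ (ρ 0) +ₙ (ρ 15)))) ;;
    rstore 5 ((ρ 14) *ₙ (ρ 0) +ₙ (ρ 15)) (.get 7 (ℓ 0))))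

/-- The capacities between pairs of subtrees. -/
def wmat : Code :=
  rep 14 0 (rep 15 0 (rstore 7 (ℓ 0) (.ofNat (ℓ 0)) ;;
    rep 16 0 (rstore 7 (ℓ 0) (.get 7 (ℓ 0) +ᵣ
      .ofNat (ancE (ρ 15) (ρ 16)) *ᵣ .get 5 ((ρ 14) *ₙ (ρ 0) +ₙ (ρ 16)))) ;;
    rstore 6 ((ρ 14) *ₙ (ρ 0) +ₙ (ρ 15)) (.get 7 (ℓ 0))))

/-- The nodes and increments of the code in register `13`. -/
def decode : Code :=
  set 23 (ρ 13) ;;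
  rep 14 8 (
    set 24 ((ρ 23) %ₙ (ρ 11)) ;; set 23 ((ρ 23) /ₙ (ρ 11)) ;;
    store 7 (ρ 14) ((ℓ 1) +ₙ (ρ 24) %ₙ (ρ 6)) ;; store 8 (ρ 14) ((ρ 24) /ₙ (ρ 6)))

/-- The labels above and below the nodes of the code. -/
def labels : Code :=
  rep 14 8 (
    set 24 (ℓ 0) ;; set 25 (ℓ 0) ;;
    rep 15 8 (
      set 26 (ancE (.get 7 (ρ 15)) (.get 7 (ρ 14))) ;;
      set 24 ((ρ 24) +ₙ .get 8 (ρ 15) *ₙ ((ρ 26) *ₙ ((ℓ 1) -ₙ eqE (.get 7 (ρ 15)) (.get 7 (ρ 14)) *ₙ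
        ((ℓ 1) -ₙ ((ℓ 1) -ₙ ((ρ 15) -ₙ (ρ 14))))))) ;;
      set 25 ((ρ 25) +ₙ .get 8 (ρ 15) *ₙ (ρ 26))) ;;
    store 9 (ρ 14) ((ρ 24) %ₙ (ρ 10)) ;;
    store 10 (ρ 14) (((ρ 24) -ₙ .get 8 (ρ 14)) %ₙ (ρ 10)) ;;
    store 11 (ρ 14) ((ρ 25) %ₙ (ρ 10))) ;;
  -- The sentinel at index `r`, as in `nod`, `top`, `bot` and `lbl`.
  store 7 (ρ 8) (ℓ 0) ;; store 9 (ρ 8) (ℓ 0) ;; store 10 (ρ 8) (ρ 10) ;; store 11 (ρ 8) (ℓ 0)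

/-- The number of different labels. -/
def count : Code :=
  set 27 (ℓ 0) ;;
  rep 14 10 (
    set 24 (ℓ 0) ;;
    rep 15 10 (set 24 ((ρ 24) +ₙ eqE (.get 11 (ρ 15)) (ρ 14))) ;;
    set 27 ((ρ 27) +ₙ ((ℓ 1) -ₙ ((ℓ 1) -ₙ (ρ 24)))))

/-- The weight of the edges inside the parts. -/
def weigh : Code :=
  -- The sum starts at `- W 0 0`. The loops run to q = r + 1 so as to include the sentinel.
  rstore 7 (ℓ 0) (.ofNat (ℓ 0) -ᵣ .get 6 (ℓ 0)) ;;
  rep 14 10 (rep 15 10 (rstore 7 (ℓ 0) (.get 7 (ℓ 0) +ᵣ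
    .get 6 (.get 7 (ρ 14) *ₙ (ρ 0) +ₙ .get 7 (ρ 15)) *ᵣ
    (.ofNat (eqE (.get 9 (ρ 14)) (.get 9 (ρ 15))) -ᵣ .ofNat (eqE (.get 10 (ρ 14)) (.get 9 (ρ 15))) -ᵣ
      .ofNat (eqE (.get 9 (ρ 14)) (.get 10 (ρ 15))) +ᵣ
      .ofNat (eqE (.get 10 (ρ 14)) (.get 10 (ρ 15)))))))

/-- The list of the best codes is kept. -/
def record (k : ℕ) : Code :=
  cond (.le (ℓ k) (ρ 27)) (
    -- A strictly larger weight becomes the record and empties the list; after that, the code is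
    -- appended whenever it attains the record.
    cond (.rle (.get 7 (ℓ 0)) (.get 8 (ℓ 0))) skip (rstore 8 (ℓ 0) (.get 7 (ℓ 0)) ;; set 2 (ℓ 0)) ;;
    cond (.rle (.get 8 (ℓ 0)) (.get 7 (ℓ 0)))
      (store 12 (ρ 2) ((ρ 12) *ₙ (ρ 7) +ₙ (ρ 13)) ;; set 2 ((ρ 2) +ₙ (ℓ 1))) skip) skip

/-- A local copy of the listed sets of edges. -/
def cells : Code :=
  rep 12 4 (rep 14 0 (store 4 ((ρ 12) *ₙ (ρ 0) +ₙ (ρ 14)) (.get 102 ((ρ 12) *ₙ (ρ 0) +ₙ (ρ 14)))))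

def main (k : ℕ) : Code :=
  cells ;; cmat ;;
  rep 12 4 (tree ;; rmat ;; wmat ;; rep 13 7 (decode ;; labels ;; count ;; weigh ;; record k))

/-- The reporting program. -/
def report : Code :=
  set 12 (.get 12 (ρ 3) /ₙ (ρ 7)) ;; set 13 (.get 12 (ρ 3) %ₙ (ρ 7)) ;;
  set 22 ((ρ 12) *ₙ (ρ 5)) ;; decode ;;
  rep 15 0 (
    set 24 (ℓ 0) ;;
    rep 14 8 (set 24 ((ρ 24) +ₙ .get 8 (ρ 14) *ₙ ancE (.get 7 (ρ 14)) (ρ 15))) ;;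
    store 13 (ρ 15) ((ρ 24) %ₙ (ρ 10))) ;;
  rep 14 1 (store 3 (ρ 14) ((ℓ 1) -ₙ eqE (.get 13 (.get 0 (ρ 14))) (.get 13 (.get 1 (ρ 14)))))

/-- The input is copied for a renamed program. -/
def copyInput (k : ℕ) : Code :=
  -- Register 8 is set this early because it bounds a loop in `constants`, and a program must not
  -- write the registers that bound its loops.
  set 8 (ℓ (2 * k - 3)) ;; set 100 (ρ 0) ;; set 101 (ρ 1) ;;
  rep 14 1 (store 100 (ρ 14) (.get 0 (ρ 14)) ;; store 101 (ρ 14) (.get 1 (ρ 14)) ;;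
    rstore 100 (ρ 14) (.get 0 (ρ 14)))

/-- The constants of the program. -/
def constants (k : ℕ) : Code :=
  set 4 (ρ 102) ;; set 5 ((ρ 0) *ₙ (ρ 0)) ;; set 6 ((ρ 0) -ₙ (ℓ 1)) ;; set 10 (ℓ (2 * k - 2)) ;; set 11 ((ρ 6) *ₙ (ρ 10)) ;;
  set 7 (ℓ 1) ;; rep 14 8 (set 7 ((ρ 7) *ₙ (ρ 11)))

theorem main_counting (k : ℕ) : (main k).Counting := by
  simp [main, Counting, cells, cmat, tree, pick, attach, rmat, wmat, decode, labels, count, weigh,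
    record, regs]

theorem main_bounds (k : ℕ) : ∀ b ∈ (main k).bounds, b ∉ (main k).regs := by
  simp [main, bounds, cells, cmat, tree, pick, attach, rmat, wmat, decode, labels, count, weigh,
    record, regs]

theorem report_counting : report.Counting := by
  simp [report, Counting, decode, regs]

theorem report_bounds : ∀ b ∈ report.bounds, b ∉ report.regs := by
  simp [report, bounds, decode, regs]

end Code
end KCut

/-! ### Correctness of growing a tree: the choice of the next node. -/

namespace KCut
namespace Code

section
variable {n m : ℕ} {G : CapGraph n m} {q r w j : ℕ} {s : State}

/-- The constants of the program and the ends of the edges are in their places. -/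
structure Ctx (G : CapGraph n m) (q r : ℕ) (s : State) : Prop where
  reg0 : s.reg 0 = n
  reg1 : s.reg 1 = m
  reg5 : s.reg 5 = n * n
  reg6 : s.reg 6 = n - 1
  reg7 : s.reg 7 = ((n - 1) * q) ^ r
  reg8 : s.reg 8 = r
  reg10 : s.reg 10 = q
  reg11 : s.reg 11 = (n - 1) * q
  fst : ∀ e : Fin m, s.arr 0 e = G.fst e
  snd : ∀ e : Fin m, s.arr 1 e = G.snd e

theorem Ctx.congr {s' : State} (h : Ctx G q r s)
    (hr : ∀ x ∈ [0, 1, 5, 6, 7, 8, 10, 11], s'.reg x = s.reg x)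
    (ha : ∀ a ∈ [0, 1], s'.arr a = s.arr a) : Ctx G q r s' := by
  simp only [List.mem_cons, forall_eq_or_imp, List.not_mem_nil, false_implies, implies_true,
    and_true] at hr ha
  obtain ⟨h0, h1, h5, h6, h7, h8, h10, h11⟩ := hr
  obtain ⟨a0, a1⟩ := ha
  exact ⟨h0 ▸ h.reg0, h1 ▸ h.reg1, h5 ▸ h.reg5, h6 ▸ h.reg6, h7 ▸ h.reg7, h8 ▸ h.reg8,
    h10 ▸ h.reg10, h11 ▸ h.reg11, a0 ▸ h.fst, a1 ▸ h.snd⟩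

theorem Ctx.frame {p : Code} {s' : State} (h : Ctx G q r s) (hf : Frame p s s')
    (hr : ∀ x ∈ [0, 1, 5, 6, 7, 8, 10, 11], x ∉ p.regs) (ha : ∀ a ∈ [0, 1], a ∉ p.arrs) :
    Ctx G q r s' :=
  h.congr (fun x hx => hf.reg x (hr x hx)) fun a hx => hf.arr a (ha a hx)

/-- The set of edges in the cells `j * n, …, j * n + n - 1`. -/
def listSet (n m : ℕ) (cell : ℕ → ℕ) (j : ℕ) : Finset (Fin m) :=
  Finset.univ.filter fun e => ∃ i < n, cell (j * n + i) = (e : ℕ) + 1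

/-- The result is exactly what the constructor `Grow.step` asks for. -/
theorem pick_spec (hc : Ctx G q r s) (hcell : ∀ i < n, s.arr 4 (j * n + i) ≤ m)
    (hj : s.reg 12 = j) (hn : 0 < n) {V : Finset (Fin n)} (h0 : ⟨0, hn⟩ ∈ V) (hV : V ≠ Finset.univ)
    (hvis : ∀ u : Fin n, s.arr 6 u = if u ∈ V then 1 else 0) :
    pick.WP w s fun s' => ∃ u v : Fin n, s'.reg 20 = v ∧ s'.reg 21 = u ∧ u ∈ V ∧ v ∉ V ∧
      ((∃ e ∈ listSet n m (s.arr 4) j, G.fst e = u ∧ G.snd e = v ∨ G.fst e = v ∧ G.snd e = u) ∨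
        ∀ e ∈ listSet n m (s.arr 4) j, G.fst e ∈ V ↔ G.snd e ∈ V) := by
  have hvis1 : ∀ u : Fin n, 1 ≤ s.arr 6 u ↔ u ∈ V := fun u => by rw [hvis]; split_ifs <;> simp_all
  have hvis0 : ∀ u : Fin n, s.arr 6 u ≤ 0 ↔ u ∉ V := fun u => by rw [hvis]; split_ifs <;> simp_all
  unfold pick
  simp only [WP_seq, WP_set, NExp.Ok, NExp.eval, true_and]
  refine ⟨fun _ _ => by positivity, fun _ _ => by positivity, ?_⟩
  refine WP.rep (fun i s' => (∃ x < i, ∃ hx : x < n, (⟨x, hx⟩ : Fin n) ∉ V) →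
    ∃ v : Fin n, s'.reg 20 = v ∧ v ∉ V) ?_ ?_ ?_
  · rintro ⟨x, hx, -⟩; omega
  · intro i hi s' hf hx hI
    simp only [State.setReg_reg, hc.reg0] at hi
    have h6 : s'.arr 6 = s.arr 6 := by rw [hf.arr 6 (by simp [arrs])]; simp
    have hv := hvis0 ⟨i, hi⟩
    simp only at hv
    simp only [WP_cond, WP_set, WP_skip, BExp.Ok, NExp.Ok, BExp.holds, NExp.eval, hx, h6, hv]
    refine ⟨by simp, fun hiV => ⟨by simp, fun _ hs => ?_, fun _ => ⟨⟨i, hi⟩, by simp, hiV⟩⟩,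
      fun hiV hex => ?_⟩
    · rw [← hx]; exact hs.reg 14 (by norm_num)
    · simp only [State.setReg_reg]
      refine hI ?_
      obtain ⟨x, hxi, hxn, hxV⟩ := hex
      refine ⟨x, ?_, hxn, hxV⟩
      rcases Nat.lt_succ_iff_lt_or_eq.1 hxi with h | rfl
      · exact h
      · exact absurd hxV hiV
  intro s1 hf1 hx1 hI1
  obtain ⟨v0, hv0, hv0V⟩ : ∃ v : Fin n, s1.reg 20 = v ∧ v ∉ V := by
    refine hI1 ?_
    obtain ⟨x, hx⟩ : ∃ x, x ∉ V := by
      by_contra hcon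
      push Not at hcon
      exact hV (Finset.eq_univ_iff_forall.2 hcon)
    exact ⟨x, by simp [hc.reg0], x.2, hx⟩
  have hs1 : s1.reg 21 = 0 := by rw [hf1.reg 21 (by simp [regs])]; simp
  have h1n : s1.reg 0 = n := by rw [hf1.reg 0 (by simp [regs])]; simp [hc.reg0]
  have h1j : s1.reg 12 = j := by rw [hf1.reg 12 (by simp [regs])]; simp [hj]
  have ha : s1.arr = s.arr := funext fun a => by rw [hf1.arr a (by simp [arrs])]; simp
  -- Either the current pair is joined by a forest edge, or none of the cells seen so far holds an
  -- edge that leaves `V`.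
  refine WP.rep (fun i s' => ∃ u v : Fin n, s'.reg 20 = v ∧ s'.reg 21 = u ∧ u ∈ V ∧ v ∉ V ∧
      ((∃ e ∈ listSet n m (s.arr 4) j, G.fst e = u ∧ G.snd e = v ∨ G.fst e = v ∧ G.snd e = u) ∨
        ∀ i' < i, ∀ e : Fin m, s.arr 4 (j * n + i') = e + 1 → (G.fst e ∈ V ↔ G.snd e ∈ V))) ?_ ?_ ?_
  · exact ⟨⟨0, hn⟩, v0, by simp [hv0], by simp [hs1], h0, hv0V, .inr (by simp)⟩
  · rintro i hi s2 hf2 hx2 ⟨u, v, h20, h21, hu, hv, huv⟩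
    rw [h1n] at hi
    have h2n : s2.reg 0 = n := by rw [hf2.reg 0 (by simp [regs]), h1n]
    have h2j : s2.reg 12 = j := by rw [hf2.reg 12 (by simp [regs]), h1j]
    have h2a : s2.arr = s.arr := funext fun a => by rw [hf2.arr a (by simp [arrs]), ha]
    simp only [WP_seq, WP_cond, WP_set, WP_skip, BExp.Ok, NExp.Ok, BExp.holds, NExp.eval, hx2, h2n,
      h2j, h2a, State.setReg_reg, State.setReg_arr, Nat.reduceLT, true_or, true_and, and_true,
      Nat.reduceEqDiff, if_true, if_false]
    refine ⟨fun _ hs => by rw [← h2a]; exact hs.arr 4 (by norm_num) _, fun hpos => ?_, fun hz => ?_⟩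
    · obtain ⟨e, he⟩ : ∃ e : Fin m, s.arr 4 (j * n + i) = e + 1 :=
        ⟨⟨s.arr 4 (j * n + i) - 1, by have := hcell i hi; omega⟩, by simp; omega⟩
      have heF : e ∈ listSet n m (s.arr 4) j := by
        simp only [listSet, Finset.mem_filter, Finset.mem_univ, true_and]
        exact ⟨i, hi, he⟩
      simp only [he, Nat.add_sub_cancel, hc.fst, hc.snd, hvis1, hvis0]
      refine ⟨fun _ hs => ?_, fun _ hs => ?_, fun hcr => ⟨fun _ hs => ?_, fun _ hs => ?_, ?_⟩,
        fun hcr => ⟨fun hcr' => ⟨fun _ hs => ?_, fun _ hs => ?_, ?_⟩, fun hcr' => ?_⟩⟩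
      · have := hs.arr 0 (by norm_num) e; simpa [h2a, hc.fst] using this
      · have := hs.arr 1 (by norm_num) e; simpa [h2a, hc.snd] using this
      · have := hs.arr 1 (by norm_num) e; simpa [h2a, hc.snd] using this
      · have := hs.arr 0 (by norm_num) e; simpa [h2a, hc.fst] using this
      · exact ⟨G.fst e, G.snd e, rfl, rfl, hcr.1, hcr.2, .inl ⟨e, heF, .inl ⟨rfl, rfl⟩⟩⟩
      · have := hs.arr 0 (by norm_num) e; simpa [h2a, hc.fst] using this
      · have := hs.arr 1 (by norm_num) e; simpa [h2a, hc.snd] using this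
      · exact ⟨G.snd e, G.fst e, rfl, rfl, hcr'.1, hcr'.2, .inl ⟨e, heF, .inr ⟨rfl, rfl⟩⟩⟩
      · refine ⟨u, v, h20, h21, hu, hv, huv.imp id fun h i' hi' e' he' => ?_⟩
        rcases Nat.lt_succ_iff_lt_or_eq.1 hi' with hlt | rfl
        · exact h i' hlt e' he'
        · obtain rfl : e = e' := Fin.ext (by omega)
          tauto
    · refine ⟨u, v, h20, h21, hu, hv, huv.imp id fun h i' hi' e' he' => ?_⟩
      rcases Nat.lt_succ_iff_lt_or_eq.1 hi' with hlt | rfl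
      · exact h i' hlt e' he'
      · omega
  · rintro s2 - - ⟨u, v, h20, h21, hu, hv, huv⟩
    refine ⟨u, v, h20, h21, hu, hv, huv.imp id fun h e he => ?_⟩
    simp only [listSet, Finset.mem_filter, Finset.mem_univ, true_and] at he
    obtain ⟨i, hi, he⟩ := he
    exact h i (by rwa [h1n]) e he

end
end Code
end KCut

/-! ### Correctness of the tables of ancestors. -/

namespace KCut
namespace Code

section
variable {n m : ℕ} {G : CapGraph n m} {q r w j : ℕ} {s : State}

theorem idx_inj {x y x' y' : ℕ} (hy : y < n) (hy' : y' < n) :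
    x * n + y = x' * n + y' ↔ x = x' ∧ y = y' := by
  refine ⟨fun h => ?_, by rintro ⟨rfl, rfl⟩; rfl⟩
  have hn : 0 < n := by omega
  have h1 : (x * n + y) / n = x := by
    rw [mul_comm, Nat.mul_add_div hn, Nat.div_eq_of_lt hy, add_zero]
  have h2 : (x' * n + y') / n = x' := by
    rw [mul_comm, Nat.mul_add_div hn, Nat.div_eq_of_lt hy', add_zero]
  have hx : x = x' := by rw [← h1, ← h2, h]
  subst hx
  exact ⟨rfl, by omega⟩

theorem idx_lt {x y : ℕ} (hx : x < n) (hy : y < n) : x * n + y < n * n := by nlinarith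

/-- As `u ≠ v`, the column that is read is not disturbed by the writes. The last clause protects the
tables of the other trees, which share the array. -/
theorem attach_spec {off u v : ℕ} (hw : 1 ≤ w) (h0 : s.reg 0 = n) (hv : s.reg 20 = v)
    (hu : s.reg 21 = u) (ho : s.reg 22 = off) (hvn : v < n) (hun : u < n) (huv : u ≠ v) :
    attach.WP w s fun s' => s'.arr 6 = Function.update (s.arr 6) v 1 ∧
      (∀ a < n, ∀ b < n, s'.arr 5 (off + a * n + b) = if b = v then
        (if a = v then 1 else s.arr 5 (off + a * n + u)) else s.arr 5 (off + a * n + b)) ∧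
      ∀ i, i < off ∨ off + n * n ≤ i → s'.arr 5 i = s.arr 5 i := by
  have h1w : 1 < 2 ^ w := Nat.one_lt_two_pow (by omega)
  unfold attach ancE
  rw [WP_seq]
  refine WP.rep (fun i s' => (∀ a < n, ∀ b < n, s'.arr 5 (off + a * n + b) =
    if b = v ∧ a < i then s.arr 5 (off + a * n + u) else s.arr 5 (off + a * n + b)) ∧
      ∀ i, i < off ∨ off + n * n ≤ i → s'.arr 5 i = s.arr 5 i) ?_ ?_ ?_
  · simp
  · rintro i hi s1 hf hx ⟨hI1, hI2⟩
    rw [h0] at hi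
    have e0 : s1.reg 0 = n := by rw [hf.reg 0 (by simp [regs]), h0]
    have e20 : s1.reg 20 = v := by rw [hf.reg 20 (by simp [regs]), hv]
    have e21 : s1.reg 21 = u := by rw [hf.reg 21 (by simp [regs]), hu]
    have e22 : s1.reg 22 = off := by rw [hf.reg 22 (by simp [regs]), ho]
    simp only [WP_store, NExp.Ok, NExp.eval, e0, e20, e21, e22, hx, State.setReg_arr,
      State.setArr_arr, if_true, Function.update_apply]
    refine ⟨by simp, by simp, fun _ hs => hs.arr 5 (by norm_num) _, fun a ha b hb => ?_,
      fun i' hi' => ?_⟩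
    · have key : off + a * n + b = off + i * n + v ↔ a = i ∧ b = v := by
        rw [add_assoc, add_assoc, Nat.add_left_cancel_iff, idx_inj hb hvn]
      rw [hI1 a ha b hb, hI1 i hi u hun]
      simp only [key, huv, false_and, if_false]
      by_cases h1 : a = i <;> by_cases h2 : b = v
      · subst h1 h2; simp
      · simp [h2]
      · have : a < i + 1 ↔ a < i := by omega
        simp [h1, h2, this]
      · simp [h2]
    · rw [if_neg, hI2 i' hi']
      have := idx_lt hi hvn
      omega
  · rintro s1 hf hx ⟨hI1, hI2⟩
    have e0 : s1.reg 0 = n := by rw [hf.reg 0 (by simp [regs]), h0]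
    have e20 : s1.reg 20 = v := by rw [hf.reg 20 (by simp [regs]), hv]
    have e22 : s1.reg 22 = off := by rw [hf.reg 22 (by simp [regs]), ho]
    have e6 : s1.arr 6 = s.arr 6 := hf.arr 6 (by simp [arrs])
    rw [h0] at hI1
    simp only [WP_seq, WP_store, NExp.Ok, NExp.eval, e0, e20, e22, State.setArr_arr,
      State.setArr_reg, if_true, Nat.reduceEqDiff, if_false, e6]
    refine ⟨by simp, trivial, fun _ _ => h1w, by simp, trivial, fun _ _ => h1w, trivial,
      fun a ha b hb => ?_, fun i hi => ?_⟩
    · have key : off + a * n + b = off + v * n + v ↔ a = v ∧ b = v := by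
        rw [add_assoc, add_assoc, Nat.add_left_cancel_iff, idx_inj hb hvn]
      rw [Function.update_apply, hI1 a ha b hb]
      simp only [key, ha, and_true]
      by_cases h1 : a = v <;> by_cases h2 : b = v <;> simp [h1, h2]
    · rw [Function.update_of_ne, hI2 i hi]
      have := idx_lt hvn hvn
      omega

/-- The table is not cleared before use; instead the array is known to be zero from the offset on,
and this is passed on for the next tree. -/
theorem tree_spec (hw : 1 ≤ w) (hc : Ctx G q r s) (hcell : ∀ i < n, s.arr 4 (j * n + i) ≤ m)
    (hj : s.reg 12 = j) (hn : 0 < n) (hoff : j * (n * n) < 2 ^ w)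
    (hz : ∀ i, j * (n * n) ≤ i → s.arr 5 i = 0) :
    tree.WP w s fun s' => s'.reg 22 = j * (n * n) ∧
      G.TreeTable (listSet n m (s.arr 4) j) (fun a u => s'.arr 5 (j * (n * n) + a * n + u)) ∧
      (∀ i < j * (n * n), s'.arr 5 i = s.arr 5 i) ∧
      ∀ i, (j + 1) * (n * n) ≤ i → s'.arr 5 i = 0 := by
  classical
  have h1w : 1 < 2 ^ w := Nat.one_lt_two_pow (by omega)
  set off := j * (n * n) with hoffd
  have hoff1 : (j + 1) * (n * n) = off + n * n := by rw [add_mul, one_mul]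
  unfold tree
  simp only [WP_seq, WP_set, NExp.Ok, NExp.eval, hj, hc.reg5]
  refine ⟨by simp, fun _ _ => hoff, ?_⟩
  refine WP.rep (fun i s' => ∀ u < i, s'.arr 6 u = 0) (by simp) ?_ ?_
  · intro i hi s1 hf hx hI
    simp only [WP_store, NExp.Ok, NExp.eval, hx, State.setReg_arr, State.setArr_arr, if_true]
    refine ⟨by simp, trivial, fun _ _ => by positivity, fun u hu => ?_⟩
    rw [Function.update_apply]
    split_ifs with h
    · rfl
    · exact hI u (by omega)
  intro s1 hf1 _ hI1
  have e0 : s1.reg 0 = n := by rw [hf1.reg 0 (by simp [regs])]; simp [hc.reg0]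
  have e22 : s1.reg 22 = off := by rw [hf1.reg 22 (by simp [regs])]; simp [hoffd]
  have hc1 : Ctx G q r s1 := hc.congr
    (fun x hx => by
      have : x ≠ 14 ∧ x ≠ 22 := by simp at hx; omega
      rw [hf1.reg x (by simp [regs, this.1])]; simp [this.2])
    (fun a ha => by
      have : a ≠ 6 := by simp at ha; omega
      rw [hf1.arr a (by simp [arrs, this])]; simp)
  have e12 : s1.reg 12 = j := by rw [hf1.reg 12 (by simp [regs])]; simp [hj]
  have a5 : s1.arr 5 = s.arr 5 := by rw [hf1.arr 5 (by simp [arrs])]; simp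
  have a4 : s1.arr 4 = s.arr 4 := by rw [hf1.arr 4 (by simp [arrs])]; simp
  simp only [State.setReg_reg, hc.reg0, Nat.reduceEqDiff, if_false] at hI1
  simp only [WP_store, NExp.Ok, NExp.eval, e22]
  refine ⟨by simp, trivial, fun _ _ => h1w, trivial, trivial, fun _ _ => h1w, ?_⟩
  -- After `t` rounds t + 1 nodes are reached, so n - 1 rounds reach all of them.
  refine WP.rep (fun t s' => s'.reg 22 = off ∧ ∃ V D, G.Grow (listSet n m (s.arr 4) j) ⟨0, hn⟩ V D ∧
    V.card = t + 1 ∧ (∀ u : Fin n, s'.arr 6 u = if u ∈ V then 1 else 0) ∧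
    (∀ a u : Fin n, s'.arr 5 (off + a * n + u) = if D a u then 1 else 0) ∧
    ∀ i, i < off ∨ off + n * n ≤ i → s'.arr 5 i = s.arr 5 i) ?_ ?_ ?_
  · refine ⟨by simp [e22], _, _, .root, by simp, fun u => ?_, fun a u => ?_, fun i hi => ?_⟩
    · simp only [State.setReg_arr, State.setArr_arr, if_true, Nat.reduceEqDiff, if_false,
        Function.update_apply, Finset.mem_singleton, Fin.ext_iff]
      split_ifs
      · rfl
      · exact hI1 u u.2
    · have key : off + (a : ℕ) * n + u = off ↔ (a : ℕ) = 0 ∧ (u : ℕ) = 0 := by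
        constructor
        · intro h
          have h1 : (a : ℕ) * n = 0 := by omega
          exact ⟨(Nat.mul_eq_zero.1 h1).resolve_right (by omega), by omega⟩
        · rintro ⟨h1, h2⟩; rw [h1, h2]; simp
      simp only [State.setReg_arr, State.setArr_arr, if_true, Nat.reduceEqDiff, if_false,
        Function.update_apply, Fin.ext_iff, key, a5]
      split_ifs
      · rfl
      · exact hz _ (by omega)
    · simp only [State.setReg_arr, State.setArr_arr, if_true, Nat.reduceEqDiff, if_false, a5]
      rw [Function.update_of_ne]
      have : 0 < n * n := by positivity
      omega
  · rintro t ht s2 hf2 - ⟨f22, V, D, hD, hcard, hvis, htab, hout⟩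
    simp only [State.setArr_reg, hc1.reg6] at ht
    have hc2 : Ctx G q r s2 := hc1.congr
      (fun x hx => by
        have : x ≠ 14 ∧ x ≠ 13 ∧ x ≠ 15 ∧ x ≠ 16 ∧ x ≠ 17 ∧ x ≠ 20 ∧ x ≠ 21 := by
          simp at hx; omega
        rw [hf2.reg x (by simp [regs, this, pick, attach])]; simp)
      (fun a ha => by
        have : a ≠ 6 ∧ a ≠ 5 := by simp at ha; omega
        rw [hf2.arr a (by simp [arrs, this, pick, attach])]; simp [this])
    have f12 : s2.reg 12 = j := by rw [hf2.reg 12 (by simp [regs, pick, attach])]; simp [e12]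
    have f4 : s2.arr 4 = s.arr 4 := by rw [hf2.arr 4 (by simp [arrs, pick, attach])]; simp [a4]
    have hV : V ≠ Finset.univ := by
      rintro rfl
      rw [Finset.card_univ, Fintype.card_fin] at hcard
      omega
    refine WP.seq (pick_spec hc2 (by rwa [f4]) f12 hn hD.root_mem hV hvis) ?_
    rintro s3 hf3 ⟨u, v, h20, h21, hu, hv, huv⟩
    rw [f4] at huv
    have g5 : s3.arr 5 = s2.arr 5 := hf3.arr 5 (by simp [arrs, pick])
    have g6 : s3.arr 6 = s2.arr 6 := hf3.arr 6 (by simp [arrs, pick])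
    have g22 : s3.reg 22 = off := by rw [hf3.reg 22 (by simp [regs, pick]), f22]
    have huv' : u ≠ v := by rintro rfl; exact hv hu
    refine (attach_spec hw (by rw [hf3.reg 0 (by simp [regs, pick]), hc2.reg0]) h20 h21 g22
      v.2 u.2 (fun h => huv' (Fin.ext h))).mono ?_
    rintro s4 hf4 ⟨k6, k5, kout⟩
    refine ⟨by simp [hf4.reg 22 (by simp [regs, attach]), g22], _, _, hD.step hu hv huv, ?_,
      fun x => ?_, fun a x => ?_, fun i hi => ?_⟩
    · rw [Finset.card_insert_of_notMem hv, hcard]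
    · rw [State.setReg_arr, k6, g6, Function.update_apply, hvis]
      by_cases hxv : x = v
      · subst hxv; simp
      · simp [hxv, Fin.ext_iff.not.1 hxv]
    · rw [State.setReg_arr, k5 a a.2 x x.2, g5, htab, htab]
      by_cases hxv : x = v
      · subst hxv
        have hax : ¬ D a x := fun h => hv (hD.mem h).2
        by_cases hax' : a = x
        · simp [hax']
        · have : (a : ℕ) ≠ x := fun h => hax' (Fin.ext h)
          simp [hax, hax', this]
      · simp [hxv, Fin.ext_iff.not.1 hxv]
    · rw [State.setReg_arr, kout i hi, g5, hout i hi]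
  · rintro s2 hf2 - ⟨f22, V, D, hD, hcard, -, htab, hout⟩
    simp only [State.setArr_reg, hc1.reg6] at hcard
    have hV : V = Finset.univ := by
      rw [← Finset.card_eq_iff_eq_univ, hcard, Fintype.card_fin]; omega
    subst hV
    refine ⟨f22, ⟨hn, D, hD, fun a u => ?_⟩, fun i hi => hout i (.inl hi), fun i hi => ?_⟩
    · simp only [htab]
      exact ⟨fun h => by simp [h], fun h => by simp [h]⟩
    · rw [hoff1] at hi
      rw [hout i (.inr hi), hz i (by omega)]

end
end Code
end KCut

/-! ### Correctness of the tables of capacities. -/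

namespace KCut
namespace Code

section
variable {n m : ℕ} {G : CapGraph n m} {q r w j : ℕ} {s : State}

theorem Ctx.fst_lt (h : Ctx G q r s) {i : ℕ} (hi : i < m) : s.arr 0 i < n := by
  have := h.fst ⟨i, hi⟩
  simp only at this
  rw [this]; exact Fin.is_lt _

theorem Ctx.snd_lt (h : Ctx G q r s) {i : ℕ} (hi : i < m) : s.arr 1 i < n := by
  have := h.snd ⟨i, hi⟩
  simp only at this
  rw [this]; exact Fin.is_lt _

theorem cmat_spec (hc : Ctx G q r s) (hcap : ∀ e : Fin m, s.rarr 0 e = G.cap e)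
    (hz : ∀ i, s.rarr 4 i = 0) :
    cmat.WP w s fun s' => ∀ u < n, ∀ v < n, s'.rarr 4 (u * n + v) =
      ∑ e, if (G.fst e : ℕ) = u ∧ (G.snd e : ℕ) = v then G.cap e else 0 := by
  unfold cmat
  refine WP.rep (fun i s' => ∀ u < n, ∀ v < n, s'.rarr 4 (u * n + v) =
    ∑ i' ∈ Finset.range i, if s.arr 0 i' = u ∧ s.arr 1 i' = v then s.rarr 0 i' else 0) ?_ ?_ ?_
  · intro u _ v _; simp [hz]
  · intro i hi s1 hf hx hI
    rw [hc.reg1] at hi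
    have e0 : s1.reg 0 = n := by rw [hf.reg 0 (by simp [regs]), hc.reg0]
    have a0 : s1.arr 0 = s.arr 0 := hf.arr 0 (by simp [arrs])
    have a1 : s1.arr 1 = s.arr 1 := hf.arr 1 (by simp [arrs])
    have r0 : s1.rarr 0 = s.rarr 0 := hf.rarr 0 (by simp [rarrs])
    have h0 := hc.fst_lt hi
    have h1 := hc.snd_lt hi
    simp only [WP_rstore, NExp.Ok, RExp.Ok, NExp.eval, RExp.eval, e0, a0, a1, r0, hx,
      State.setReg_rarr, State.setRArr_rarr, if_true, Function.update_apply]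
    refine ⟨by simp, by simp, fun u hu v hv => ?_⟩
    rw [Finset.sum_range_succ, ← hI u hu v hv]
    simp only [idx_inj hv h1]
    by_cases h : u = s.arr 0 i ∧ v = s.arr 1 i
    · rw [if_pos h, if_pos ⟨h.1.symm, h.2.symm⟩, h.1, h.2]
    · rw [if_neg h, if_neg fun h' => h ⟨h'.1.symm, h'.2.symm⟩, add_zero]
  · intro s1 hf _ hI u hu v hv
    rw [hI u hu v hv, hc.reg1, Finset.sum_range]
    simp only [hc.fst, hc.snd, hcap]

/-- A table of sums is computed. -/
def mat (a : ℕ) (e : RExp) : Code :=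
  rep 14 0 (rep 15 0 (rstore 7 (ℓ 0) (.ofNat (ℓ 0)) ;;
    rep 16 0 (rstore 7 (ℓ 0) (.get 7 (ℓ 0) +ᵣ e)) ;;
    rstore a ((ρ 14) *ₙ (ρ 0) +ₙ (ρ 15)) (.get 7 (ℓ 0))))

/-- One specification for both `rmat` and `wmat`, which are instances of `mat` by unfolding. The
summand may depend on everything except the counters' old values, the accumulator and the target. -/
theorem mat_spec {dst : ℕ} {e : RExp} {φ : ℕ → ℕ → ℕ → ℝ} (hdst : dst ≠ 7) (h0 : s.reg 0 = n)
    (he : ∀ s' : State, (∀ x, x ∉ [14, 15, 16] → s'.reg x = s.reg x) → s'.arr = s.arr →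
      (∀ a, a ∉ [7, dst] → s'.rarr a = s.rarr a) → s'.reg 14 < n → s'.reg 15 < n → s'.reg 16 < n →
      e.Ok w s' ∧ e.eval s' = φ (s'.reg 14) (s'.reg 15) (s'.reg 16)) :
    (mat dst e).WP w s fun s' => ∀ a < n, ∀ b < n, s'.rarr dst (a * n + b) =
      ∑ c ∈ Finset.range n, φ a b c := by
  unfold mat
  refine WP.rep (fun i s' => ∀ a < i, ∀ b < n, s'.rarr dst (a * n + b) =
    ∑ c ∈ Finset.range n, φ a b c) (by simp) ?_ ?_
  swap
  · intro s1 _ _ hI; rwa [h0] at hI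
  intro i hi s1 hf1 hx1 hI1
  rw [h0] at hi
  have e0 : s1.reg 0 = n := by rw [hf1.reg 0 (by simp [regs]), h0]
  refine WP.rep (fun t s' => (∀ a < i, ∀ b < n, s'.rarr dst (a * n + b) =
    ∑ c ∈ Finset.range n, φ a b c) ∧ ∀ b < t, s'.rarr dst (i * n + b) =
    ∑ c ∈ Finset.range n, φ i b c) ⟨by simpa using hI1, by simp⟩ ?_ ?_
  swap
  · rintro s2 - - ⟨h1, h2⟩ a ha b hb
    rw [e0] at h2
    simp only [State.setReg_rarr]
    rcases Nat.lt_succ_iff_lt_or_eq.1 ha with h | rfl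
    · exact h1 a h b hb
    · exact h2 b hb
  rintro t ht s2 hf2 hx2 ⟨hI2, hI2'⟩
  rw [e0] at ht
  have f0 : s2.reg 0 = n := by rw [hf2.reg 0 (by simp [regs]), e0]
  have f14 : s2.reg 14 = i := by rw [hf2.reg 14 (by simp [regs]), hx1]
  simp only [WP_seq, WP_rstore, NExp.Ok, RExp.Ok, NExp.eval, RExp.eval, true_and]
  refine WP.rep (fun c s' => s'.rarr 7 0 = ∑ c' ∈ Finset.range c, φ i t c') (by simp) ?_ ?_
  · intro c hcn s3 hf3 hx3 hI3
    simp only [State.setRArr_reg, f0] at hcn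
    have g14 : s3.reg 14 = i := by rw [hf3.reg 14 (by simp [regs])]; simp [f14]
    have g15 : s3.reg 15 = t := by rw [hf3.reg 15 (by simp [regs])]; simp [hx2]
    have hee := he s3 (fun x hx => by
        rw [hf3.reg x (by simp [regs]; simp at hx; tauto), State.setRArr_reg,
          hf2.reg x (by simp [regs]; simp at hx; tauto),
          hf1.reg x (by simp [regs]; simp at hx; tauto)])
      (funext fun a => by
        rw [hf3.arr a (by simp [arrs]), State.setRArr_arr, hf2.arr a (by simp [arrs]),
          hf1.arr a (by simp [arrs])])
      (fun a ha => by
        have ha : a ≠ 7 ∧ a ≠ dst := by simpa using ha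
        rw [hf3.rarr a (by simp [rarrs, ha]), State.setRArr_rarr, if_neg ha.1,
          hf2.rarr a (by simp [rarrs, ha]), hf1.rarr a (by simp [rarrs, ha])])
      (by omega) (by omega) (by omega)
    simp only [WP_rstore, NExp.Ok, RExp.Ok, NExp.eval, RExp.eval, true_and, State.setReg_rarr,
      State.setRArr_rarr, if_true, Function.update_self, hee.1]
    rw [hee.2, hI3, g14, g15, hx3, Finset.sum_range_succ]
  · intro s3 hf3 _ hI3
    simp only [State.setRArr_reg, f0] at hI3
    have g14 : s3.reg 14 = i := by rw [hf3.reg 14 (by simp [regs])]; simp [f14]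
    have g15 : s3.reg 15 = t := by rw [hf3.reg 15 (by simp [regs])]; simp [hx2]
    have g0 : s3.reg 0 = n := by rw [hf3.reg 0 (by simp [regs])]; simp [f0]
    have gd : s3.rarr dst = s2.rarr dst := by
      rw [hf3.rarr dst (by simp [rarrs, hdst])]; simp [hdst]
    simp only [g14, g15, g0, State.setReg_rarr,
      State.setRArr_rarr, if_true, Function.update_apply, gd, hI3]
    refine ⟨by simp, fun a ha b hb => ?_, fun b hb => ?_⟩
    · rw [if_neg (by rw [idx_inj hb ht]; omega), hI2 a ha b hb]
    · split_ifs with h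
      · rw [Nat.add_left_cancel h]
      · exact hI2' b (lt_of_le_of_ne (Nat.lt_succ_iff.1 hb) fun hbt => h (by rw [hbt]))

/-- The capacities between the subtrees are computed. -/
theorem wmat_spec {anc : ℕ → ℕ → ℕ} {off : ℕ} (h0 : s.reg 0 = n) (ho : s.reg 22 = off)
    (hanc : ∀ a < n, ∀ u < n, s.arr 5 (off + a * n + u) = anc a u)
    (hC : ∀ u < n, ∀ v < n, s.rarr 4 (u * n + v) =
      ∑ e, if (G.fst e : ℕ) = u ∧ (G.snd e : ℕ) = v then G.cap e else 0) :
    (rmat ;; wmat).WP w s fun s' => ∀ x < n, ∀ y < n, s'.rarr 6 (x * n + y) =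
      ∑ e, G.cap e * (anc x (G.fst e) * anc y (G.snd e)) := by
  refine WP.seq (mat_spec (φ := fun a b c => (anc a c : ℝ) *
    ∑ e, if (G.fst e : ℕ) = c ∧ (G.snd e : ℕ) = b then G.cap e else 0)
    (by norm_num : 5 ≠ 7) h0 ?_) fun s1 hf1 h1 => ?_
  · intro s' hr ha hra h14 h15 h16
    simp only [RExp.Ok, NExp.Ok, ancE, RExp.eval, NExp.eval, hr 22 (by simp), hr 0 (by simp), ho,
      h0, ha, hra 4 (by simp), hC _ h16 _ h15, hanc _ h14 _ h16]
    simp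
  refine (mat_spec (φ := fun a b c => (anc b c : ℝ) * ∑ c' ∈ Finset.range n, (anc a c' : ℝ) *
    ∑ e, if (G.fst e : ℕ) = c' ∧ (G.snd e : ℕ) = c then G.cap e else 0)
    (by norm_num : 6 ≠ 7) (by rw [hf1.reg 0 (by simp [rmat, regs]), h0]) ?_).mono
    fun s2 hf2 h2 x hx y hy => ?_
  · intro s' hr ha hra h14 h15 h16
    have e22 : s'.reg 22 = off := by rw [hr 22 (by simp), hf1.reg 22 (by simp [rmat, regs]), ho]
    have e0 : s'.reg 0 = n := by rw [hr 0 (by simp), hf1.reg 0 (by simp [rmat, regs]), h0]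
    have a5 : s'.arr 5 = s.arr 5 := by rw [ha, hf1.arr 5 (by simp [rmat, arrs])]
    simp only [RExp.Ok, NExp.Ok, ancE, RExp.eval, NExp.eval, e22, e0, a5, hra 5 (by simp),
      h1 _ h14 _ h16, hanc _ h15 _ h16]
    simp
  · rw [h2 x hx y hy]
    -- In the double sum over pairs of nodes, each edge is met only at the pair of its own ends.
    have key : ∀ c c' : ℕ, ∀ e : Fin m, (anc y c : ℝ) * ((anc x c' : ℝ) *
        if (G.fst e : ℕ) = c' ∧ (G.snd e : ℕ) = c then G.cap e else 0) =
        if (G.fst e : ℕ) = c' then (if (G.snd e : ℕ) = c then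
          G.cap e * (anc x (G.fst e) * anc y (G.snd e)) else 0) else 0 := by
      intro c c' e
      by_cases h1 : (G.fst e : ℕ) = c' <;> by_cases h2 : (G.snd e : ℕ) = c
      · simp only [h1, h2, and_self, if_true]; ring
      all_goals simp [h1, h2]
    simp only [Finset.mul_sum, key]
    have h3 : ∀ c, ∑ c' ∈ Finset.range n, ∑ e, (if (G.fst e : ℕ) = c' then
        (if (G.snd e : ℕ) = c then G.cap e * ((anc x (G.fst e) : ℝ) * anc y (G.snd e)) else 0)
        else 0) = ∑ e, if (G.snd e : ℕ) = c then
          G.cap e * ((anc x (G.fst e) : ℝ) * anc y (G.snd e)) else 0 := by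
      intro c
      rw [Finset.sum_comm]
      exact Finset.sum_congr rfl fun e _ => by
        rw [Finset.sum_ite_eq, if_pos (Finset.mem_range.2 (Fin.is_lt _))]
    simp only [h3]
    rw [Finset.sum_comm]
    exact Finset.sum_congr rfl fun e _ => by
      rw [Finset.sum_ite_eq, if_pos (Finset.mem_range.2 (Fin.is_lt _))]

end
end Code
end KCut

/-! ### Correctness of decoding and evaluating one code. -/

namespace KCut
namespace Code

section
variable {n m : ℕ} {G : CapGraph n m} {q r w j x off : ℕ} {s : State} {anc : ℕ → ℕ → ℕ}
  {v d : ℕ → ℕ}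

theorem decode_spec (hc : Ctx G q r s) (hx : s.reg 13 = x) (hn : 1 < n) :
    decode.WP w s fun s' => ∀ i < r, s'.arr 7 i = vOf n ((n - 1) * q) x i ∧
      s'.arr 8 i = dOf n ((n - 1) * q) x i := by
  unfold decode
  simp only [WP_seq, WP_set, NExp.Ok, NExp.eval, hx]
  refine ⟨by simp, fun _ hs => hx ▸ hs.reg 13 (by norm_num), ?_⟩
  refine WP.rep (fun i s' => s'.reg 23 = x / ((n - 1) * q) ^ i ∧ ∀ i' < i,
    s'.arr 7 i' = vOf n ((n - 1) * q) x i' ∧ s'.arr 8 i' = dOf n ((n - 1) * q) x i') (by simp) ?_ ?_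
  · rintro i hi s1 hf hx1 ⟨h23, hI⟩
    have e0 : s1.reg 0 = n := by rw [hf.reg 0 (by simp [regs])]; simp [hc.reg0]
    have e6 : s1.reg 6 = n - 1 := by rw [hf.reg 6 (by simp [regs])]; simp [hc.reg6]
    have e11 : s1.reg 11 = (n - 1) * q := by rw [hf.reg 11 (by simp [regs])]; simp [hc.reg11]
    have hs23 : Small w s1 → x / ((n - 1) * q) ^ i < 2 ^ w := fun hs => by
      rw [← h23]; exact hs.reg 23 (by norm_num)
    simp only [WP_seq, WP_set, WP_store, NExp.Ok, NExp.eval, h23, e6, e11, hx1, State.setReg_reg,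
      State.setReg_arr, State.setArr_arr, State.setArr_reg, Nat.reduceEqDiff, if_true, if_false,
      Nat.reduceLT, true_or, true_and, true_imp_iff]
    have hlt : ∀ t, 1 + t % (n - 1) ≤ n - 1 := fun t => by
      have := Nat.mod_lt t (show 0 < n - 1 by omega)
      omega
    refine ⟨fun hs => (Nat.mod_le _ _).trans_lt (hs23 hs),
      fun hs => (Nat.div_le_self _ _).trans_lt ?_, fun hs => (hlt _).trans_lt ?_,
      fun hs => (Nat.div_le_self _ _).trans_lt ?_, ?_, fun i' hi' => ?_⟩
    · have := hs.reg 23 (by norm_num); simpa [h23] using this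
    · have := hs.reg 6 (by norm_num); simpa [e6] using this
    · have := hs.reg 24 (by norm_num); simpa using this
    · rw [Nat.div_div_eq_div_mul, pow_succ]
    · simp only [Function.update_apply]
      split_ifs with h
      · rw [h]; exact ⟨rfl, rfl⟩
      · exact hI i' (by omega)
  · rintro s1 hf - ⟨-, hI⟩
    simpa [hc.reg8] using hI

theorem labels_spec (hc : Ctx G q r s) (ho : s.reg 22 = off)
    (hanc : ∀ a < n, ∀ u < n, s.arr 5 (off + a * n + u) = anc a u)
    (h01 : ∀ a < n, ∀ u < n, anc a u ≤ 1) (hv : ∀ i < r, s.arr 7 i = v i ∧ v i < n)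
    (hd : ∀ i < r, s.arr 8 i = d i ∧ d i < q) (hrq : r * q < 2 ^ w) :
    labels.WP w s fun s' => (∀ i < r + 1, s'.arr 7 i = nod r v i) ∧
      (∀ i < r + 1, s'.arr 9 i = top r q anc v d i) ∧
      (∀ i < r + 1, s'.arr 10 i = bot r q anc v d i) ∧
      ∀ i < r + 1, s'.arr 11 i = lbl r q anc v d i := by
  -- All partial sums of increments stay below r · q, so they fit into a word before the reduction
  -- modulo `q`.
  have hsum : ∀ i ≤ r, ∀ g : ℕ → ℕ, (∀ t < r, g t ≤ 1) →
      ∑ t ∈ Finset.range i, d t * g t < 2 ^ w := fun i hi g hg => by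
    refine lt_of_le_of_lt ?_ hrq
    calc _ ≤ ∑ t ∈ Finset.range i, q := Finset.sum_le_sum fun t ht => by
          have ht := Finset.mem_range.1 ht
          have h1 := hg t (by omega)
          have h2 := (hd t (by omega)).2
          nlinarith
      _ ≤ r * q := by simpa using Nat.mul_le_mul_right q hi
  let φ : ℕ → ℕ → ℕ := fun i t => anc (v t) (v i) * (1 - eqN (v t) (v i) * (1 - (1 - (t - i))))
  have hφ : ∀ i < r, ∀ t < r, φ i t ≤ 1 := fun i hi t ht => by
    have h1 := h01 _ (hv t ht).2 _ (hv i hi).2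
    have h2 : 1 - eqN (v t) (v i) * (1 - (1 - (t - i))) ≤ 1 := Nat.sub_le _ _
    calc φ i t ≤ 1 * 1 := Nat.mul_le_mul h1 h2
      _ = 1 := rfl
  unfold labels ancE
  rw [WP_seq]
  refine WP.rep (fun i s' => ∀ i' < i, s'.arr 9 i' = tot r anc v d i' % q ∧
    s'.arr 10 i' = (tot r anc v d i' - d i') % q ∧ s'.arr 11 i' = lab r q anc v d (v i'))
    (by simp) ?_ ?_
  · intro i hi s1 hf hx1 hI
    rw [hc.reg8] at hi
    have e8 : s1.reg 8 = r := by rw [hf.reg 8 (by simp [regs]), hc.reg8]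
    have e0 : s1.reg 0 = n := by rw [hf.reg 0 (by simp [regs]), hc.reg0]
    have e10 : s1.reg 10 = q := by rw [hf.reg 10 (by simp [regs]), hc.reg10]
    have e22 : s1.reg 22 = off := by rw [hf.reg 22 (by simp [regs]), ho]
    have a5 : s1.arr 5 = s.arr 5 := hf.arr 5 (by simp [arrs])
    have a7 : s1.arr 7 = s.arr 7 := hf.arr 7 (by simp [arrs])
    have a8 : s1.arr 8 = s.arr 8 := hf.arr 8 (by simp [arrs])
    simp only [WP_seq, WP_set, NExp.Ok, NExp.eval, true_and]
    refine ⟨fun _ _ => by positivity, fun _ _ => by positivity, ?_⟩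
    refine WP.rep (fun t s' => s'.reg 24 = ∑ t' ∈ Finset.range t, d t' * φ i t' ∧
      s'.reg 25 = ∑ t' ∈ Finset.range t, d t' * anc (v t') (v i)) (by simp) ?_ ?_
    · rintro t ht s2 hf2 hx2 ⟨h24, h25⟩
      simp only [State.setReg_reg, e8, Nat.reduceEqDiff, if_false] at ht
      have f0 : s2.reg 0 = n := by rw [hf2.reg 0 (by simp [regs])]; simp [e0]
      have f14 : s2.reg 14 = i := by rw [hf2.reg 14 (by simp [regs])]; simp [hx1]
      have f22 : s2.reg 22 = off := by rw [hf2.reg 22 (by simp [regs])]; simp [e22]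
      have b5 : s2.arr 5 = s.arr 5 := by rw [hf2.arr 5 (by simp [arrs])]; simp [a5]
      have b7 : s2.arr 7 = s.arr 7 := by rw [hf2.arr 7 (by simp [arrs])]; simp [a7]
      have b8 : s2.arr 8 = s.arr 8 := by rw [hf2.arr 8 (by simp [arrs])]; simp [a8]
      simp only [WP_seq, WP_set, NExp.Ok, NExp.eval, eqE_eval, eqE_Ok, h24, h25, f0, f14, f22, b5,
        b7, b8, hx2, (hv i hi).1, (hv t ht).1, (hd t ht).1, hanc _ (hv t ht).2 _ (hv i hi).2,
        State.setReg_reg, State.setReg_arr, Nat.reduceEqDiff, if_true, if_false,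
        Nat.reduceLT, true_or, true_and, and_true, true_imp_iff]
      refine ⟨fun hs => ?_, fun hs => ?_, fun hs => ?_, ?_, ?_⟩
      · rw [← hanc _ (hv t ht).2 _ (hv i hi).2, ← b5]; exact hs.arr 5 (by norm_num) _
      · have := hsum (t + 1) ht (φ i) (hφ i hi)
        rwa [Finset.sum_range_succ] at this
      · have := hsum (t + 1) ht (fun t => anc (v t) (v i))
          fun t ht => h01 _ (hv t ht).2 _ (hv i hi).2
        rwa [Finset.sum_range_succ] at this
      · rw [Finset.sum_range_succ]
      · rw [Finset.sum_range_succ]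
    · rintro s2 hf2 - ⟨h24, h25⟩
      simp only [State.setReg_reg, e8, Nat.reduceEqDiff, if_false] at h24 h25
      have f10 : s2.reg 10 = q := by rw [hf2.reg 10 (by simp [regs])]; simp [e10]
      have f14 : s2.reg 14 = i := by rw [hf2.reg 14 (by simp [regs])]; simp [hx1]
      have b8 : s2.arr 8 = s.arr 8 := by rw [hf2.arr 8 (by simp [arrs])]; simp [a8]
      have b9 : s2.arr 9 = s1.arr 9 := by rw [hf2.arr 9 (by simp [arrs])]; simp
      have b10 : s2.arr 10 = s1.arr 10 := by rw [hf2.arr 10 (by simp [arrs])]; simp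
      have b11 : s2.arr 11 = s1.arr 11 := by rw [hf2.arr 11 (by simp [arrs])]; simp
      have ht : ∑ t' ∈ Finset.range r, d t' * φ i t' = tot r anc v d i := rfl
      have ht1 : tot r anc v d i < 2 ^ w := hsum r le_rfl _ (hφ i hi)
      have ht2 : ∑ t' ∈ Finset.range r, d t' * anc (v t') (v i) < 2 ^ w :=
        hsum r le_rfl (fun t => anc (v t) (v i)) fun t ht => h01 _ (hv t ht).2 _ (hv i hi).2
      rw [ht] at h24
      simp only [WP_store, NExp.Ok, NExp.eval, h24, h25, f10, f14, b8, b9, b10, b11, (hd i hi).1,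
        State.setReg_arr, State.setArr_arr, State.setArr_reg, Nat.reduceEqDiff, if_true, if_false,
        Nat.reduceLT, true_or, true_and, and_true, true_imp_iff]
      refine ⟨fun _ => (Nat.mod_le _ _).trans_lt ht1,
        fun _ => (Nat.mod_le _ _).trans_lt ((Nat.sub_le _ _).trans_lt ht1),
        fun _ => (Nat.mod_le _ _).trans_lt ht2, fun i' hi' => ?_⟩
      simp only [Function.update_apply]
      split_ifs with h
      · rw [h]; exact ⟨rfl, rfl, rfl⟩
      · exact hI i' (by omega)
  · intro s1 hf _ hI
    rw [hc.reg8] at hI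
    have e8 : s1.reg 8 = r := by rw [hf.reg 8 (by simp [regs]), hc.reg8]
    have e10 : s1.reg 10 = q := by rw [hf.reg 10 (by simp [regs]), hc.reg10]
    have a7 : s1.arr 7 = s.arr 7 := hf.arr 7 (by simp [arrs])
    simp only [WP_seq, WP_store, NExp.Ok, NExp.eval, e8, e10, a7,
      State.setArr_arr, State.setArr_reg, Nat.reduceEqDiff, if_true, if_false,
      Nat.reduceLT, true_or, true_and, true_imp_iff]
    refine ⟨fun _ => by positivity, fun _ => by positivity, fun hs => ?_, fun _ => by positivity,
      fun i hi => ?_, fun i hi => ?_, fun i hi => ?_, fun i hi => ?_⟩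
    · have := hs.reg 10 (by norm_num); simpa [e10] using this
    all_goals
      rw [Function.update_apply]
      by_cases h : i = r
      · simp [h, nod, top, bot, lbl]
      · have hir : i < r := by omega
        simp [h, hir, nod, top, bot, lbl, hI i hir, hv i hir]

theorem count_spec {f : ℕ → ℕ} (h10 : s.reg 10 = q) (hq : q < 2 ^ w)
    (hf : ∀ i < q, s.arr 11 i = f i) (hfq : ∀ i < q, f i < q) :
    count.WP w s fun s' => s'.reg 27 = ((Finset.range q).image f).card := by
  have hone : ∀ a, 1 - (1 - a) ≤ 1 := fun a => by omega
  have hle : ∀ (g : ℕ → ℕ) (i : ℕ), (∀ t, g t ≤ 1) → i ≤ q →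
      ∑ t ∈ Finset.range i, g t < 2 ^ w := fun g i hg hi => by
    refine lt_of_le_of_lt ?_ hq
    calc _ ≤ ∑ t ∈ Finset.range i, 1 := Finset.sum_le_sum fun t _ => hg t
      _ ≤ q := by simpa using hi
  have heq : ∀ a b, eqN a b ≤ 1 := fun a b => Nat.sub_le _ _
  rw [card_image_eq_sum _ f fun i hi => hfq i (Finset.mem_range.1 hi)]
  unfold count
  simp only [WP_seq, WP_set, NExp.Ok, NExp.eval, true_and]
  refine ⟨fun _ _ => by positivity, WP.rep (fun l s' => s'.reg 27 =
    ∑ l' ∈ Finset.range l, (1 - (1 - ∑ i ∈ Finset.range q, eqN (f i) l'))) (by simp) ?_ ?_⟩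
  · intro l hl s1 hf1 hx1 hI1
    simp only [State.setReg_reg, h10, Nat.reduceEqDiff, if_false] at hl
    have e10 : s1.reg 10 = q := by rw [hf1.reg 10 (by simp [regs])]; simp [h10]
    have a11 : s1.arr 11 = s.arr 11 := by rw [hf1.arr 11 (by simp [arrs])]; simp
    refine ⟨trivial, fun _ _ => by simp, WP.rep (fun t s' => s'.reg 24 =
      ∑ i ∈ Finset.range t, eqN (f i) l) (by simp) ?_ ?_⟩
    · intro t ht s2 hf2 hx2 hI2
      simp only [State.setReg_reg, e10, Nat.reduceEqDiff, if_false] at ht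
      have f14 : s2.reg 14 = l := by rw [hf2.reg 14 (by simp [regs])]; simp [hx1]
      have b11 : s2.arr 11 = s.arr 11 := by rw [hf2.arr 11 (by simp [arrs])]; simp [a11]
      simp only [WP_set, NExp.Ok, NExp.eval, eqE_eval, eqE_Ok, hI2, hx2, f14, b11, hf t ht,
        State.setReg_reg, Nat.reduceEqDiff, if_true, if_false,
        Nat.reduceLT, true_or, true_and, and_true, true_imp_iff]
      have := hle (fun i => eqN (f i) l) (t + 1) (fun i => heq _ _) ht
      rw [Finset.sum_range_succ] at this ⊢
      exact ⟨fun _ => this, rfl⟩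
    · intro s2 hf2 _ hI2
      simp only [State.setReg_reg, e10, Nat.reduceEqDiff, if_false] at hI2
      have f27 : s2.reg 27 = ∑ l' ∈ Finset.range l,
          (1 - (1 - ∑ i ∈ Finset.range q, eqN (f i) l')) := by
        rw [hf2.reg 27 (by simp [regs])]; simp [hI1]
      simp only [WP_set, NExp.Ok, NExp.eval, f27, hI2, State.setReg_reg, Nat.reduceEqDiff, if_true, if_false,
        Nat.reduceLT, true_or, true_and, and_true, true_imp_iff]
      have := hle (fun l => 1 - (1 - ∑ i ∈ Finset.range q, eqN (f i) l)) (l + 1)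
        (fun i => hone _) hl
      rw [Finset.sum_range_succ] at this ⊢
      exact ⟨fun _ => this, rfl⟩
  · intro s1 _ _ hI
    simpa [h10] using hI

theorem weigh_spec {W : ℕ → ℕ → ℝ} {v t b : ℕ → ℕ} (h0 : s.reg 0 = n) (h10 : s.reg 10 = q)
    (hv : ∀ i < q, s.arr 7 i = v i ∧ v i < n) (ht : ∀ i < q, s.arr 9 i = t i)
    (hb : ∀ i < q, s.arr 10 i = b i) (hn : 0 < n)
    (hW : ∀ x < n, ∀ y < n, s.rarr 6 (x * n + y) = W x y) :
    weigh.WP w s fun s' => s'.rarr 7 0 =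
      ∑ i ∈ Finset.range q, ∑ j ∈ Finset.range q, W (v i) (v j) *
        ((eqN (t i) (t j) : ℝ) - eqN (b i) (t j) - eqN (t i) (b j) + eqN (b i) (b j)) - W 0 0 := by
  have hW0 : s.rarr 6 0 = W 0 0 := by simpa using hW 0 hn 0 hn
  unfold weigh
  simp only [WP_seq, WP_rstore, NExp.Ok, RExp.Ok, NExp.eval, RExp.eval, true_and, hW0,
    Nat.cast_zero]
  let φ : ℕ → ℕ → ℝ := fun i j => W (v i) (v j) *
    ((eqN (t i) (t j) : ℝ) - eqN (b i) (t j) - eqN (t i) (b j) + eqN (b i) (b j))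
  refine WP.rep (fun i s' => s'.rarr 7 0 =
    ∑ i' ∈ Finset.range i, ∑ j ∈ Finset.range q, φ i' j - W 0 0) (by simp) ?_ ?_
  · intro i hi s1 hf1 hx1 hI1
    simp only [State.setRArr_reg, h10] at hi
    have e10 : s1.reg 10 = q := by rw [hf1.reg 10 (by simp [regs])]; simp [h10]
    refine WP.rep (fun j s' => s'.rarr 7 0 =
      ∑ i' ∈ Finset.range i, ∑ j ∈ Finset.range q, φ i' j - W 0 0 + ∑ j' ∈ Finset.range j, φ i j')
      (by simp [hI1]) ?_ ?_
    · intro j hj s2 hf2 hx2 hI2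
      rw [e10] at hj
      have f0 : s2.reg 0 = n := by
        rw [hf2.reg 0 (by simp [regs]), hf1.reg 0 (by simp [regs])]; simp [h0]
      have f14 : s2.reg 14 = i := by rw [hf2.reg 14 (by simp [regs]), hx1]
      have ha : s2.arr = s.arr := funext fun a => by
        rw [hf2.arr a (by simp [arrs]), hf1.arr a (by simp [arrs])]; simp
      have r6 : s2.rarr 6 = s.rarr 6 := by
        rw [hf2.rarr 6 (by simp [rarrs]), hf1.rarr 6 (by simp [rarrs])]; simp
      simp only [WP_rstore, NExp.Ok, RExp.Ok, NExp.eval, RExp.eval, eqE_eval, eqE_Ok, f0, f14, hx2,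
        ha, r6, hI2, (hv i hi).1, (hv j hj).1, ht i hi, ht j hj, hb i hi, hb j hj,
        hW _ (hv i hi).2 _ (hv j hj).2, State.setReg_rarr, State.setRArr_rarr, if_true,
        Function.update_self]
      refine ⟨trivial, by simp, ?_⟩
      rw [Finset.sum_range_succ]
      ring
    · intro s2 _ _ hI2
      rw [e10] at hI2
      simp only [State.setReg_rarr, hI2]
      rw [Finset.sum_range_succ]
      ring
  · intro s1 _ _ hI
    simpa [h10] using hI

end
end Code
end KCut

/-! ### The list of the best codes. -/

namespace KCut

theorem vOf_lt {n b x i : ℕ} (hn : 1 < n) : vOf n b x i < n := by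
  have := Nat.mod_lt (dig b x i) (show 0 < n - 1 by omega)
  unfold vOf; omega

theorem vOf_ne_zero {n b x i : ℕ} : vOf n b x i ≠ 0 := by unfold vOf; omega

theorem dOf_lt {n q x i : ℕ} (hn : 1 < n) (hq : 0 < q) : dOf n ((n - 1) * q) x i < q := by
  have hn' : 0 < n - 1 := by omega
  exact Nat.div_lt_of_lt_mul (Nat.mod_lt _ (Nat.mul_pos hn' hq))

theorem CapGraph.codeLab_mul_add {n q r j x : ℕ} {T : ℕ → ℕ → ℕ → ℕ}
    (hx : x < ((n - 1) * q) ^ r) : codeLab n q r T (j * ((n - 1) * q) ^ r + x) =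
      lab r q (T j) (vOf n ((n - 1) * q) x) (dOf n ((n - 1) * q) x) := by
  funext u
  rw [codeLab, Nat.mul_comm j, Nat.mul_add_div (by omega), Nat.div_eq_of_lt hx, add_zero,
    Nat.mul_add_mod, Nat.mod_eq_of_lt hx]

theorem CapGraph.uncut_nonneg {n m : ℕ} {G : CapGraph n m} (l : ℕ → ℕ) : 0 ≤ G.uncut l :=
  Finset.sum_nonneg fun e _ => by split_ifs; exacts [G.cap_nonneg e, le_rfl]

namespace Code

/-- The state `s` lists the best among the valid codes below `X`. -/
structure Best (valid : ℕ → Prop) (U : ℕ → ℝ) (X : ℕ) (s : State) : Prop where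
  codes : ∀ x, (∃ i < s.reg 2, s.arr 12 i = x) ↔ x < X ∧ valid x ∧ U x = s.rarr 8 0
  le : ∀ x < X, valid x → U x ≤ s.rarr 8 0
  -- The record starts at 0, which need not be the weight of any code.
  attained : s.rarr 8 0 = 0 ∨ ∃ x < X, valid x ∧ U x = s.rarr 8 0
  count_le : s.reg 2 ≤ X

section
variable {n m : ℕ} {G : CapGraph n m} {q r w j x off : ℕ} {s : State} {valid valid' : ℕ → Prop}
  {U U' : ℕ → ℝ} {X : ℕ}

theorem Best.congr {s' : State} (h : Best valid U X s) (hv : ∀ x < X, valid x ↔ valid' x)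
    (hU : ∀ x < X, U x = U' x) (h2 : s'.reg 2 = s.reg 2) (h12 : s'.arr 12 = s.arr 12)
    (h8 : s'.rarr 8 = s.rarr 8) : Best valid' U' X s' := by
  refine ⟨fun x => ?_, fun x hx hvx => ?_, ?_, h2 ▸ h.count_le⟩
  · rw [h2, h12, h8, h.codes]
    exact and_congr_right fun hx => by rw [hv x hx, hU x hx]
  · rw [h8, ← hU x hx]; exact h.le x hx ((hv x hx).2 hvx)
  · rw [h8]
    refine h.attained.imp id ?_
    rintro ⟨x, hx, hvx, hUx⟩
    exact ⟨x, hx, (hv x hx).1 hvx, hU x hx ▸ hUx⟩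

theorem Best.frame {p : Code} {s' : State} (h : Best valid U X s) (hf : Frame p s s')
    (h2 : 2 ∉ p.regs) (h12 : 12 ∉ p.arrs) (h8 : 8 ∉ p.rarrs) : Best valid U X s' :=
  h.congr (fun _ _ => Iff.rfl) (fun _ _ => rfl) (hf.reg 2 h2) (hf.arr 12 h12) (hf.rarr 8 h8)

/-- For non-negative weights the initial record excludes nothing: if it is still 0, every valid code
has weight 0 and attains it. -/
theorem Best.codes_iff (h : Best valid U X s) (hU : ∀ x, 0 ≤ U x) (x : ℕ) :
    (∃ i < s.reg 2, s.arr 12 i = x) ↔ x < X ∧ valid x ∧ ∀ x' < X, valid x' → U x' ≤ U x := by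
  rw [h.codes]
  refine and_congr_right fun hx => and_congr_right fun hv => ⟨fun he => ?_, fun hmax => ?_⟩
  · rw [he]; exact h.le
  · refine (h.le x hx hv).antisymm ?_
    rcases h.attained with h0 | ⟨x', hx', hv', he⟩
    · rw [h0]; exact hU x
    · rw [← he]; exact hmax x' hx' hv'

theorem record_spec {k Q : ℕ} (hB : Best valid U X s) (h7 : s.reg 7 = Q) (h12 : s.reg 12 = j)
    (h13 : s.reg 13 = x) (hX : j * Q + x = X) (hw : X + 1 < 2 ^ w) (h27 : k ≤ s.reg 27 ↔ valid X)
    (hr7 : s.rarr 7 0 = U X) (hU : 0 ≤ U X) :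
    (record k).WP w s fun s' => Best valid U (X + 1) s' := by
  -- This covers a tie as well as a new record; in the latter case it is applied to the emptied
  -- list.
  have append : ∀ s1 : State, valid X → (∀ x, (∃ i < s1.reg 2, s1.arr 12 i = x) ↔
      x < X ∧ valid x ∧ U x = U X) → (∀ x < X, valid x → U x ≤ U X) → s1.rarr 8 0 = U X →
      s1.reg 2 ≤ X →
      Best valid U (X + 1) ((s1.setArr 12 (s1.reg 2) X).setReg 2 (s1.reg 2 + 1)) := by
    intro s1 hv hcodes hle h8 hcount
    refine ⟨fun x' => ?_, fun x' hx' hv' => ?_, .inr ⟨X, by omega, hv, by simp [h8]⟩, by simpa⟩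
    · simp only [State.setReg_reg, State.setReg_arr, State.setArr_arr, State.setReg_rarr,
        State.setArr_rarr, if_true, Function.update_apply, h8]
      constructor
      · rintro ⟨i, hi, hix⟩
        split_ifs at hix with h
        · subst hix; exact ⟨by omega, hv, rfl⟩
        · have := (hcodes x').1 ⟨i, by omega, hix⟩
          exact ⟨by omega, this.2⟩
      · rintro ⟨hx', h2⟩
        by_cases h : x' = X
        · exact ⟨s1.reg 2, by omega, by simp [h]⟩
        · obtain ⟨i, hi, hix⟩ := (hcodes x').2 ⟨by omega, h2⟩
          exact ⟨i, by omega, by rw [if_neg (by omega), hix]⟩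
    · simp only [State.setReg_rarr, State.setArr_rarr, h8]
      rcases Nat.lt_succ_iff_lt_or_eq.1 hx' with h | rfl
      · exact hle x' h hv'
      · exact le_rfl
  have keep : ¬ (valid X ∧ U X = s.rarr 8 0) → (valid X → U X ≤ s.rarr 8 0) →
      Best valid U (X + 1) s := by
    intro hne hle
    refine ⟨fun x' => ?_, fun x' hx' hv' => ?_, hB.attained.imp id ?_, by
      have := hB.count_le; omega⟩
    · rw [hB.codes]
      refine ⟨fun h => ⟨by omega, h.2⟩, fun h => ⟨?_, h.2⟩⟩
      refine lt_of_le_of_ne (Nat.lt_succ_iff.1 h.1) ?_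
      rintro rfl; exact hne h.2
    · rcases Nat.lt_succ_iff_lt_or_eq.1 hx' with h | rfl
      · exact hB.le x' h hv'
      · exact hle hv'
    · rintro ⟨x', hx', h⟩; exact ⟨x', by omega, h⟩
  have hcount := hB.count_le
  unfold record
  simp only [WP_seq, WP_cond, WP_skip, WP_rstore, WP_store, WP_set, BExp.Ok, BExp.holds, NExp.Ok,
    RExp.Ok, NExp.eval, RExp.eval, h7, h12, h13, h27, hr7, hX, State.setReg_reg, State.setArr_reg, State.setReg_rarr, State.setRArr_rarr, State.setRArr_reg,
    Nat.reduceEqDiff, if_true, if_false, Function.update_self, le_refl, not_le,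
    Nat.reduceLT, true_or, true_and, and_true, true_imp_iff]
  refine ⟨fun hv => ⟨fun hle => ⟨fun hge => ⟨fun _ => by omega, fun _ => by omega, ?_⟩, fun hlt => ?_⟩,
    fun hlt => ⟨fun _ => by positivity, ⟨fun _ => by omega, fun _ => by omega, ?_⟩,
      fun h => absurd h (lt_irrefl _)⟩⟩, fun hv => ?_⟩
  · have he := hle.antisymm hge
    exact append s hv (by rw [he]; exact hB.codes) (by rw [he]; exact hB.le) he.symm hB.count_le
  · exact keep (fun h => hlt.ne h.2) fun _ => hle
  · have := append ((s.setRArr 8 0 (U X)).setReg 2 0) hv (fun x' => ?_)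
      (fun x' hx' hv' => (hB.le x' hx' hv').trans hlt.le) (by simp) (by simp)
    · simpa using this
    · simp only [State.setReg_reg, if_true]
      refine ⟨by rintro ⟨i, hi, -⟩; omega, fun h => ?_⟩
      have := hB.le x' h.1 h.2.1
      rw [h.2.2] at this
      exact absurd hlt this.not_gt
  · exact keep (fun h => hv h.1) fun h => absurd h hv

/-- One round of the loop over the codes. -/
def round (k : ℕ) : Code := decode ;; labels ;; count ;; weigh ;; record k

theorem round_spec {k : ℕ} {T : ℕ → ℕ → ℕ → ℕ} (hc : Ctx G q r s) (hqr : q = r + 1) (hn : 1 < n)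
    (hj : s.reg 12 = j) (hx : s.reg 13 = x) (hxQ : x < ((n - 1) * q) ^ r) (ho : s.reg 22 = off)
    (hT : IsAncTable n (T j)) (hanc : ∀ a < n, ∀ u < n, s.arr 5 (off + a * n + u) = T j a u)
    (hW : ∀ x < n, ∀ y < n, s.rarr 6 (x * n + y) =
      ∑ e, G.cap e * (T j x (G.fst e) * T j y (G.snd e)))
    (hrq : r * q < 2 ^ w) (hq : q < 2 ^ w) (hX : j * ((n - 1) * q) ^ r + x + 1 < 2 ^ w)
    (hB : Best (fun X => k ≤ ((Finset.range n).image (CapGraph.codeLab n q r T X)).card)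
      (fun X => G.uncut (CapGraph.codeLab n q r T X)) (j * ((n - 1) * q) ^ r + x) s) :
    (round k).WP w s fun s' =>
      Best (fun X => k ≤ ((Finset.range n).image (CapGraph.codeLab n q r T X)).card)
        (fun X => G.uncut (CapGraph.codeLab n q r T X)) (j * ((n - 1) * q) ^ r + (x + 1)) s' := by
  set b := (n - 1) * q with hb
  have hq0 : 0 < q := by omega
  have h01 : ∀ a < n, ∀ u < n, T j a u ≤ 1 := fun a ha u hu => by
    rcases hT.zero_or_one a ha u hu with h | h <;> omega
  have hv : ∀ i, vOf n b x i < n := fun i => vOf_lt hn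
  have hd : ∀ i, dOf n b x i < q := fun i => dOf_lt hn hq0
  refine WP.seq (decode_spec hc hx hn) fun s1 hf1 h1 => ?_
  have c1 : Ctx G q r s1 := hc.frame hf1 (by simp [decode, regs]) (by simp [decode, arrs])
  refine WP.seq (labels_spec c1 (by rw [hf1.reg 22 (by simp [decode, regs]), ho])
    (by rw [hf1.arr 5 (by simp [decode, arrs])]; exact hanc) h01
    (fun i hi => ⟨(h1 i hi).1, hv i⟩) (fun i hi => ⟨(h1 i hi).2, hd i⟩) hrq) fun s2 hf2 h2 => ?_
  have c2 : Ctx G q r s2 := c1.frame hf2 (by simp [labels, regs]) (by simp [labels, arrs])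
  obtain ⟨h27, h29, h210, h211⟩ := h2
  rw [← hqr] at h27 h29 h210 h211
  refine WP.seq (count_spec c2.reg10 hq h211 fun i hi => ?_) fun s3 hf3 h3 => ?_
  · unfold lbl; split_ifs
    · exact lab_lt hq0 _
    · exact hq0
  have c3 : Ctx G q r s3 := c2.frame hf3 (by simp [count, regs]) (by simp [count, arrs])
  have a3 : s3.arr = s2.arr := funext fun a => hf3.arr a (by simp [count, arrs])
  have r3 : s3.rarr = s.rarr := funext fun a => by
    rw [hf3.rarr a (by simp [count, rarrs]), hf2.rarr a (by simp [labels, rarrs]),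
      hf1.rarr a (by simp [decode, rarrs])]
  refine WP.seq (weigh_spec (n := n) (q := q) (v := nod r (vOf n b x))
    (W := fun x y => ∑ e, G.cap e * (T j x (G.fst e) * T j y (G.snd e))) c3.reg0 c3.reg10
    (fun i hi => ⟨by rw [a3]; exact h27 i hi, by unfold nod; split_ifs; exacts [hv i, by omega]⟩)
    (by rw [a3]; exact h29) (by rw [a3]; exact h210) (by omega) (by rw [r3]; exact hW))
    fun s4 hf4 h4 => ?_
  -- This identifies the sum computed by `weigh` with the capacity inside the parts.
  have hU := sum_weight_eq (r := r) (d := dOf n b x) Finset.univ G.cap (fun e => (G.fst e : ℕ))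
    (fun e => (G.snd e : ℕ)) (fun e _ => Fin.is_lt _) (fun e _ => Fin.is_lt _) _
    (fun _ _ _ _ => rfl) hT (by omega) (fun i _ => hv i) hq0
  rw [← hqr] at hU
  rw [hU] at h4
  have hlab := CapGraph.codeLab_mul_add (j := j) (T := T) hxQ
  rw [← hb] at hlab
  refine (record_spec (k := k) (Q := b ^ r) (j := j) (x := x) (hB.congr (fun _ _ => Iff.rfl) (fun _ _ => rfl)
    ?_ ?_ ?_) ?_ ?_ ?_ rfl hX ?_ ?_ (CapGraph.uncut_nonneg _)).mono fun s5 hf5 h5 => h5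
  · rw [hf4.reg 2 (by simp [weigh, regs]), hf3.reg 2 (by simp [count, regs]),
      hf2.reg 2 (by simp [labels, regs]), hf1.reg 2 (by simp [decode, regs])]
  · rw [hf4.arr 12 (by simp [weigh, arrs]), a3, hf2.arr 12 (by simp [labels, arrs]),
      hf1.arr 12 (by simp [decode, arrs])]
  · rw [hf4.rarr 8 (by simp [weigh, rarrs]), r3]
  · rw [hf4.reg 7 (by simp [weigh, regs]), c3.reg7]
  · rw [hf4.reg 12 (by simp [weigh, regs]), hf3.reg 12 (by simp [count, regs]),
      hf2.reg 12 (by simp [labels, regs]), hf1.reg 12 (by simp [decode, regs]), hj]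
  · rw [hf4.reg 13 (by simp [weigh, regs]), hf3.reg 13 (by simp [count, regs]),
      hf2.reg 13 (by simp [labels, regs]), hf1.reg 13 (by simp [decode, regs]), hx]
  · have himg := image_lbl (r := r) (q := q) (d := dOf n b x) hT (by omega) (fun i _ => hv i)
      fun i _ => vOf_ne_zero
    rw [← hqr] at himg
    rw [hf4.reg 27 (by simp [weigh, regs]), h3, hlab, ← himg]
  · rw [h4, hlab]; rfl

end
end Code
end KCut

/-! ### The loop over the trees. -/

namespace KCut

theorem CapGraph.TreeTable.congr {n m : ℕ} {G : CapGraph n m} {F : Finset (Fin m)}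
    {anc anc' : ℕ → ℕ → ℕ} (h : G.TreeTable F anc) (ha : ∀ a < n, ∀ u < n, anc a u = anc' a u) :
    G.TreeTable F anc' := by
  obtain ⟨h0, D, hD, hanc⟩ := h
  exact ⟨h0, D, hD, fun a u => ha a a.2 u u.2 ▸ hanc a u⟩

namespace Code

/-- The tables of ancestors that are stored in the array `A`. -/
def tab (n : ℕ) (A : ℕ → ℕ) (j a u : ℕ) : ℕ :=
  if a < n ∧ u < n then A (j * (n * n) + a * n + u) else 0

section
variable {n m : ℕ} {G : CapGraph n m} {q r w j L : ℕ} {s : State}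

theorem tab_eq (A : ℕ → ℕ) {a u : ℕ} (ha : a < n) (hu : u < n) :
    tab n A j a u = A (j * (n * n) + a * n + u) := by rw [tab, if_pos ⟨ha, hu⟩]

/-- Later trees are written beyond the tables of the earlier ones, so codes already recorded keep
their meaning. Being cut off outside the nodes, the tables agree as functions. -/
theorem tab_congr {A A' : ℕ → ℕ} {j' : ℕ} (h : ∀ i < j * (n * n), A i = A' i) (hj : j' < j) :
    tab n A j' = tab n A' j' := by
  funext a u
  unfold tab
  split_ifs with hau
  · apply h
    have h1 := idx_lt hau.1 hau.2
    have h2 : (j' + 1) * (n * n) ≤ j * (n * n) := Nat.mul_le_mul_right _ hj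
    rw [add_mul] at h2
    omega
  · rfl

theorem listSet_congr {c c' : ℕ → ℕ} (h : ∀ i < n, c (j * n + i) = c' (j * n + i)) :
    listSet n m c j = listSet n m c' j := by
  ext e
  simp only [listSet, Finset.mem_filter, Finset.mem_univ, true_and]
  exact exists_congr fun i => and_congr_right fun hi => by rw [h i hi]

/-- Nothing is known about the size of the solver's numbers in general. The bound `m` on the listed
cells is used here once; the copy is then covered by `Small`. -/
theorem cells_spec (h0 : s.reg 0 = n) (h4 : s.reg 4 = L) (hm : m < 2 ^ w)
    (hcell : ∀ j < L, ∀ i < n, s.arr 102 (j * n + i) ≤ m) :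
    cells.WP w s fun s' => ∀ j < L, ∀ i < n, s'.arr 4 (j * n + i) = s.arr 102 (j * n + i) := by
  unfold cells
  refine WP.rep (fun t s' => ∀ j < t, ∀ i < n, s'.arr 4 (j * n + i) = s.arr 102 (j * n + i))
    (by simp) ?_ ?_
  · intro t ht s1 hf1 hx1 hI1
    rw [h4] at ht
    have e0 : s1.reg 0 = n := by rw [hf1.reg 0 (by simp [regs]), h0]
    have a102 : s1.arr 102 = s.arr 102 := hf1.arr 102 (by simp [arrs])
    refine WP.rep (fun u s' => (∀ j < t, ∀ i < n, s'.arr 4 (j * n + i) = s.arr 102 (j * n + i)) ∧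
      ∀ i < u, s'.arr 4 (t * n + i) = s.arr 102 (t * n + i)) ⟨by simpa using hI1, by simp⟩ ?_ ?_
    · rintro u hu s2 hf2 hx2 ⟨hI2, hI2'⟩
      rw [e0] at hu
      have f0 : s2.reg 0 = n := by rw [hf2.reg 0 (by simp [regs]), e0]
      have f12 : s2.reg 12 = t := by rw [hf2.reg 12 (by simp [regs]), hx1]
      have b102 : s2.arr 102 = s.arr 102 := by rw [hf2.arr 102 (by simp [arrs]), a102]
      have hlt := (hcell t ht u hu).trans_lt hm
      simp only [WP_store, NExp.Ok, NExp.eval, f0, f12, hx2, b102, hlt, State.setReg_arr,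
        State.setArr_arr, if_true, Function.update_apply]
      refine ⟨by simp, by simp, by simp, fun j hj i hi => ?_, fun i hi => ?_⟩
      · rw [if_neg (by rw [idx_inj hi hu]; omega), hI2 j hj i hi]
      · split_ifs with h
        · rw [h]
        · exact hI2' i (lt_of_le_of_ne (Nat.lt_succ_iff.1 hi) fun h' => h (by rw [h']))
    · rintro s2 - - ⟨h1, h2⟩ j hj i hi
      rw [e0] at h2
      simp only [State.setReg_arr]
      rcases Nat.lt_succ_iff_lt_or_eq.1 hj with h | rfl
      · exact h1 j h i hi
      · exact h2 i hi
  · intro s1 _ _ hI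
    rwa [h4] at hI

/-- The property that is kept by the loop over the trees. -/
structure Inv (G : CapGraph n m) (k q r : ℕ) (c : ℕ → ℕ) (j : ℕ) (s : State) : Prop where
  zero : ∀ i, j * (n * n) ≤ i → s.arr 5 i = 0
  tree : ∀ j' < j, G.TreeTable (listSet n m c j') (tab n (s.arr 5) j')
  best : Best (fun X => k ≤ ((Finset.range n).image
      (CapGraph.codeLab n q r (tab n (s.arr 5)) X)).card)
    (fun X => G.uncut (CapGraph.codeLab n q r (tab n (s.arr 5)) X)) (j * ((n - 1) * q) ^ r) s

/-- The part of the program for one tree. -/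
def treeRound (k : ℕ) : Code := tree ;; (rmat ;; wmat) ;; rep 13 7 (round k)

theorem treeRound_spec {k : ℕ} {c : ℕ → ℕ} (hw : 1 ≤ w) (hc : Ctx G q r s) (hqr : q = r + 1)
    (hn : 1 < n) (hcell : ∀ i < n, s.arr 4 (j * n + i) ≤ m)
    (hcc : ∀ i < n, s.arr 4 (j * n + i) = c (j * n + i)) (hj : s.reg 12 = j)
    (hC : ∀ u < n, ∀ v < n, s.rarr 4 (u * n + v) =
      ∑ e, if (G.fst e : ℕ) = u ∧ (G.snd e : ℕ) = v then G.cap e else 0)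
    (hoff : j * (n * n) < 2 ^ w) (hrq : r * q < 2 ^ w) (hq : q < 2 ^ w)
    (hX : (j + 1) * ((n - 1) * q) ^ r < 2 ^ w) (hI : Inv G k q r c j s) :
    (treeRound k).WP w s fun s' => Inv G k q r c (j + 1) s' := by
  set Q := ((n - 1) * q) ^ r with hQ
  have hQ0 : 0 < Q := Nat.pow_pos (Nat.mul_pos (by omega) (by omega))
  refine WP.seq (tree_spec hw hc hcell hj (by omega) hoff hI.zero) ?_
  rintro s1 hf1 ⟨h22, htree, hbelow, hzero⟩
  have c1 : Ctx G q r s1 := hc.frame hf1 (by simp [tree, pick, attach, regs])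
    (by simp [tree, pick, attach, arrs])
  have hT : G.TreeTable (listSet n m c j) (tab n (s1.arr 5) j) := by
    rw [← listSet_congr hcc]
    exact htree.congr fun a ha u hu => (tab_eq _ ha hu).symm
  have htab : ∀ j' < j, tab n (s.arr 5) j' = tab n (s1.arr 5) j' := fun j' hj' =>
    tab_congr (fun i hi => (hbelow i hi).symm) hj'
  -- The quotient of a code by `Q` is the number of its tree, so codes below `j * Q` use only the
  -- earlier tables.
  have hlab : ∀ X < j * Q, CapGraph.codeLab n q r (tab n (s.arr 5)) X =
      CapGraph.codeLab n q r (tab n (s1.arr 5)) X := fun X hX => by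
    funext u
    unfold CapGraph.codeLab
    rw [htab _ (Nat.div_lt_of_lt_mul (by rwa [mul_comm]))]
  have hB1 : Best (fun X => k ≤ ((Finset.range n).image
      (CapGraph.codeLab n q r (tab n (s1.arr 5)) X)).card)
    (fun X => G.uncut (CapGraph.codeLab n q r (tab n (s1.arr 5)) X)) (j * Q) s1 :=
    hI.best.congr (fun X hX => by rw [hlab X hX]) (fun X hX => by rw [hlab X hX])
      (hf1.reg 2 (by simp [tree, pick, attach, regs]))
      (hf1.arr 12 (by simp [tree, pick, attach, arrs]))
      (hf1.rarr 8 (by simp [tree, pick, attach, rarrs]))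
  refine WP.seq (wmat_spec (anc := tab n (s1.arr 5) j) c1.reg0 h22
    (fun a ha u hu => (tab_eq _ ha hu).symm)
    (by rw [hf1.rarr 4 (by simp [tree, pick, attach, rarrs])]; exact hC)) fun s2 hf2 hW => ?_
  have c2 : Ctx G q r s2 := c1.frame hf2 (by simp [rmat, wmat, regs]) (by simp [rmat, wmat, arrs])
  have b5 : s2.arr 5 = s1.arr 5 := hf2.arr 5 (by simp [rmat, wmat, arrs])
  refine WP.rep (fun x s' => Best (fun X => k ≤ ((Finset.range n).image
      (CapGraph.codeLab n q r (tab n (s1.arr 5)) X)).card)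
    (fun X => G.uncut (CapGraph.codeLab n q r (tab n (s1.arr 5)) X)) (j * Q + x) s') ?_ ?_ ?_
  · exact (hB1.frame hf2 (by simp [rmat, wmat, regs]) (by simp [rmat, wmat, arrs])
      (by simp [rmat, wmat, rarrs])).congr (fun _ _ => Iff.rfl) (fun _ _ => rfl) (by simp)
      (by simp) (by simp)
  · intro x hx s3 hf3 hx3 hI3
    rw [c2.reg7] at hx
    have c3 : Ctx G q r s3 := c2.frame hf3
      (by simp [round, decode, labels, count, weigh, record, regs])
      (by simp [round, decode, labels, count, weigh, record, arrs])
    refine (round_spec (j := j) (off := j * (n * n)) c3 hqr hn ?_ hx3 hx ?_ hT.isAncTable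
      (fun a ha u hu => ?_) ?_ hrq hq ?_ hI3).mono fun s4 hf4 h4 =>
      h4.congr (fun _ _ => Iff.rfl) (fun _ _ => rfl) (by simp) (by simp) (by simp)
    · rw [hf3.reg 12 (by simp [round, decode, labels, count, weigh, record, regs]),
        hf2.reg 12 (by simp [rmat, wmat, regs]),
        hf1.reg 12 (by simp [tree, pick, attach, regs]), hj]
    · rw [hf3.reg 22 (by simp [round, decode, labels, count, weigh, record, regs]),
        hf2.reg 22 (by simp [rmat, wmat, regs]), h22]
    · rw [tab_eq _ ha hu, hf3.arr 5 (by simp [round, decode, labels, count, weigh, record, arrs]),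
        b5]
    · rw [hf3.rarr 6 (by simp [round, decode, labels, count, weigh, record, rarrs])]
      exact hW
    · rw [add_mul, one_mul] at hX
      rw [← hQ] at hx ⊢
      omega
  · intro s3 hf3 _ hI3
    have d5 : s3.arr 5 = s1.arr 5 := by
      rw [hf3.arr 5 (by simp [round, decode, labels, count, weigh, record, arrs]), b5]
    rw [c2.reg7] at hI3
    refine ⟨fun i hi => by rw [d5]; exact hzero i hi, fun j' hj' => ?_, ?_⟩
    · rw [d5]
      rcases Nat.lt_succ_iff_lt_or_eq.1 hj' with h | rfl
      · rw [← htab j' h]; exact hI.tree j' h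
      · exact hT
    · rw [d5, add_mul, one_mul]; exact hI3

theorem main_spec {k : ℕ} (hw : 1 ≤ w) (hc : Ctx G q r s) (hqr : q = r + 1) (hn : 1 < n)
    (h4 : s.reg 4 = L) (hcell : ∀ j < L, ∀ i < n, s.arr 102 (j * n + i) ≤ m)
    (hcap : ∀ e : Fin m, s.rarr 0 e = G.cap e) (h2 : s.reg 2 = 0) (ha5 : ∀ i, s.arr 5 i = 0)
    (hr4 : ∀ i, s.rarr 4 i = 0) (hr8 : s.rarr 8 0 = 0)
    (hoff : L * (n * n) < 2 ^ w) (hrq : r * q < 2 ^ w) (hq : q < 2 ^ w) (hm : m < 2 ^ w)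
    (hX : L * ((n - 1) * q) ^ r < 2 ^ w) :
    (main k).WP w s fun s' => Inv G k q r (s.arr 102) L s' := by
  unfold main
  refine WP.seq (cells_spec hc.reg0 h4 hm hcell) fun s1 hf1 h1 => ?_
  have c1 : Ctx G q r s1 := hc.frame hf1 (by simp [cells, regs]) (by simp [cells, arrs])
  refine WP.seq (cmat_spec c1 (by rw [hf1.rarr 0 (by simp [cells, rarrs])]; exact hcap)
    (by rw [hf1.rarr 4 (by simp [cells, rarrs])]; exact hr4)) fun s2 hf2 hC => ?_
  have c2 : Ctx G q r s2 := c1.frame hf2 (by simp [cmat, regs]) (by simp [cmat, arrs])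
  have f4 : s2.reg 4 = L := by
    rw [hf2.reg 4 (by simp [cmat, regs]), hf1.reg 4 (by simp [cells, regs]), h4]
  have f2 : s2.reg 2 = 0 := by
    rw [hf2.reg 2 (by simp [cmat, regs]), hf1.reg 2 (by simp [cells, regs]), h2]
  have b4 : s2.arr 4 = s1.arr 4 := hf2.arr 4 (by simp [cmat, arrs])
  have b5 : s2.arr 5 = s.arr 5 := by
    rw [hf2.arr 5 (by simp [cmat, arrs]), hf1.arr 5 (by simp [cells, arrs])]
  have b8 : s2.rarr 8 = s.rarr 8 := by
    rw [hf2.rarr 8 (by simp [cmat, rarrs]), hf1.rarr 8 (by simp [cells, rarrs])]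
  refine WP.rep (fun j s' => Inv G k q r (s.arr 102) j s') ?_ ?_ ?_
  · refine ⟨fun i _ => by simp [b5, ha5], by simp, fun x => ?_, ?_, .inl ?_, ?_⟩
    · simp [f2]
    · simp
    · simp [b8, hr8]
    · simp [f2]
  · intro j hj s3 hf3 hx3 hI3
    rw [f4] at hj
    have c3 : Ctx G q r s3 := c2.frame hf3
      (by simp [tree, pick, attach, rmat, wmat, decode, labels, count, weigh, record, regs])
      (by simp [tree, pick, attach, rmat, wmat, decode, labels, count, weigh, record, arrs])
    have d4 : s3.arr 4 = s1.arr 4 := by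
      rw [hf3.arr 4 (by simp [tree, pick, attach, rmat, wmat, decode, labels, count, weigh,
        record, arrs]), b4]
    refine WP.mono (treeRound_spec (k := k) (c := s.arr 102) (j := j) hw c3 hqr hn ?_ ?_ hx3 ?_ ?_
      hrq hq ?_ hI3) fun s4 hf4 h4 => ⟨?_, ?_, ?_⟩
    · intro i hi; rw [d4, h1 j hj i hi]; exact hcell j hj i hi
    · intro i hi; rw [d4, h1 j hj i hi]
    · rw [hf3.rarr 4 (by simp [tree, pick, attach, rmat, wmat, decode, labels, count, weigh,
        record, rarrs])]
      exact hC
    · exact (Nat.mul_le_mul_right _ hj.le).trans_lt hoff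
    · exact (Nat.mul_le_mul_right _ hj).trans_lt hX
    · simpa using h4.zero
    · simpa using h4.tree
    · exact h4.best.congr (fun _ _ => Iff.rfl) (fun _ _ => rfl) (by simp) (by simp) (by simp)
  · intro s3 _ _ hI
    rwa [f4] at hI

end
end Code
end KCut

/-! ### Correctness of the reporting program. -/

namespace KCut
namespace Code

section
variable {n m : ℕ} {G : CapGraph n m} {q r w j L X : ℕ} {s : State}

/-- The labels of all nodes are recomputed from the stored table of ancestors, and an edge is
reported if its ends have different labels. No real number is read. -/
theorem report_spec (hw : 1 ≤ w) (hc : Ctx G q r s) (hn : 1 < n) (hq : 0 < q)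
    (hX : s.arr 12 (s.reg 3) = X) (hXL : X < L * ((n - 1) * q) ^ r)
    (hT : IsAncTable n (tab n (s.arr 5) (X / ((n - 1) * q) ^ r)))
    (hoff : L * (n * n) < 2 ^ w) (hrq : r * q < 2 ^ w) :
    report.WP w s fun s' => ∀ e : Fin m, s'.arr 3 e =
      if e ∈ G.cutOf (CapGraph.codeLab n q r (tab n (s.arr 5)) X) then 1 else 0 := by
  have h1w : 1 < 2 ^ w := Nat.one_lt_two_pow (by omega)
  set Q := ((n - 1) * q) ^ r with hQ
  set j := X / Q with hjd
  set x := X % Q with hxd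
  have hjL : j < L := Nat.div_lt_of_lt_mul (by rwa [mul_comm])
  have hj : j * (n * n) < 2 ^ w := (Nat.mul_le_mul_right _ hjL.le).trans_lt hoff
  set v := vOf n ((n - 1) * q) x with hvd
  set d := dOf n ((n - 1) * q) x with hdd
  have hv : ∀ i, v i < n := fun i => vOf_lt hn
  have hd : ∀ i, d i < q := fun i => dOf_lt hn hq
  unfold report
  simp only [WP_seq, WP_set, NExp.Ok, NExp.eval, hX, hc.reg5, hc.reg7, State.setReg_reg,
    State.setReg_arr, Nat.reduceEqDiff, if_true, if_false, Nat.reduceLT, true_or, true_and,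
    and_true, true_imp_iff, ← hQ, ← hjd, ← hxd]
  have hsX : Small w s → X < 2 ^ w := fun hs => hX ▸ hs.arr 12 (by norm_num) _
  refine ⟨fun hs => (Nat.div_le_self _ _).trans_lt (hsX hs), fun hs => ?_, fun _ => hj, ?_⟩
  · refine (Nat.mod_le _ _).trans_lt ?_
    have := hs.arr 12 (by norm_num) (s.reg 3)
    simpa [hX] using this
  set s0 := ((s.setReg 12 j).setReg 13 x).setReg 22 (j * (n * n)) with hs0
  have c0 : Ctx G q r s0 := hc.congr
    (fun y hy => by
      have : y ≠ 12 ∧ y ≠ 13 ∧ y ≠ 22 := by simp at hy; omega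
      simp [hs0, this]) (fun a _ => by simp [hs0])
  refine WP.mono (decode_spec (x := x) c0 (by simp [hs0]) hn) fun s1 hf1 h1 => ?_
  have c1 : Ctx G q r s1 := c0.frame hf1 (by simp [decode, regs]) (by simp [decode, arrs])
  have e22 : s1.reg 22 = j * (n * n) := by rw [hf1.reg 22 (by simp [decode, regs])]; simp [hs0]
  have a5 : s1.arr 5 = s.arr 5 := by rw [hf1.arr 5 (by simp [decode, arrs])]; simp [hs0]
  have hanc : ∀ a < n, ∀ u < n, s1.arr 5 (j * (n * n) + a * n + u) = tab n (s.arr 5) j a u :=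
    fun a ha u hu => by rw [a5, tab_eq _ ha hu]
  have hsum : ∀ u < n, ∀ i ≤ r, ∑ t ∈ Finset.range i, d t * tab n (s.arr 5) j (v t) u < 2 ^ w := by
    intro u hu i hi
    refine lt_of_le_of_lt ?_ hrq
    calc _ ≤ ∑ t ∈ Finset.range i, q := Finset.sum_le_sum fun t ht => by
          have h2 := hd t
          rcases hT.zero_or_one _ (hv t) u hu with h | h <;> rw [h] <;> omega
      _ ≤ r * q := by simpa using Nat.mul_le_mul_right q hi
  refine WP.rep (fun u s' => ∀ u' < u, s'.arr 13 u' = lab r q (tab n (s.arr 5) j) v d u')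
    (by simp) ?_ ?_
  · intro u hu s2 hf2 hx2 hI2
    rw [c1.reg0] at hu
    have c2 : Ctx G q r s2 := c1.frame hf2 (by simp [regs]) (by simp [arrs])
    have f22 : s2.reg 22 = j * (n * n) := by rw [hf2.reg 22 (by simp [regs]), e22]
    have b5 : s2.arr 5 = s1.arr 5 := hf2.arr 5 (by simp [arrs])
    have b7 : s2.arr 7 = s1.arr 7 := hf2.arr 7 (by simp [arrs])
    have b8 : s2.arr 8 = s1.arr 8 := hf2.arr 8 (by simp [arrs])
    simp only [WP_seq, WP_set, NExp.Ok, NExp.eval, true_and]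
    refine ⟨fun _ _ => by positivity, WP.rep (fun t s' => s'.reg 24 =
      ∑ t' ∈ Finset.range t, d t' * tab n (s.arr 5) j (v t') u) (by simp) ?_ ?_⟩
    · intro t ht s3 hf3 hx3 hI3
      simp only [State.setReg_reg, c2.reg8, Nat.reduceEqDiff, if_false] at ht
      have g0 : s3.reg 0 = n := by rw [hf3.reg 0 (by simp [regs])]; simp [c2.reg0]
      have g15 : s3.reg 15 = u := by rw [hf3.reg 15 (by simp [regs])]; simp [hx2]
      have g22 : s3.reg 22 = j * (n * n) := by rw [hf3.reg 22 (by simp [regs])]; simp [f22]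
      have ha : s3.arr = s2.arr := funext fun a => by rw [hf3.arr a (by simp [arrs])]; simp
      simp only [WP_set, NExp.Ok, ancE, NExp.eval, hI3, hx3, g0, g15, g22, ha, b5, b7, b8,
        (h1 t ht).1, (h1 t ht).2, ← hvd, ← hdd, hanc _ (hv t) u hu, State.setReg_reg,
        Nat.reduceEqDiff, if_true, if_false, Nat.reduceLT, true_or, true_and, and_true,
        true_imp_iff]
      have := hsum u hu (t + 1) ht
      rw [Finset.sum_range_succ] at this ⊢
      exact ⟨fun _ => this, rfl⟩
    · intro s3 hf3 _ hI3
      simp only [State.setReg_reg, c2.reg8, Nat.reduceEqDiff, if_false] at hI3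
      have g10 : s3.reg 10 = q := by rw [hf3.reg 10 (by simp [regs])]; simp [c2.reg10]
      have g15 : s3.reg 15 = u := by rw [hf3.reg 15 (by simp [regs])]; simp [hx2]
      have g13 : s3.arr 13 = s2.arr 13 := by rw [hf3.arr 13 (by simp [arrs])]; simp
      simp only [WP_store, NExp.Ok, NExp.eval, hI3, g10, g15, g13, State.setReg_arr,
        State.setArr_arr, Nat.reduceLT, true_or, true_and, true_imp_iff, if_true,
        Function.update_apply]
      refine ⟨fun _ => (Nat.mod_le _ _).trans_lt (hsum u hu r le_rfl), fun u' hu' => ?_⟩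
      split_ifs with h
      · rw [h]; rfl
      · exact hI2 u' (by omega)
  · intro s2 hf2 _ hI2
    rw [c1.reg0] at hI2
    have c2 : Ctx G q r s2 := c1.frame hf2 (by simp [regs]) (by simp [arrs])
    refine WP.rep (fun e s' => ∀ e' : Fin m, (e' : ℕ) < e → s'.arr 3 e' =
      1 - eqN (lab r q (tab n (s.arr 5) j) v d (G.fst e'))
        (lab r q (tab n (s.arr 5) j) v d (G.snd e'))) (by simp) ?_ ?_
    · intro e he s3 hf3 hx3 hI3
      rw [c2.reg1] at he
      have g0 : s3.arr 0 e = G.fst ⟨e, he⟩ := by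
        rw [hf3.arr 0 (by simp [arrs])]; exact c2.fst ⟨e, he⟩
      have g1 : s3.arr 1 e = G.snd ⟨e, he⟩ := by
        rw [hf3.arr 1 (by simp [arrs])]; exact c2.snd ⟨e, he⟩
      have g13 : s3.arr 13 = s2.arr 13 := hf3.arr 13 (by simp [arrs])
      simp only [WP_store, NExp.Ok, NExp.eval, eqE_eval, eqE_Ok, hx3, g0, g1, g13,
        hI2 _ (Fin.is_lt _), State.setReg_arr, State.setArr_arr, Nat.reduceLT, true_or, true_and,
        true_imp_iff, if_true, Function.update_apply]
      refine ⟨fun _ => (Nat.sub_le _ _).trans_lt h1w, fun e' he' => ?_⟩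
      split_ifs with h
      · obtain rfl : e' = ⟨e, he⟩ := Fin.ext h
        rfl
      · exact hI3 e' (by omega)
    · intro s3 _ _ hI3 e
      rw [c2.reg1] at hI3
      have hlab : CapGraph.codeLab n q r (tab n (s.arr 5)) X =
        lab r q (tab n (s.arr 5) j) v d := rfl
      rw [hI3 e e.2, eqN_eq, hlab]
      simp only [CapGraph.cutOf, Finset.mem_filter, Finset.mem_univ, true_and]
      split_ifs <;> simp_all

end
end Code
end KCut

/-! ### Running times, the copy of the input and the constants. -/

namespace KCut

theorem Exec.time_pos {p : Prog} {s s' : State} {t : ℕ} (h : Exec p s s' t) : 0 < t := by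
  induction h <;> omega

theorem CapGraph.small_input {n m w : ℕ} (G : CapGraph n m) (hn : n < 2 ^ w) (hm : m < 2 ^ w) :
    Small w G.input := by
  refine ⟨fun x _ => ?_, fun a _ i => ?_⟩
  · simp only [CapGraph.input]
    split_ifs
    exacts [hn, hm, by positivity]
  · simp only [CapGraph.input]
    split_ifs
    exacts [(Fin.is_lt _).trans hn, (Fin.is_lt _).trans hn, by positivity, by positivity]

namespace Code

/-- The largest number of rounds of nested loops. -/
def vol (ν : ℕ → ℕ) : Code → ℕ
  | skip => 1
  | set _ _ => 1
  | store _ _ _ => 1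
  | rstore _ _ _ => 1
  | seq p q => max (p.vol ν) (q.vol ν)
  | cond _ p q => max (p.vol ν) (q.vol ν)
  | rep _ b p => ν b * p.vol ν

theorem one_le_vol {ν : ℕ → ℕ} {p : Code} (hν : ∀ b ∈ p.bounds, 1 ≤ ν b) : 1 ≤ p.vol ν := by
  induction p with
  | skip | set | store | rstore => exact le_rfl
  | seq p q ih _ | cond b p q ih _ =>
    exact (ih fun b hb => hν b (by simp [bounds, hb])).trans (le_max_left _ _)
  | rep x b p ih =>
    exact Nat.mul_pos (hν b (by simp [bounds])) (ih fun b hb => hν b (by simp [bounds, hb]))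

/-- This splits the time into a factor that depends on the program text only, the time with all loop
bounds equal to 1, and the number of rounds. Bounds of at least 1 allow the overheads to be
absorbed. -/
theorem time_le_vol {ν : ℕ → ℕ} {p : Code} (hν : ∀ b ∈ p.bounds, 1 ≤ ν b) :
    p.time ν ≤ p.time (fun _ => 1) * p.vol ν := by
  induction p with
  | skip | set | store | rstore => simp [time, vol]
  | seq p q ihp ihq =>
    have h1 := ihp fun b hb => hν b (by simp [bounds, hb])
    have h2 := ihq fun b hb => hν b (by simp [bounds, hb])
    have h3 := Nat.mul_le_mul_left (p.time fun _ => 1) (le_max_left (p.vol ν) (q.vol ν))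
    have h4 := Nat.mul_le_mul_left (q.time fun _ => 1) (le_max_right (p.vol ν) (q.vol ν))
    simp only [time, vol, add_mul]
    omega
  | cond b p q ihp ihq =>
    have h0 := one_le_vol hν
    have h1 := ihp fun b hb => hν b (by simp [bounds, hb])
    have h2 := ihq fun b hb => hν b (by simp [bounds, hb])
    have h3 := Nat.mul_le_mul_left (p.time fun _ => 1) (le_max_left (p.vol ν) (q.vol ν))
    have h4 := Nat.mul_le_mul_left (q.time fun _ => 1) (le_max_right (p.vol ν) (q.vol ν))
    simp only [vol] at h0
    have h5 := Nat.mul_le_mul_left (1 + b.wt) h0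
    simp only [time, vol, add_mul] at h5 ⊢
    omega
  | rep x b p ih =>
    have h0 := hν b (by simp [bounds])
    have h1 := ih fun b hb => hν b (by simp [bounds, hb])
    have h2 := one_le_vol (p := p) fun b hb => hν b (by simp [bounds, hb])
    have h3 := Nat.mul_le_mul_left (ν b) h1
    have h4 := Nat.mul_le_mul_left (ν b) h2
    have h5 : ν b * ((p.time fun _ => 1) * p.vol ν) = (p.time fun _ => 1) * (ν b * p.vol ν) := by
      ring
    simp only [time, vol, one_mul, add_mul, mul_add]
    omega

section
variable {n m : ℕ} {G : CapGraph n m} {q r w L k : ℕ} {s : State}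

theorem copyInput_counting : (copyInput k).Counting := by
  simp [copyInput, Counting, regs]

theorem copyInput_bounds : ∀ b ∈ (copyInput k).bounds, b ∉ (copyInput k).regs := by
  simp [copyInput, bounds, regs]

theorem constants_counting : (constants k).Counting := by
  simp [constants, Counting, regs]

theorem constants_bounds : ∀ b ∈ (constants k).bounds, b ∉ (constants k).regs := by
  simp [constants, bounds, regs]

theorem copyInput_spec (hr : 2 * k - 3 < 2 ^ w) :
    (copyInput k).WP w G.input fun s' => Simulates G.input s' ∧ s'.reg 8 = 2 * k - 3 := by
  unfold copyInput
  simp only [WP_seq, WP_set, NExp.Ok, NExp.eval, State.setReg_reg, Nat.reduceEqDiff, if_false,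
    Nat.reduceLT, true_or, true_and, true_imp_iff, false_imp_iff]
  refine ⟨fun _ => hr, WP.rep (fun i s' => (∀ e < i, s'.arr 100 e = G.input.arr 0 e ∧
    s'.arr 101 e = G.input.arr 1 e ∧ s'.rarr 100 e = G.input.rarr 0 e) ∧ ∀ e, m ≤ e →
      s'.arr 100 e = 0 ∧ s'.arr 101 e = 0 ∧ s'.rarr 100 e = 0) ?_ ?_ ?_⟩
  · refine ⟨by simp, fun e he => ?_⟩
    simp [CapGraph.input, not_lt.2 he]
  · rintro i hi s1 hf hx ⟨hI1, hI2⟩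
    have hi : i < m := by simpa [CapGraph.input] using hi
    have a0 : s1.arr 0 = G.input.arr 0 := by rw [hf.arr 0 (by simp [arrs])]; simp
    have a1 : s1.arr 1 = G.input.arr 1 := by rw [hf.arr 1 (by simp [arrs])]; simp
    have r0 : s1.rarr 0 = G.input.rarr 0 := by rw [hf.rarr 0 (by simp [rarrs])]; simp
    simp only [WP_seq, WP_store, WP_rstore, NExp.Ok, RExp.Ok, NExp.eval, RExp.eval, hx, a0, a1, r0,
      State.setReg_arr, State.setReg_rarr, State.setArr_arr, State.setArr_reg, State.setArr_rarr,
      State.setRArr_arr, State.setRArr_rarr, Nat.reduceEqDiff, if_true, if_false, Nat.reduceLT,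
      true_or, true_and, false_imp_iff, Function.update_apply]
    refine ⟨fun e he => ?_, fun e he => ?_⟩
    · split_ifs with h
      · rw [h]; exact ⟨rfl, rfl, rfl⟩
      · exact hI1 e (by omega)
    · rw [if_neg (by omega), if_neg (by omega), if_neg (by omega)]
      exact hI2 e he
  · rintro s1 hf - ⟨hI1, hI2⟩
    simp only [State.setReg_reg, CapGraph.input, Nat.reduceEqDiff, if_true, if_false] at hI1
    have ext : ∀ e, s1.arr 100 e = G.input.arr 0 e ∧ s1.arr 101 e = G.input.arr 1 e ∧
        s1.rarr 100 e = G.input.rarr 0 e := fun e => by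
      by_cases he : e < m
      · exact hI1 e he
      · obtain ⟨h1, h2, h3⟩ := hI2 e (by omega)
        rw [h1, h2, h3]
        simp [CapGraph.input, he]
    refine ⟨⟨fun x => ?_, fun a => ?_, fun a => ?_⟩, ?_⟩
    · rw [hf.reg _ (by simp [regs])]
      rcases x with _ | _ | x
      · simp [CapGraph.input]
      · simp [CapGraph.input]
      · have h1 : ¬ x + 1 + 1 + 100 = 101 := by omega
        have h3 : ¬ x + 1 + 1 + 100 = 8 := by omega
        simp [CapGraph.input, h1, h3]
    · rcases a with _ | _ | a
      · exact funext fun e => (ext e).1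
      · exact funext fun e => (ext e).2.1
      · rw [hf.arr _ (by simp [arrs])]
        funext e
        simp [CapGraph.input]
    · rcases a with _ | a
      · exact funext fun e => (ext e).2.2
      · rw [hf.rarr _ (by simp [rarrs])]
        funext e
        simp [CapGraph.input]
    · rw [hf.reg 8 (by simp [regs])]
      simp

theorem constants_spec (h0 : s.reg 0 = n) (h1 : s.reg 1 = m) (h8 : s.reg 8 = r)
    (hfst : ∀ e : Fin m, s.arr 0 e = G.fst e) (hsnd : ∀ e : Fin m, s.arr 1 e = G.snd e)
    (hL : s.reg 102 = L) (hLw : L < 2 ^ w) (hnw : n * n < 2 ^ w) (hqw : 2 * k - 2 < 2 ^ w)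
    (hbw : (n - 1) * (2 * k - 2) < 2 ^ w) (hQw : ((n - 1) * (2 * k - 2)) ^ r < 2 ^ w)
    (hb : 0 < (n - 1) * (2 * k - 2)) (hw : 1 ≤ w) :
    (constants k).WP w s fun s' => s'.reg 4 = L ∧ Ctx G (2 * k - 2) r s' := by
  unfold constants
  simp only [WP_seq, WP_set, NExp.Ok, NExp.eval, h0, hL, State.setReg_reg, Nat.reduceEqDiff,
    if_true, if_false, Nat.reduceLT, true_or, or_true, true_and, true_imp_iff, hLw, hnw, hqw, hbw]
  refine ⟨fun _ => trivial, fun _ => trivial, fun hs => ?_, fun _ => trivial, fun _ => trivial,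
    fun _ => Nat.one_lt_two_pow (by omega), ?_⟩
  · have := hs.reg 0 (by norm_num)
    simp only [State.setReg_reg, Nat.reduceEqDiff, if_false, h0] at this
    omega
  refine WP.rep (fun i s' => s'.reg 7 = ((n - 1) * (2 * k - 2)) ^ i) (by simp) ?_ ?_
  · intro i hi s1 hf hx hI
    have hi : i < r := by simpa [h8] using hi
    have e11 : s1.reg 11 = (n - 1) * (2 * k - 2) := by rw [hf.reg 11 (by simp [regs])]; simp
    simp only [WP_set, NExp.Ok, NExp.eval, e11, hI, State.setReg_reg, Nat.reduceEqDiff,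
      if_true, if_false, Nat.reduceLT, true_or, true_and, true_imp_iff]
    rw [← pow_succ]
    exact ⟨fun _ => (Nat.pow_le_pow_right hb hi).trans_lt hQw, rfl⟩
  · intro s1 hf _ hI
    simp only [State.setReg_reg, Nat.reduceEqDiff, if_false, h8] at hI
    refine ⟨?_, ?_, ?_, ?_, ?_, hI, ?_, ?_, ?_, fun e => ?_, fun e => ?_⟩
    all_goals first
      | rw [hf.reg _ (by simp [regs])]; simp [h0, h1, h8]
      | rw [hf.arr _ (by simp [arrs])]; simp [hfst, hsnd]

end
end Code
end KCut

/-! ### Bounds for the number of rounds and the word length. -/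

namespace KCut
namespace Code

section
variable {n m : ℕ} {q r k : ℕ}

/-- The loop over the codes dominates: m (n q)^r codes with at most q² rounds each. The n³ rounds
for the tables of a tree fit in because r ≥ 3. -/
theorem main_vol_le {ν : ℕ → ℕ} (h0 : ν 0 = n) (h1 : ν 1 = m) (h4 : ν 4 = m) (h6 : ν 6 = n)
    (h7 : ν 7 = (n * q) ^ r) (h8 : ν 8 = r) (h10 : ν 10 = q) (hr : 3 ≤ r) (hrq : r ≤ q)
    (hn : 1 ≤ n) : (main k).vol ν ≤ m * n ^ r * (q ^ r * (q * q)) := by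
  have e1 : m * n ^ r * (q ^ r * (q * q)) = m * ((n * q) ^ r * (q * q)) := by
    rw [mul_pow]; ring
  rw [e1]
  have h3 : n * (n * n) ≤ (n * q) ^ r := by
    calc n * (n * n) = n ^ 3 := by ring
      _ ≤ n ^ r := Nat.pow_le_pow_right hn hr
      _ ≤ (n * q) ^ r := Nat.pow_le_pow_left (Nat.le_mul_of_pos_right _ (by omega)) _
  have hq2 : 1 ≤ q * q := Nat.mul_pos (by omega) (by omega)
  have h5 : (n * q) ^ r ≤ (n * q) ^ r * (q * q) := Nat.le_mul_of_pos_right _ hq2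
  have hnn : n ≤ n * n := Nat.le_mul_of_pos_right _ hn
  have hnnn : n * n ≤ n * (n * n) := Nat.mul_le_mul_left n hnn
  have hrr : r * r ≤ q * q := Nat.mul_le_mul hrq hrq
  have hr1 : r ≤ r * r := Nat.le_mul_of_pos_right _ (by omega)
  simp only [main, vol, cells, cmat, tree, pick, attach, rmat, wmat, decode, labels, count, weigh,
    record, h0, h1, h4, h6, h7, h8, h10, max_self, mul_one, max_eq_left hn, max_eq_right hn,
    max_eq_left (show 1 ≤ r by omega), max_eq_right (show 1 ≤ r by omega),
    max_eq_left (show 1 ≤ q by omega), max_eq_right (show 1 ≤ q by omega)]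
  refine max_le (Nat.mul_le_mul_left m (by omega)) (max_le
    (Nat.le_mul_of_pos_right m (by omega)) (Nat.mul_le_mul_left m ?_))
  simp only [max_le_iff]
  exact ⟨⟨by omega, by omega, by omega, by omega, by omega⟩, by omega, by omega,
    Nat.mul_le_mul_left _ (by simp only [max_le_iff]; omega)⟩

end
end Code

section
variable {k r q n m : ℕ}

/-- With l = log₂ N ≥ 1 one has N < 2^(2l) and q < 2^q. For N = n + m + 2 the left-hand side bounds
the number m ((n - 1) q)^r of codes, the largest quantity that occurs. -/
theorem exists_wordLength (r q : ℕ) (hr : 1 ≤ r) : ∃ c : ℕ, ∀ N : ℕ, 2 ≤ N →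
    1 ≤ c * Nat.log 2 N ∧ N ^ (r + 1) * q ^ r < 2 ^ (c * Nat.log 2 N) := by
  refine ⟨2 * (r + 1) + q * r, fun N hN => ?_⟩
  set l := Nat.log 2 N with hl
  have hl1 : 1 ≤ l := Nat.log_pos (by norm_num) hN
  have hNl : N < 2 ^ (2 * l) :=
    (Nat.lt_pow_succ_log_self (by norm_num) N).trans_le (Nat.pow_le_pow_right (by norm_num) (by omega))
  refine ⟨Nat.mul_pos (by omega) hl1, ?_⟩
  calc N ^ (r + 1) * q ^ r < (2 ^ (2 * l)) ^ (r + 1) * (2 ^ q) ^ r :=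
        Nat.mul_lt_mul'' (Nat.pow_lt_pow_left hNl (by omega))
          (Nat.pow_lt_pow_left Nat.lt_two_pow_self (by omega))
    _ = 2 ^ (2 * l * (r + 1) + q * r) := by rw [← pow_mul, ← pow_mul, ← pow_add]
    _ ≤ 2 ^ ((2 * (r + 1) + q * r) * l) := Nat.pow_le_pow_right (by norm_num) (by
        have := Nat.mul_le_mul_left (q * r) hl1
        linarith)

/-- The enumerating program for graphs with at least `k` nodes. -/
def enumeration (k : ℕ) (S : Prog) : Prog :=
  .seq (Code.copyInput k).toProg (.seq S.shift (.seq (Code.constants k).toProg (Code.main k).toProg))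

/-- The bound for the numbers that occur in the computation. -/
structure Fits (k n m w : ℕ) : Prop where
  pos : 1 ≤ w
  nodes : n < 2 ^ w
  edges : m < 2 ^ w
  labels : 2 * k - 2 < 2 ^ w
  pairs : m * (n * n) < 2 ^ w
  total : (2 * k - 3) * (2 * k - 2) < 2 ^ w
  codes : m * ((n - 1) * (2 * k - 2)) ^ (2 * k - 3) < 2 ^ w
  square : n * n < 2 ^ w
  base : (n - 1) * (2 * k - 2) < 2 ^ w
  power : ((n - 1) * (2 * k - 2)) ^ (2 * k - 3) < 2 ^ w

theorem exists_fits (hk : 2 < k) : ∃ c, ∀ n m, Fits k n m (c * Nat.log 2 (n + m + 2)) := by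
  obtain ⟨c, hc⟩ := exists_wordLength (2 * k - 3) (2 * k - 2) (by omega)
  refine ⟨c, fun n m => ?_⟩
  obtain ⟨hw, hlt⟩ := hc (n + m + 2) (by omega)
  set w := c * Nat.log 2 (n + m + 2)
  set N := n + m + 2 with hN
  set q := 2 * k - 2 with hq
  set r := 2 * k - 3 with hr
  have hr3 : 3 ≤ r := by omega
  have hq0 : 1 ≤ q := by omega
  have hN1 : 1 ≤ N := by omega
  have hqr : q ≤ q ^ r := Nat.le_self_pow (by omega) q
  have hqr0 : 1 ≤ q ^ r := Nat.pow_pos hq0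
  have hp : ∀ i, i ≤ r + 1 → N ^ i ≤ N ^ (r + 1) * q ^ r := fun i hi =>
    (Nat.pow_le_pow_right hN1 hi).trans (Nat.le_mul_of_pos_right _ hqr0)
  have hq' : ∀ x, x ≤ q ^ r → x < 2 ^ w := fun x hx =>
    (hx.trans (Nat.le_mul_of_pos_left _ (Nat.pow_pos hN1))).trans_lt hlt
  have hP : m * (n * q) ^ r ≤ N ^ (r + 1) * q ^ r := by
    rw [mul_pow, ← mul_assoc]
    refine Nat.mul_le_mul_right _ ?_
    rw [pow_succ, mul_comm]
    exact Nat.mul_le_mul (Nat.pow_le_pow_left (by omega) _) (by omega)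
  have hP' : ((n - 1) * q) ^ r ≤ N ^ (r + 1) * q ^ r := by
    rw [mul_pow]
    exact Nat.mul_le_mul_right _ ((Nat.pow_le_pow_left (by omega) _).trans
      (Nat.pow_le_pow_right hN1 (by omega)))
  have h1 := hp 1 (by omega)
  have h2 := hp 2 (by omega)
  have h3 := hp 3 (by omega)
  rw [pow_one] at h1
  refine ⟨hw, by omega, by omega, hq' _ hqr, lt_of_le_of_lt ?_ hlt, hq' _ ?_,
    lt_of_le_of_lt ?_ hlt, lt_of_le_of_lt ?_ hlt, lt_of_le_of_lt ?_ hlt, hP'.trans_lt hlt⟩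
  · refine le_trans ?_ h3
    calc m * (n * n) ≤ N * (N * N) := Nat.mul_le_mul (by omega) (Nat.mul_le_mul (by omega) (by omega))
      _ = N ^ 3 := by ring
  · calc r * q ≤ q * q := Nat.mul_le_mul_right q (by omega)
      _ = q ^ 2 := by ring
      _ ≤ q ^ r := Nat.pow_le_pow_right hq0 (by omega)
  · refine le_trans ?_ hP
    exact Nat.mul_le_mul_left m (Nat.pow_le_pow_left (Nat.mul_le_mul_right _ (by omega)) _)
  · refine le_trans ?_ h2
    calc n * n ≤ N * N := Nat.mul_le_mul (by omega) (by omega)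
      _ = N ^ 2 := by ring
  · refine Nat.mul_le_mul ?_ hqr
    exact le_trans (by omega : n - 1 ≤ N) (Nat.le_self_pow (by omega) N)

end
end KCut

/-! ### Assembling the enumerating program. -/

namespace KCut

section
variable {k n m w t : ℕ} {G : CapGraph n m} {S : Prog}

theorem CapGraph.isKCut_of_le (G : CapGraph n m) (hkn : k ≤ n) : ∃ A, G.IsKCut k A :=
  ⟨_, isKCut_cutOf (G := G) (fun u => u) (by simpa using hkn)⟩

theorem CapGraph.IsKCut.le {A : Finset (Fin m)} (h : G.IsKCut k A) : k ≤ n := by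
  obtain ⟨P, hP, -⟩ := h
  simpa using hP.trans P.card_parts_le_card

theorem report_runs {s : State} {q r L X : ℕ} (hf : Small w s) (hw : 1 ≤ w)
    (hc : Code.Ctx G q r s) (hn : 1 < n) (hm : 1 ≤ m) (hr : 1 ≤ r) (hq : 0 < q)
    (hX : s.arr 12 (s.reg 3) = X) (hXL : X < L * ((n - 1) * q) ^ r)
    (hT : IsAncTable n (Code.tab n (s.arr 5) (X / ((n - 1) * q) ^ r)))
    (hoff : L * (n * n) < 2 ^ w) (hrq : r * q < 2 ^ w) :
    ∃ s' τ, Exec Code.report.toProg s s' τ ∧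
      τ ≤ Code.report.time (fun _ => 1) * (r * (n + m)) * w ∧
      ∀ e : Fin m, s'.arr 3 e =
        if e ∈ G.cutOf (CapGraph.codeLab n q r (Code.tab n (s.arr 5)) X) then 1 else 0 := by
  let ν : ℕ → ℕ := fun x => if x = 0 then n else if x = 1 then m else r
  have hb : ∀ b ∈ Code.report.bounds, b = 0 ∨ b = 1 ∨ b = 8 := by
    simp [Code.report, Code.bounds, Code.decode]
  obtain ⟨s', τ, hx, hτ, -, -, h⟩ := Code.WP.sound hw ν Code.report_counting Code.report_bounds hf
    (fun b hb' => by
      rcases hb b hb' with rfl | rfl | rfl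
      · exact hc.reg0.le
      · exact hc.reg1.le
      · exact hc.reg8.le) (Code.report_spec hw hc hn hq hX hXL hT hoff hrq)
  refine ⟨s', τ, hx, hτ.trans (Nat.mul_le_mul_right w ((Code.time_le_vol fun b hb' => ?_).trans
    (Nat.mul_le_mul_left _ ?_))), h⟩
  · rcases hb b hb' with rfl | rfl | rfl
    · exact hn.le
    · exact hm
    · exact hr
  · have h1 : r * 1 ≤ r * (n + m) := Nat.mul_le_mul_left r (by omega)
    have h2 : n * r ≤ r * (n + m) := by rw [mul_comm n]; exact Nat.mul_le_mul_left r (by omega)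
    have h3 : 1 * m ≤ r * (n + m) := Nat.mul_le_mul hr (by omega)
    simp only [Code.report, Code.vol, Code.decode, ν, if_true, if_false, max_self, mul_one,
      max_eq_left hr, max_eq_right hr, Nat.reduceEqDiff, one_ne_zero, max_le_iff]
    omega

theorem enumeration_runs (hk : 2 < k) (hpos : ∀ A, G.IsKCut k A → 0 < G.capOf A)
    (hS : G.SolvesLP k S t) (hkn : k ≤ n) (hf : Fits k n m w) :
    G.EnumeratesMinKCuts k (enumeration k S) Code.report.toProg
      (((Code.copyInput k).time (fun _ => 1) + (Code.constants k).time (fun _ => 1) * (2 * k - 3) +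
        (Code.main k).time (fun _ => 1) *
          ((2 * k - 2) ^ (2 * k - 3) * ((2 * k - 2) * (2 * k - 2)))) *
        (m * n ^ (2 * k - 3)) * w + t)
      (Code.report.time (fun _ => 1) * ((2 * k - 3) * (n + m)) * w) := by
  obtain ⟨sS, τS, hxS, hτS, y, z, hopt, hlist⟩ := hS
  set q := 2 * k - 2 with hq
  set r := 2 * k - 3 with hr
  have hw := hf.pos
  -- A `k`-cut of positive capacity contains an edge.
  have hm : 1 ≤ m := by
    obtain ⟨A, hA⟩ := G.isKCut_of_le hkn
    have h := hpos A hA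
    rcases A.eq_empty_or_nonempty with rfl | ⟨e, -⟩
    · simp [CapGraph.capOf] at h
    · exact e.pos
  have hn : 1 < n := by omega
  have hb : 0 < (n - 1) * q := Nat.mul_pos (by omega) (by omega)
  set Q := ((n - 1) * q) ^ r with hQ
  -- the input is copied
  obtain ⟨s1, τ1, hx1, hτ1, hs1, hf1, hsim, h18⟩ := Code.WP.sound hw (fun _ => m)
    (Code.copyInput_counting (k := k)) Code.copyInput_bounds (G.small_input hf.nodes hf.edges)
    (fun b hb => by
      have : b = 1 := by simpa [Code.copyInput, Code.bounds] using hb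
      subst this; simp [CapGraph.input])
    (Code.copyInput_spec (by have := hf.labels; omega))
  have hvol1 : (Code.copyInput k).time (fun _ => m) ≤ (Code.copyInput k).time (fun _ => 1) * m :=
    (Code.time_le_vol fun _ _ => hm).trans (Nat.mul_le_mul_left _ (by
      simp [Code.copyInput, Code.vol, hm]))
  have hlow1 : ∀ x < 100, x ∉ [8, 14] → s1.reg x = G.input.reg x := fun x hx hx' =>
    hf1.reg x (by simp at hx'; simp [Code.copyInput, Code.regs]; omega)
  have halow1 : ∀ a < 100, s1.arr a = G.input.arr a := fun a ha =>
    hf1.arr a (by simp [Code.copyInput, Code.arrs]; omega)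
  have hrlow1 : ∀ a < 100, s1.rarr a = G.input.rarr a := fun a ha =>
    hf1.rarr a (by simp [Code.copyInput, Code.rarrs]; omega)
  -- the linear program is solved
  obtain ⟨s2, hx2, hsim2, hlow2⟩ := hxS.shift hsim
  -- The solver may leave arbitrarily large numbers behind, but only under names from 100 on.
  have hs2 : Small w s2 := ⟨fun x hx => hlow2.reg x hx ▸ hs1.reg x hx,
    fun a ha i => hlow2.arr a ha ▸ hs1.arr a ha i⟩
  have hL : s2.reg 102 = sS.reg 2 := hsim2.reg 2
  have hcells : s2.arr 102 = sS.arr 2 := hsim2.arr 2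
  set L := sS.reg 2 with hLd
  have hLm : L ≤ m := hlist.count_le
  have hfst2 : ∀ e : Fin m, s2.arr 0 e = G.fst e := fun e => by
    rw [hlow2.arr 0 (by norm_num), halow1 0 (by norm_num)]; simp [CapGraph.input]
  have hsnd2 : ∀ e : Fin m, s2.arr 1 e = G.snd e := fun e => by
    rw [hlow2.arr 1 (by norm_num), halow1 1 (by norm_num)]; simp [CapGraph.input]
  have h28 : s2.reg 8 = r := by rw [hlow2.reg 8 (by norm_num), h18]
  -- the constants are computed
  obtain ⟨s3, τ3, hx3, hτ3, hs3, hf3, h34, hc3⟩ := Code.WP.sound hw (fun _ => r)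
    (Code.constants_counting (k := k)) Code.constants_bounds hs2
    (fun b hb => by
      have : b = 8 := by simpa [Code.constants, Code.bounds] using hb
      subst this; exact h28.le)
    (Code.constants_spec (G := G)
      (by rw [hlow2.reg 0 (by norm_num), hlow1 0 (by norm_num) (by simp)]; rfl)
      (by rw [hlow2.reg 1 (by norm_num), hlow1 1 (by norm_num) (by simp)]; rfl) h28 hfst2 hsnd2 hL
      (hLm.trans_lt hf.edges) hf.square hf.labels hf.base hf.power hb hw)
  rw [← hq] at hc3
  have hvol3 : (Code.constants k).time (fun _ => r) ≤ (Code.constants k).time (fun _ => 1) * r :=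
    (Code.time_le_vol fun _ _ => by omega).trans (Nat.mul_le_mul_left _ (by
      simp [Code.constants, Code.vol]; omega))
  have harr3 : s3.arr = s2.arr := funext fun a => hf3.arr a (by simp [Code.constants, Code.arrs])
  have hrarr3 : s3.rarr = s2.rarr :=
    funext fun a => hf3.rarr a (by simp [Code.constants, Code.rarrs])
  have hz : ∀ a < 100, 2 ≤ a → ∀ i, s3.arr a i = 0 := fun a ha ha2 i => by
    rw [harr3, hlow2.arr a ha, halow1 a ha]
    have h0 : a ≠ 0 := by omega
    have h1 : a ≠ 1 := by omega
    simp [CapGraph.input, h0, h1]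
  have hrz : ∀ a < 100, 1 ≤ a → ∀ i, s3.rarr a i = 0 := fun a ha ha1 i => by
    rw [hrarr3, hlow2.rarr a ha, hrlow1 a ha]
    have h0 : a ≠ 0 := by omega
    simp [CapGraph.input, h0]
  have h32 : s3.reg 2 = 0 := by
    rw [hf3.reg 2 (by simp [Code.constants, Code.regs]), hlow2.reg 2 (by norm_num),
      hlow1 2 (by norm_num) (by simp)]
    rfl
  have hLnn : L * (n * n) < 2 ^ w := (Nat.mul_le_mul_right _ hLm).trans_lt hf.pairs
  -- the cuts are enumerated
  let ν : ℕ → ℕ := fun x => if x = 0 then n else if x = 1 then m else if x = 4 then m else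
    if x = 6 then n else if x = 7 then (n * q) ^ r else if x = 8 then r else q
  have hbs : ∀ b ∈ (Code.main k).bounds, b = 0 ∨ b = 1 ∨ b = 4 ∨ b = 6 ∨ b = 7 ∨ b = 8 ∨ b = 10 := by
    simp [Code.main, Code.bounds, Code.cells, Code.cmat, Code.tree, Code.pick, Code.attach,
      Code.rmat, Code.wmat, Code.decode, Code.labels, Code.count, Code.weigh, Code.record]
  obtain ⟨s4, τ4, hx4, hτ4, hs4, hf4, hinv⟩ := Code.WP.sound hw ν (Code.main_counting k)
    (Code.main_bounds k) hs3 (fun b hb => by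
      rcases hbs b hb with rfl | rfl | rfl | rfl | rfl | rfl | rfl
      · exact hc3.reg0.le
      · exact hc3.reg1.le
      · exact h34.le.trans hLm
      · exact hc3.reg6.le.trans (Nat.sub_le _ _)
      · exact hc3.reg7.le.trans (Nat.pow_le_pow_left (Nat.mul_le_mul_right _ (Nat.sub_le _ _)) _)
      · exact hc3.reg8.le
      · exact hc3.reg10.le)
    (Code.main_spec (k := k) hw hc3 (by omega) hn h34
      (fun j hj i hi => by rw [harr3, hcells]; exact hlist.cell_le j hj i hi)
      (fun e => by
        rw [hrarr3, hlow2.rarr 0 (by norm_num), hrlow1 0 (by norm_num)]; simp [CapGraph.input])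
      h32 (hz 5 (by norm_num) (by norm_num)) (hrz 4 (by norm_num) (by norm_num))
      (hrz 8 (by norm_num) (by norm_num) 0) hLnn hf.total hf.labels hf.edges
      ((Nat.mul_le_mul_right _ hLm).trans_lt hf.codes))
  have hvol4 : (Code.main k).time ν ≤ (Code.main k).time (fun _ => 1) *
      (m * n ^ r * (q ^ r * (q * q))) :=
    (Code.time_le_vol fun b hb => by
      rcases hbs b hb with rfl | rfl | rfl | rfl | rfl | rfl | rfl
      · exact hn.le
      · exact hm
      · exact hm
      · exact hn.le
      · exact Nat.pow_pos (Nat.mul_pos (by omega) (by omega))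
      · exact (by omega : 1 ≤ r)
      · exact (by omega : 1 ≤ q)).trans (Nat.mul_le_mul_left _
        (Code.main_vol_le rfl rfl rfl rfl rfl rfl rfl (by omega) (by omega) hn.le))
  have hlistSet : ∀ j, Code.listSet n m (s3.arr 102) j = storedSet n m sS j := fun j => by
    rw [harr3, hcells]; rfl
  have hcover : ∀ A, G.IsMinKCut k A → ∃ X < L * ((n - 1) * q) ^ r,
      k ≤ ((Finset.range n).image (CapGraph.codeLab n q r (Code.tab n (s4.arr 5)) X)).card ∧
        G.cutOf (CapGraph.codeLab n q r (Code.tab n (s4.arr 5)) X) = A := fun A hA =>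
    hA.exists_code hk hq hr hkn hopt hpos hlist.y_unlisted
      fun j hj => by rw [← hlistSet]; exact hinv.tree j hj
  have hc4 : Code.Ctx G q r s4 := hc3.frame hf4
    (by simp [Code.main, Code.regs, Code.cells, Code.cmat, Code.tree, Code.pick, Code.attach,
      Code.rmat, Code.wmat, Code.decode, Code.labels, Code.count, Code.weigh, Code.record])
    (by simp [Code.main, Code.arrs, Code.cells, Code.cmat, Code.tree, Code.pick, Code.attach,
      Code.rmat, Code.wmat, Code.decode, Code.labels, Code.count, Code.weigh, Code.record])
  have hcode := hinv.best.codes_iff fun x => CapGraph.uncut_nonneg _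
  refine ⟨s4, _, .seq hx1 (.seq hx2 (.seq hx3 hx4)), ?_,
    fun i => G.cutOf (CapGraph.codeLab n q r (Code.tab n (s4.arr 5)) (s4.arr 12 i)),
    CapGraph.isMinKCut_iff hcover hcode, fun i hi => ?_⟩
  · have h1 : m * 1 ≤ m * n ^ r := Nat.mul_le_mul_left m (Nat.pow_pos hn.le)
    rw [mul_one] at h1
    have k1 := hτ1.trans (Nat.mul_le_mul_right w (hvol1.trans (Nat.mul_le_mul_left _ h1)))
    have k3 := hτ3.trans (Nat.mul_le_mul_right w (hvol3.trans
      (Nat.le_mul_of_pos_right _ (hm.trans h1))))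
    have k4 := hτ4.trans (Nat.mul_le_mul_right w hvol4)
    have e4 : (Code.main k).time (fun _ => 1) * (m * n ^ r * (q ^ r * (q * q))) * w =
      (Code.main k).time (fun _ => 1) * (q ^ r * (q * q)) * (m * n ^ r) * w := by ring
    rw [e4] at k4
    simp only [add_mul]
    omega
  · obtain ⟨hX, -, -⟩ := (hcode (s4.arr 12 i)).1 ⟨i, hi, rfl⟩
    have hjL : s4.arr 12 i / Q < L := Nat.div_lt_of_lt_mul (by rwa [mul_comm])
    -- A query changes only register 3 among the natural numbers; no constant is kept there, and `i`
    -- is below the content of register 2, hence a word.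
    refine report_runs (s := s4.query i) (L := L) ⟨fun x hx => ?_, fun a ha j => hs4.arr a ha j⟩ hw
      (hc4.congr (fun x hx => ?_) fun a _ => rfl) hn hm (by omega) (by omega) (by simp [State.query])
      hX (hinv.tree _ hjL).isAncTable hLnn hf.total
    · simp only [State.query, Function.update_apply]
      split_ifs
      · exact hi.trans (hs4.reg 2 (by norm_num))
      · exact hs4.reg x hx
    · exact Function.update_of_ne (by rintro rfl; simp at hx) _ _

end
end KCut

theorem mainTheorem7 (k : ℕ) (hk : 2 < k) :
    ∃ C d : ℕ, ∀ S : KCut.Prog, ∃ P D : KCut.Prog,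
      ∀ (β : ℕ → ℕ → ℕ) (n m : ℕ) (G : KCut.CapGraph n m),
        (∀ A, G.IsKCut k A → 0 < G.capOf A) →
        G.SolvesLP k S (β m n) →
        G.EnumeratesMinKCuts k P D
          (C * Nat.log 2 (n + m + 2) ^ d * (m * n ^ (2 * k - 3) + β m n))
          (C * Nat.log 2 (n + m + 2) ^ d * (n + m)) := by
  obtain ⟨c, hc⟩ := KCut.exists_fits hk
  -- Graphs with fewer than `k` nodes have no `k`-cut. For them nothing is done, and register 2,
  -- which is initially 0, announces the empty list.
  set b : KCut.BExp := .le (.const k) (.reg 0) with hb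
  set T := (KCut.Code.copyInput k).time (fun _ => 1) +
    (KCut.Code.constants k).time (fun _ => 1) * (2 * k - 3) + (KCut.Code.main k).time (fun _ => 1) *
      ((2 * k - 2) ^ (2 * k - 3) * ((2 * k - 2) * (2 * k - 2))) with hT
  set R := KCut.Code.report.time (fun _ => 1) * (2 * k - 3) with hR
  -- `T` and `R` pay for enumerating and reporting and `b.wt` for the test, each times the word
  -- length c · log₂(n + m + 2). The summand 2 pays for the solver and the remaining unit steps.
  refine ⟨(T + b.wt) * c + R * c + 2, 1, fun S => ⟨.cond b (KCut.enumeration k S) .skip,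
    KCut.Code.report.toProg, fun β n m G hpos hS => ?_⟩⟩
  have hf := hc n m
  have hl : 1 ≤ Nat.log 2 (n + m + 2) := Nat.log_pos (by norm_num) (by omega)
  rw [pow_one]
  set l := Nat.log 2 (n + m + 2)
  -- Every run takes positive time, so the test can be charged to `β`.
  have hβ : 1 ≤ β m n := by
    obtain ⟨s, τ, hx, hτ, -⟩ := hS
    exact hx.time_pos.trans_le hτ
  have hcost : b.cost G.input ≤ b.wt * (c * l) :=
    b.cost_le hf.pos (G.small_input hf.nodes hf.edges) (by simp [hb])
  by_cases hkn : k ≤ n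
  · obtain ⟨s, τ, hx, hτ, K, hK, hrep⟩ := KCut.enumeration_runs hk hpos hS hkn hf
    refine ⟨s, _, .cond_true (by simpa [hb, KCut.CapGraph.input] using hkn) hx, ?_, K, hK,
      fun i hi => ?_⟩
    · rw [← hT] at hτ
      set M := m * n ^ (2 * k - 3)
      have h1 : b.wt * (c * l) * 1 ≤ b.wt * (c * l) * β m n := Nat.mul_le_mul_left _ hβ
      have h2 : 1 * β m n ≤ l * β m n := Nat.mul_le_mul_right _ hl
      have h3 : ((T + b.wt) * c + R * c + 2) * l * (M + β m n) = T * M * (c * l) +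
        b.wt * (c * l) * β m n + 2 * (l * β m n) + (T * c * l * β m n + b.wt * c * l * M +
          R * c * l * (M + β m n) + 2 * l * M) := by ring
      omega
    · obtain ⟨s', τ', hx', hτ', h'⟩ := hrep i hi
      refine ⟨s', τ', hx', hτ'.trans ?_, h'⟩
      rw [← mul_assoc (KCut.Code.time _ _), ← hR]
      calc R * (n + m) * (c * l) = R * c * (l * (n + m)) := by ring
        _ ≤ ((T + b.wt) * c + R * c + 2) * (l * (n + m)) := Nat.mul_le_mul_right _ (by omega)
        _ = _ := by ring
  · refine ⟨_, _, .cond_false (by simpa [hb, KCut.CapGraph.input] using hkn) (.skip _), ?_,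
      fun _ => ∅, fun A => ⟨fun hA => absurd hA.1.le hkn, ?_⟩, ?_⟩
    · have h1 : b.wt * (c * l) * 1 ≤ b.wt * (c * l) * β m n := Nat.mul_le_mul_left _ hβ
      have h2 : 1 * 1 ≤ l * β m n := Nat.mul_le_mul hl hβ
      set M := m * n ^ (2 * k - 3)
      have h3 : ((T + b.wt) * c + R * c + 2) * l * (M + β m n) = b.wt * (c * l) * β m n +
        2 * (l * β m n) + (T * M * (c * l) + T * c * l * β m n + b.wt * c * l * M +
          R * c * l * (M + β m n) + 2 * l * M) := by ring
      omega
    · rintro ⟨i, hi, -⟩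
      simp [KCut.CapGraph.input] at hi
    · intro i hi
      simp [KCut.CapGraph.input] at hi
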